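/- Let $R$ be a commutative ring and let $\mathcal O$ be an operad in $\mathbb Z$-graded differential graded $R$-modules such that the $\mathcal O$-algebras form a closed model category whose fibrations are the surjections and whose weak equivalences are the quasi-isomorphisms. Let $\mathbf 1=\mathcal O(0)$ be the initial $\mathcal O$-algebra; it is the ground ring $R$ itself when $\mathcal O(0)=R$. Write $\vee$ for coproducts (and pushouts) of $\mathcal O$-algebras and $\mathcal O\langle V\rangle$ for the free graded algebra on a graded module $V$. A morphism $j:A\to B$ of $\mathcal O$-algebras is a *cell extension* if, forgetting differentials, $B\cong A\vee\mathcal O\langle V\rangle$ with $j$ the canonical inclusion, where $V=\bigcup_{k\ge 0}V(k)$ for an increasing sequence of graded submodules such that $V(0)$ and all $V(k)/V(k-1)$ are (degreewise) $R$-free, $dV(0)\subset A$ and $dV(k)\subset A\vee\mathcal O\langle V(k-1)\rangle$ for $k\ge1$. A *cell algebra* is a cell extension $A=(\mathcal O\langle V\rangle,d)$ of $\mathbf 1$. A *cylinder* on $A$ is a factorisation $A\vee A\to IA\to A$ of the fold map as a cell extension followed by a surjective quasi-isomorphism. For $x\in A$ let $x',x''\in IA$ be its images under the two inclusions of $A$.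 Let $A=(\mathcal O\langle V\rangle,d)$ be a cell algebra with filtration $V(k)$, and let $\varepsilon:A\to\mathbf 1$ be an augmentation, i.e. a morphism of $\mathcal O$-algebras. Then: 1. $A$ has a cylinder of the standard form $IA=(\mathcal O\langle V'\oplus V''\oplus sV\rangle,d)$, in which $V',V''$ are the generators of the two copies of $A$, $sV$ is the suspension of $V$ (so $(sV)_i=V_{i-1}$), and $d(sx)-x'+x''\in\mathcal O\langle V'(k-1)\oplus V''(k-1)\oplus sV(k-1)\rangle$ for $x\in V(k)$, $k\ge 0$ (with $V(-1)=0$). 2. For every cylinder $IA$ on $A$, in particular for the standard ones, let $CA:=\mathbf 1\vee_A IA$ be the pushout of $\varepsilon$ along the second inclusion $A\to IA$, and let $A\to CA$ be induced by the first inclusion. Then $A\to CA$ is a cell extension, and $\varepsilon$ factors as $A\to CA\to\mathbf 1$, where $CA\to\mathbf 1$ is the map given by the identity on $\mathbf 1$ and by $IA\to A\xrightarrow{\varepsilon}\mathbf 1$ on $IA$; this map $CA\to\mathbf 1$ is a surjective quasi-isomorphism. -/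

import Mathlib

open CategoryTheory CategoryTheory.Limits HomotopicalAlgebra

universe u

noncomputable section

namespace CellOperad

/-! ### Graded and differential graded modules -/

/-- A `ℤ`-graded `R`-module (lower grading), as the internal direct sum of its homogeneous parts
`gr i`. -/
structure GrModule (R : Type u) [CommRing R] where
  carrier : Type u
  [addCommGroup : AddCommGroup carrier]
  [module : Module R carrier]
  gr : ℤ → Submodule R carrier
  isInternal : DirectSum.IsInternal gr

attribute [instance] GrModule.addCommGroup GrModule.module

instance {R : Type u} [CommRing R] : CoeSort (GrModule R) (Type u) := ⟨GrModule.carrier⟩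

/-- A differential graded `R`-module: the differential lowers the (lower) degree by one. -/
structure DGModule (R : Type u) [CommRing R] extends GrModule R where
  d : carrier →ₗ[R] carrier
  d_mem : ∀ {i : ℤ} {x : carrier}, x ∈ gr i → d x ∈ gr (i - 1)
  d_d : ∀ x : carrier, d (d x) = 0

instance {R : Type u} [CommRing R] : CoeSort (DGModule R) (Type u) :=
  ⟨fun M => M.toGrModule.carrier⟩

/-- The homology of a differential graded module (all degrees together). -/
abbrev DGModule.Homology {R : Type u} [CommRing R] (M : DGModule R) : Type u :=
  LinearMap.ker M.d ⧸ (LinearMap.range M.d).submoduleOf (LinearMap.ker M.d)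

/-! ### Koszul signs and block bijections -/

/-- The Koszul sign of the rearrangement of a word of homogeneous elements of degrees `deg` that
moves the letter in position `i` to position `e i`. -/
def koszulSign {m n : ℕ} (e : Fin m ≃ Fin n) (deg : Fin m → ℤ) : ℤˣ :=
  ∏ p ∈ Finset.univ.filter (fun p : Fin m × Fin m => p.1 < p.2 ∧ e p.2 < e p.1),
    (deg p.1 * deg p.2).negOnePow

/-- The Koszul sign of the rearrangement `y₁ ⋯ yₙ z₁ ⋯ zₙ ↦ y₁ z₁ y₂ z₂ ⋯ yₙ zₙ`, where `yᵢ` has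
degree `p i` and (the word) `zᵢ` has degree `q i`: each `zᵢ` moves past all `yₖ` with `i < k`. -/
def shuffleSign {n : ℕ} (p q : Fin n → ℤ) : ℤˣ :=
  ∏ s ∈ Finset.univ.filter (fun s : Fin n × Fin n => s.1 < s.2), (q s.1 * p s.2).negOnePow

/-- The sign `(-1)^(a + p₀ + ⋯ + pᵢ₋₁)` in the differential of a tensor product. -/
def leibnizSign {n : ℕ} (a : ℤ) (p : Fin n → ℤ) (i : Fin n) : ℤˣ :=
  (a + ∑ k ∈ Finset.univ.filter (fun k => k < i), p k).negOnePow

/-- The block bijection which carries the `i`-th block to the `e i`-th block, in order. -/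
def blockPerm {m n : ℕ} (e : Fin m ≃ Fin n) (k : Fin n → ℕ) :
    Fin (∑ i, k (e i)) ≃ Fin (∑ i, k i) :=
  finSigmaFinEquiv.symm.trans
    ((Equiv.sigmaCongrLeft (β := fun i => Fin (k i)) e).trans finSigmaFinEquiv)

/-- The direct sum of bijections, acting within each block. -/
def blockSum {n : ℕ} {l j : Fin n → ℕ} (τ : ∀ i, Fin (l i) ≃ Fin (j i)) :
    Fin (∑ i, l i) ≃ Fin (∑ i, j i) :=
  finSigmaFinEquiv.symm.trans ((Equiv.sigmaCongrRight τ).trans finSigmaFinEquiv)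

theorem sum_blocks {n : ℕ} (j : Fin n → ℕ) (l : ∀ i, Fin (j i) → ℕ) :
    ∑ t : Fin (∑ i, j i), l (finSigmaFinEquiv.symm t).1 (finSigmaFinEquiv.symm t).2 =
      ∑ i, ∑ a, l i a := by
  rw [Equiv.sum_comp finSigmaFinEquiv.symm (fun s : (i : Fin n) × Fin (j i) => l s.1 s.2)]
  exact Fintype.sum_sigma' l

/-! ### Operads -/

/-- An operad in differential graded `R`-modules: modules `O(n)`, a unit, symmetric group actions,
and associative, unital and equivariant composition products
`O(n) ⊗ O(j₁) ⊗ ⋯ ⊗ O(jₙ) → O(j₁ + ⋯ + jₙ)`, given as multilinear maps.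

The right actions of the symmetric groups are written as `act e : O(n) → O(m)` for bijections
`e : Fin m ≃ Fin n`. Such a bijection forces `m = n`, so this is the same datum as a right action
of each `Σₙ = Perm (Fin n)`, `x · σ = act σ x`; for `e = finCongr h` it is the transport along
`h : m = n`. -/
structure Operad (R : Type u) [CommRing R] where
  obj : ℕ → DGModule R
  /-- the unit, an element of `O(1)` of degree `0` and a cycle -/
  one : obj 1
  one_mem : one ∈ (obj 1).gr 0
  d_one : (obj 1).d one = 0
  /-- the right action of bijections -/
  act {m n : ℕ} (e : Fin m ≃ Fin n) : obj n →ₗ[R] obj m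
  act_refl (n : ℕ) (x : obj n) : act (Equiv.refl (Fin n)) x = x
  act_trans {l m n : ℕ} (e : Fin l ≃ Fin m) (f : Fin m ≃ Fin n) (x : obj n) :
    act (e.trans f) x = act e (act f x)
  act_mem {m n : ℕ} (e : Fin m ≃ Fin n) {i : ℤ} {x : obj n} :
    x ∈ (obj n).gr i → act e x ∈ (obj m).gr i
  d_act {m n : ℕ} (e : Fin m ≃ Fin n) (x : obj n) :
    (obj m).d (act e x) = act e ((obj n).d x)
  /-- the composition products -/
  comp {n : ℕ} (j : Fin n → ℕ) :
    obj n →ₗ[R] MultilinearMap R (fun i : Fin n => (obj (j i)).carrier) (obj (∑ i, j i))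
  comp_mem {n : ℕ} (j : Fin n → ℕ) {a : ℤ} {x : obj n} {p : Fin n → ℤ} {y : ∀ i, obj (j i)} :
    x ∈ (obj n).gr a → (∀ i, y i ∈ (obj (j i)).gr (p i)) →
      comp j x y ∈ (obj (∑ i, j i)).gr (a + ∑ i, p i)
  d_comp {n : ℕ} (j : Fin n → ℕ) {a : ℤ} {x : obj n} {p : Fin n → ℤ} {y : ∀ i, obj (j i)} :
    x ∈ (obj n).gr a → (∀ i, y i ∈ (obj (j i)).gr (p i)) →
      (obj (∑ i, j i)).d (comp j x y) = comp j ((obj n).d x) y +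
        ∑ i, leibnizSign a p i • comp j x (Function.update y i ((obj (j i)).d (y i)))
  /-- associativity -/
  comp_comp {n : ℕ} (j : Fin n → ℕ) (l : ∀ i, Fin (j i) → ℕ) (x : obj n)
    {p : Fin n → ℤ} {y : ∀ i, obj (j i)} {q : ∀ i, Fin (j i) → ℤ} {z : ∀ i a, obj (l i a)} :
    (∀ i, y i ∈ (obj (j i)).gr (p i)) → (∀ i a, z i a ∈ (obj (l i a)).gr (q i a)) →
      comp (fun t => l (finSigmaFinEquiv.symm t).1 (finSigmaFinEquiv.symm t).2) (comp j x y)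
          (fun t => z (finSigmaFinEquiv.symm t).1 (finSigmaFinEquiv.symm t).2) =
        shuffleSign p (fun i => ∑ a, q i a) •
          act (finCongr (sum_blocks j l))
            (comp (fun i => ∑ a, l i a) x (fun i => comp (l i) (y i) (z i)))
  /-- right unit -/
  comp_one {n : ℕ} (x : obj n) :
    comp (fun _ => 1) x (fun _ => one) = act (finCongr (by simp)) x
  /-- left unit -/
  one_comp (j : Fin 1 → ℕ) (y : ∀ i, obj (j i)) :
    comp j one y = act (finCongr (by simp)) (y 0)
  /-- equivariance with respect to permutations of the blocks -/
  comp_act_left {m n : ℕ} (e : Fin m ≃ Fin n) (k : Fin n → ℕ) (x : obj n)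
    {p : Fin n → ℤ} {y : ∀ i, obj (k i)} : (∀ i, y i ∈ (obj (k i)).gr (p i)) →
      comp (fun i => k (e i)) (act e x) (fun i => y (e i)) =
        koszulSign e (fun i => p (e i)) • act (blockPerm e k) (comp k x y)
  /-- equivariance with respect to permutations within the blocks -/
  comp_act_right {n : ℕ} {l j : Fin n → ℕ} (τ : ∀ i, Fin (l i) ≃ Fin (j i)) (x : obj n)
    (y : ∀ i, obj (j i)) :
    comp l x (fun i => act (τ i) (y i)) = act (blockSum τ) (comp j x y)

/-! ### Algebras over an operad -/

variable {R : Type u} [CommRing R]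

/-- A graded algebra over the graded operad that underlies `O` (all differentials forgotten):
a graded module with associative, unital and equivariant products `O(n) ⊗ A^{⊗n} → A`. -/
structure GrAlg (O : Operad R) extends GrModule R where
  op (n : ℕ) : O.obj n →ₗ[R] MultilinearMap R (fun _ : Fin n => carrier) carrier
  op_mem {n : ℕ} {i : ℤ} {x : O.obj n} {p : Fin n → ℤ} {a : Fin n → carrier} :
    x ∈ (O.obj n).gr i → (∀ k, a k ∈ gr (p k)) → op n x a ∈ gr (i + ∑ k, p k)
  op_one (a : Fin 1 → carrier) : op 1 O.one a = a 0
  op_act {m n : ℕ} (e : Fin m ≃ Fin n) (x : O.obj n) {p : Fin n → ℤ} {a : Fin n → carrier} :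
    (∀ k, a k ∈ gr (p k)) →
      op m (O.act e x) (fun i => a (e i)) = koszulSign e (fun i => p (e i)) • op n x a
  op_comp {n : ℕ} (j : Fin n → ℕ) (x : O.obj n) {p : Fin n → ℤ} {y : ∀ i, O.obj (j i)}
    {q : ∀ i, Fin (j i) → ℤ} {a : ∀ i, Fin (j i) → carrier} :
    (∀ i, y i ∈ (O.obj (j i)).gr (p i)) → (∀ i t, a i t ∈ gr (q i t)) →
      op (∑ i, j i) (O.comp j x y)
          (fun t => a (finSigmaFinEquiv.symm t).1 (finSigmaFinEquiv.symm t).2) =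
        shuffleSign p (fun i => ∑ t, q i t) • op n x (fun i => op (j i) (y i) (a i))

instance (O : Operad R) : CoeSort (GrAlg O) (Type u) := ⟨fun A => A.toGrModule.carrier⟩

/-- A morphism of graded algebras. -/
@[ext]
structure GrAlg.Hom {O : Operad R} (A B : GrAlg O) where
  toLin : A.carrier →ₗ[R] B.carrier
  map_mem : ∀ {i : ℤ} {x : A.carrier}, x ∈ A.gr i → toLin x ∈ B.gr i
  map_op : ∀ (n : ℕ) (x : O.obj n) (a : Fin n → A.carrier),
    toLin (A.op n x a) = B.op n x (fun i => toLin (a i))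

/-- The sub-`O`-algebra (differentials ignored) generated by a set. -/
def GrAlg.adjoin {O : Operad R} (A : GrAlg O) (s : Set A.carrier) : Submodule R A.carrier :=
  sInf {S | s ⊆ S ∧ ∀ (n : ℕ) (x : O.obj n) (a : Fin n → A.carrier),
    (∀ i, a i ∈ S) → A.op n x a ∈ S}

/-- An algebra over the differential graded operad `O`: the products are chain maps. -/
structure Alg (O : Operad R) extends GrAlg O where
  d : carrier →ₗ[R] carrier
  d_mem : ∀ {i : ℤ} {x : carrier}, x ∈ gr i → d x ∈ gr (i - 1)
  d_d : ∀ x : carrier, d (d x) = 0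
  d_op {n : ℕ} {i : ℤ} {x : O.obj n} {p : Fin n → ℤ} {a : Fin n → carrier} :
    x ∈ (O.obj n).gr i → (∀ k, a k ∈ gr (p k)) →
      d (op n x a) = op n ((O.obj n).d x) a +
        ∑ k, leibnizSign i p k • op n x (Function.update a k (d (a k)))

instance (O : Operad R) : CoeSort (Alg O) (Type u) := ⟨fun A => A.toGrModule.carrier⟩

/-- The underlying differential graded module of an `O`-algebra. -/
abbrev Alg.toDGModule {O : Operad R} (A : Alg O) : DGModule R where
  toGrModule := A.toGrModule
  d := A.d
  d_mem := A.d_mem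
  d_d := A.d_d

/-- A morphism of `O`-algebras. -/
@[ext]
structure Alg.Hom {O : Operad R} (A B : Alg O) extends GrAlg.Hom A.toGrAlg B.toGrAlg where
  map_d : ∀ x : A.carrier, toLin (A.d x) = B.d (toLin x)

/-- The category of `O`-algebras. -/
instance (O : Operad R) : Category (Alg O) where
  Hom := Alg.Hom
  id A :=
    { toLin := LinearMap.id
      map_mem := fun h => h
      map_op := fun _ _ _ => rfl
      map_d := fun _ => rfl }
  comp f g :=
    { toLin := g.toLin ∘ₗ f.toLin
      map_mem := fun h => g.map_mem (f.map_mem h)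
      map_op := fun n x a => by simp [f.map_op, g.map_op]
      map_d := fun x => by simp [f.map_d, g.map_d] }

/-- The morphism of graded algebras that underlies a morphism of `O`-algebras. -/
abbrev gr {O : Operad R} {A B : Alg O} (f : A ⟶ B) : GrAlg.Hom A.toGrAlg B.toGrAlg :=
  Alg.Hom.toHom f

/-- The linear map that underlies a morphism of `O`-algebras. -/
abbrev lin {O : Operad R} {A B : Alg O} (f : A ⟶ B) : A.carrier →ₗ[R] B.carrier :=
  (gr f).toLin

/-- A surjective morphism of `O`-algebras. -/
def IsSurjective {O : Operad R} {A B : Alg O} (f : A ⟶ B) : Prop :=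
  Function.Surjective (lin f)

/-- The map that a morphism of `O`-algebras induces in homology. -/
def homologyMap {O : Operad R} {A B : Alg O} (f : A ⟶ B) :
    A.toDGModule.Homology →ₗ[R] B.toDGModule.Homology :=
  Submodule.mapQ _ _
    ((lin f).restrict (p := LinearMap.ker A.d) (q := LinearMap.ker B.d) (fun x hx => by
      rw [LinearMap.mem_ker] at hx ⊢
      rw [← Alg.Hom.map_d f, hx, map_zero]))
    (by
      rintro ⟨x, hx⟩ ⟨y, hy⟩
      exact ⟨lin f y, (Alg.Hom.map_d f y).symm.trans (congrArg (lin f) hy)⟩)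

/-- A quasi-isomorphism: a morphism that induces an isomorphism in homology. -/
def IsQuasiIso {O : Operad R} {A B : Alg O} (f : A ⟶ B) : Prop :=
  Function.Bijective (homologyMap f)

/-! ### The ground algebra and the unit morphism -/

/-- The bijection that identifies `O(0 + ⋯ + 0)` with `O(0)`. -/
def zeroBlocks (n : ℕ) : Fin 0 ≃ Fin (∑ _i : Fin n, 0) := finCongr (by simp)

theorem act_congr {O : Operad R} {m n : ℕ} [IsEmpty (Fin m)] (e f : Fin m ≃ Fin n)
    (x : O.obj n) : O.act e x = O.act f x :=
  congrArg (fun g => O.act g x) (Equiv.ext fun i => isEmptyElim i)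

theorem act_units_smul {O : Operad R} {m n : ℕ} (e : Fin m ≃ Fin n) (s : ℤˣ) (x : O.obj n) :
    O.act e (s • x) = s • O.act e x := by
  rcases Int.units_eq_one_or s with rfl | rfl <;> simp [Units.smul_def]

theorem isEmpty_fin_sum_zero {n : ℕ} : IsEmpty (Fin (∑ _i : Fin n, 0)) := by
  simp only [Finset.sum_const_zero]; infer_instance

/-- The ground algebra: `O(0)` with the products
`O(n) ⊗ O(0)^{⊗n} → O(0 + ⋯ + 0) = O(0)`. -/
def ground (O : Operad R) : Alg O where
  toGrModule := (O.obj 0).toGrModule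
  op n :=
    { toFun := fun x => (O.act (zeroBlocks n)).compMultilinearMap (O.comp (fun _ => 0) x)
      map_add' := fun x y => by ext a; simp
      map_smul' := fun r x => by ext a; simp }
  op_mem hx ha := O.act_mem _ (O.comp_mem _ hx ha)
  op_one a := by
    change O.act _ (O.comp (fun _ => 0) O.one a) = _
    rw [O.one_comp, ← O.act_trans, act_congr _ (Equiv.refl _), O.act_refl]
  op_act e x p a ha := by
    change O.act _ (O.comp (fun _ => 0) (O.act e x) (fun i => a (e i))) =
      _ • O.act _ (O.comp (fun _ => 0) x a)
    rw [O.comp_act_left e (fun _ => 0) x ha, act_units_smul, ← O.act_trans]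
    congr 1
    exact act_congr _ _ _
  op_comp {n} j x p y q a hy ha := by
    change O.act _ (O.comp (fun _ => 0) (O.comp j x y) _) =
      _ • O.act _ (O.comp (fun _ => 0) x
        (fun i => O.act (zeroBlocks (j i)) (O.comp (fun _ => 0) (y i) (a i))))
    rw [O.comp_comp j (fun _ _ => 0) x hy ha, act_units_smul,
      O.comp_act_right (fun i => zeroBlocks (j i)) x, ← O.act_trans, ← O.act_trans]
    congr 1
    exact act_congr _ _ _
  d := (O.obj 0).d
  d_mem := (O.obj 0).d_mem
  d_d := (O.obj 0).d_d
  d_op {n i x p a} hx ha := by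
    change (O.obj 0).d (O.act _ (O.comp (fun _ => 0) x a)) =
      O.act _ (O.comp (fun _ => 0) ((O.obj n).d x) a) + ∑ k, _ • O.act _ (O.comp (fun _ => 0) x _)
    rw [O.d_act, O.d_comp _ hx ha, map_add, map_sum]
    simp only [act_units_smul]

/-- Multilinear maps that agree on homogeneous elements are equal. -/
theorem multilinear_ext_of_homogeneous {n : ℕ} {M : Fin n → GrModule R} {N : Type u}
    [AddCommGroup N] [Module R N] {f g : MultilinearMap R (fun i => (M i).carrier) N}
    (h : ∀ (p : Fin n → ℤ) (a : ∀ i, M i), (∀ i, a i ∈ (M i).gr (p i)) → f a = g a) :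
    f = g := by
  have hs : ∀ i, Submodule.span R (Set.range
      (fun s : (p : ℤ) × (M i).gr p => (s.2 : (M i).carrier))) = ⊤ := by
    intro i
    rw [eq_top_iff, ← (M i).isInternal.submodule_iSup_eq_top]
    refine iSup_le fun p x hx => Submodule.subset_span ⟨⟨p, x, hx⟩, rfl⟩
  refine MultilinearMap.ext_of_span_eq_top (g := fun i
    (s : (p : ℤ) × (M i).gr p) => (s.2 : (M i).carrier)) hs ?_
  intro s
  exact h (fun i => (s i).1) _ (fun i => (s i).2.2)

/-- The structure map `O(0) → A`. -/
def GrAlg.nullary {O : Operad R} (A : GrAlg O) : (O.obj 0).carrier →ₗ[R] A.carrier where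
  toFun x := A.op 0 x Fin.elim0
  map_add' x y := by simp
  map_smul' r x := by simp

theorem nullary_op {O : Operad R} (A : GrAlg O) {n : ℕ} (x : O.obj n) (y : Fin n → O.obj 0) :
    A.nullary (O.act (zeroBlocks n) (O.comp (fun _ => 0) x y)) =
      A.op n x (fun i => A.nullary (y i)) := by
  have key : (A.nullary ∘ₗ O.act (zeroBlocks n)).compMultilinearMap (O.comp (fun _ => 0) x) =
      (A.op n x).compLinearMap (fun _ => A.nullary) := by
    refine multilinear_ext_of_homogeneous (M := fun _ => (O.obj 0).toGrModule) fun p y hy => ?_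
    have h1 := A.op_comp (fun _ => 0) x (q := fun _ => Fin.elim0) (a := fun _ => Fin.elim0) hy
      (fun _ t => t.elim0)
    have h2 : shuffleSign p (fun i => ∑ t, (Fin.elim0 : Fin 0 → ℤ) t) = 1 := by
      simp [shuffleSign]
    rw [h2, one_smul] at h1
    have h3 := A.op_act (zeroBlocks n) (O.comp (fun _ => 0) x y) (p := fun _ => 0)
      (a := fun t => isEmpty_fin_sum_zero.elim t) (fun t => isEmpty_fin_sum_zero.elim t)
    have h4 : koszulSign (zeroBlocks n) (fun _ => 0) = 1 := by
      simp [koszulSign]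
    rw [h4, one_smul] at h3
    change A.op 0 (O.act (zeroBlocks n) (O.comp (fun _ => 0) x y)) Fin.elim0 =
      A.op n x (fun i => A.op 0 (y i) Fin.elim0)
    rw [← h1]
    refine Eq.trans (congrArg _ (Subsingleton.elim _ _)) (h3.trans (congrArg _ ?_))
    funext t
    exact isEmpty_fin_sum_zero.elim t
  exact congrArg (fun F => F y) key

/-- Linear maps that agree on homogeneous elements are equal. -/
theorem linear_ext_of_homogeneous {M : GrModule R} {N : Type u} [AddCommGroup N] [Module R N]
    {f g : M.carrier →ₗ[R] N} (h : ∀ (i : ℤ), ∀ x ∈ M.gr i, f x = g x) : f = g := by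
  refine LinearMap.ext fun x => ?_
  have hx : x ∈ ⨆ i, M.gr i := by rw [M.isInternal.submodule_iSup_eq_top]; trivial
  have hle : (⨆ i, M.gr i) ≤ LinearMap.eqLocus f g := iSup_le fun i x hx => h i x hx
  exact hle hx

/-- The unit morphism of an `O`-algebra, given by the nullary products `O(0) → A`. -/
def unitHom {O : Operad R} (A : Alg O) : ground O ⟶ A where
  toLin := A.nullary
  map_mem {i x} hx := by
    have := A.op_mem (p := Fin.elim0) (a := Fin.elim0) hx (fun k => k.elim0)
    simpa using! this
  map_op n x a := nullary_op A.toGrAlg x a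
  map_d x := by
    have key : A.nullary ∘ₗ (O.obj 0).d = A.d ∘ₗ A.nullary :=
      linear_ext_of_homogeneous fun i x hx => by
        have := A.d_op (p := Fin.elim0) (a := Fin.elim0) hx (fun k => k.elim0)
        simpa using! this.symm
    exact congrArg (fun F => F x) key

theorem act_comp_nullary {O : Operad R} (x : O.obj 0) (j : Fin 0 → ℕ) (y : ∀ i, O.obj (j i))
    (e : Fin 0 ≃ Fin (∑ i, j i)) : O.act e (O.comp j x y) = x := by
  obtain rfl : j = fun _ => 1 := Subsingleton.elim _ _
  obtain rfl : y = fun _ => O.one := Subsingleton.elim _ _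
  rw [O.comp_one, ← O.act_trans, act_congr _ (Equiv.refl _), O.act_refl]

/-- The ground algebra is the initial `O`-algebra. -/
theorem hom_ground_ext {O : Operad R} {A : Alg O} (f : ground O ⟶ A) : f = unitHom A := by
  refine Alg.Hom.ext (LinearMap.ext fun (x : O.obj 0) => ?_)
  have h1 := (gr f).map_op 0 x Fin.elim0
  have h2 : (ground O).op 0 x Fin.elim0 = x := act_comp_nullary x _ _ _
  rw [h2] at h1
  exact h1.trans (congrArg (A.op 0 x) (Subsingleton.elim _ _))

/-! ### Cell extensions -/

/-- Let `j : A → B` be a morphism of graded algebras, and let `ι : V → B` be a homogeneous map of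
degree `0` from a graded module `V = (Vᵢ)`. This says that `j` and `ι` exhibit `B` as the coproduct
`A ∨ O⟨V⟩` of `A` with the free graded algebra on `V`: morphisms `B → C` of graded algebras
correspond to pairs of a morphism `A → C` and a homogeneous map `V → C` of degree `0`. -/
def IsFreeExtension {O : Operad R} {A B : GrAlg O} (j : A.Hom B) (V : ℤ → Type u)
    [∀ i, AddCommGroup (V i)] [∀ i, Module R (V i)] (ι : ∀ i, V i →ₗ[R] B.carrier) : Prop :=
  (∀ i x, ι i x ∈ B.gr i) ∧
    ∀ (C : GrAlg O) (f : A.Hom C) (g : ∀ i, V i →ₗ[R] C.carrier), (∀ i x, g i x ∈ C.gr i) →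
      ∃! h : B.Hom C, (∀ a, h.toLin (j.toLin a) = f.toLin a) ∧ ∀ i x, h.toLin (ι i x) = g i x

/-- The data that make `j : A ⟶ B` a cell extension: a graded module `V` with `B ≅ A ∨ O⟨V⟩` when
differentials are forgotten, and an exhaustive increasing filtration `V(0) ⊆ V(1) ⊆ ⋯` of `V` by
graded submodules with (degreewise) free quotients such that `d V(0) ⊆ A` and
`d V(k + 1) ⊆ A ∨ O⟨V(k)⟩`. -/
structure CellStructure {O : Operad R} {A B : Alg O} (j : A ⟶ B) where
  V : ℤ → Type u
  [addCommGroup : ∀ i, AddCommGroup (V i)]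
  [module : ∀ i, Module R (V i)]
  ι : ∀ i, V i →ₗ[R] B.carrier
  isFree : IsFreeExtension (gr j) V ι
  fil : ℕ → ∀ i, Submodule R (V i)
  fil_mono : ∀ i, Monotone (fun k => fil k i)
  fil_exhaust : ∀ i (x : V i), ∃ k, x ∈ fil k i
  free_zero : ∀ i, Module.Free R (fil 0 i)
  free_succ : ∀ k i, Module.Free R (fil (k + 1) i ⧸ (fil k i).submoduleOf (fil (k + 1) i))
  d_zero : ∀ i, ∀ x ∈ fil 0 i, B.d (ι i x) ∈ Set.range (lin j)
  d_succ : ∀ k i, ∀ x ∈ fil (k + 1) i,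
    B.d (ι i x) ∈ B.adjoin (Set.range (lin j) ∪ {b | ∃ i', ∃ y ∈ fil k i', b = ι i' y})

attribute [instance] CellStructure.addCommGroup CellStructure.module

/-- A cell extension of `O`-algebras. -/
def IsCellExtension {O : Operad R} {A B : Alg O} (j : A ⟶ B) : Prop :=
  Nonempty (CellStructure j)

/-- A cell algebra is a cell extension of the ground algebra; this is the structure on `A`, which
presents it as `(O⟨V⟩, d)`. -/
abbrev CellAlgebraStructure {O : Operad R} (A : Alg O) := CellStructure (unitHom A)

/-! ### Cylinders and cones -/

/-- A cylinder on `A`: a surjective cell model of the fold map, that is, a factorisation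
`A ∨ A → IA → A` of the fold map as a cell extension followed by a surjective
quasi-isomorphism. -/
structure Cylinder {O : Operad R} (A : Alg O) [HasBinaryCoproduct A A] where
  obj : Alg O
  incl : A ⨿ A ⟶ obj
  proj : obj ⟶ A
  fac : incl ≫ proj = coprod.desc (𝟙 A) (𝟙 A)
  isCell : IsCellExtension incl
  surjective : IsSurjective proj
  quasiIso : IsQuasiIso proj

namespace Cylinder

variable {O : Operad R} {A : Alg O} [HasBinaryCoproduct A A]

/-- The first inclusion `x ↦ x'`. -/
def fst (I : Cylinder A) : A ⟶ I.obj := coprod.inl ≫ I.incl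

/-- The second inclusion `x ↦ x''`. -/
def snd (I : Cylinder A) : A ⟶ I.obj := coprod.inr ≫ I.incl

theorem fst_proj (I : Cylinder A) : I.fst ≫ I.proj = 𝟙 A := by
  rw [fst, Category.assoc, I.fac, coprod.inl_desc]

theorem snd_proj (I : Cylinder A) : I.snd ≫ I.proj = 𝟙 A := by
  rw [snd, Category.assoc, I.fac, coprod.inr_desc]

/-- The elements `x'`, `x''` and `sx` of `IA`, for `x` in the `k`-th stage `V(k)`. -/
def generators (I : Cylinder A) (c : CellAlgebraStructure A) (s : ∀ i, c.V i →ₗ[R] I.obj.carrier)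
    (k : ℕ) : Set I.obj.carrier :=
  {b | ∃ i, ∃ x ∈ c.fil k i, b = lin I.fst (c.ι i x) ∨ b = lin I.snd (c.ι i x) ∨ b = s i x}

/-- For a cell algebra `A = (O⟨V⟩, d)`, the cylinder has the standard form
`IA = (O⟨V' ⊕ V'' ⊕ sV⟩, d)`, where `V'` and `V''` are the generators of the two copies of `A`,
`sV` is the suspension of `V`, with `(sV)ᵢ = Vᵢ₋₁`, and `d(sx) - x' + x''` lies in
`O⟨V'(k - 1) ⊕ V''(k - 1) ⊕ sV(k - 1)⟩` for `x ∈ V(k)` (where `V(-1) = 0`). -/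
def IsStandard (I : Cylinder A) (c : CellAlgebraStructure A) : Prop :=
  ∃ s : ∀ i, c.V i →ₗ[R] I.obj.carrier,
    IsFreeExtension (gr I.incl) (fun i => c.V (i - 1)) (fun i => s (i - 1)) ∧
    (∀ i, ∀ x ∈ c.fil 0 i,
      I.obj.d (s i x) - lin I.fst (c.ι i x) + lin I.snd (c.ι i x) ∈ I.obj.adjoin ∅) ∧
    ∀ k i, ∀ x ∈ c.fil (k + 1) i,
      I.obj.d (s i x) - lin I.fst (c.ι i x) + lin I.snd (c.ι i x) ∈
        I.obj.adjoin (I.generators c s k)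

variable [HasPushouts (Alg O)]

/-- The acyclic closure, or cone, `CA = R ∨_A IA`: the pushout of the augmentation `ε` and of the
second inclusion `A → IA`. -/
def cone (I : Cylinder A) (ε : A ⟶ ground O) : Alg O := pushout ε I.snd

/-- The map `A → CA`, through the first inclusion. -/
def toCone (I : Cylinder A) (ε : A ⟶ ground O) : A ⟶ I.cone ε :=
  I.fst ≫ pushout.inr ε I.snd

/-- The map `CA → R` which is the identity on `R` and `IA → A → R` on `IA`. -/
def coneProj (I : Cylinder A) (ε : A ⟶ ground O) : I.cone ε ⟶ ground O :=
  pushout.desc (𝟙 (ground O)) (I.proj ≫ ε) (by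
    rw [Category.comp_id, ← Category.assoc, I.snd_proj, Category.id_comp])

end Cylinder

end CellOperad

end

/-!
Differentials are controlled by one adjunction: the functor that forgets the differential of an
`O`-algebra has a right adjoint `C ↦ path C`, the cofree algebra of pairs `(c, e)` with `e` in the
role of `dc` (`toPath`, `pathFst`, `path_hom_ext`). Therefore derivations are morphisms to `path C`,
hence are determined by, and can be prescribed on, free generators; and coproducts and pushouts of
algebras are still coproducts and pushouts of the underlying graded algebras.

Both parts of the theorem rest on lifting properties. A cell extension lifts against surjective
quasi-isomorphisms, by recursion over its filtration (`IsFreeOver.exists_lift`), so it is a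
cofibration (`IsCellExtension.cofibration`).

For the standard cylinder, let `A` be free on generators `x` whose differentials only involve
generators of smaller rank. On the free graded algebra on `x'`, `x''` and `sx` one looks for a
differential that extends the ones of the two copies of `A` and has `d(sx) = x' - x'' - w x`, with a
correction term `w x` of smaller rank. It has square zero, and the projection `x', x'' ↦ x`,
`sx ↦ 0` is a chain map, exactly if `d(w x) = (dx)' - (dx)''` and `w x ↦ 0` (`IsCylTerm`). Whenever
such terms are given, the first inclusion `x ↦ x'` lifts against all surjections: `sx` may be lifted
arbitrarily, and its differential then dictates the lift of `x''` (`cylAlgIn₁_exists_lift`). So that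
inclusion is a trivial cofibration, and the projection is a quasi-isomorphism
(`cylAlgProj_quasiIso`). This makes the construction of `w x` a recursion over the rank
(`exists_cylTerms`): the terms of smaller rank define a cylinder on the algebra in which the
differentials of the generators of larger rank are put to zero, there the cycle `(dx)' - (dx)''` in
the kernel of the surjective quasi-isomorphism to that algebra bounds an element of the kernel, and
this element is moved to the part of smaller rank by the chain retraction that kills all other
generators.

For the cone, the second inclusion `A → IA` is a composite of the cofibrations `A → A ∨ A → IA` and
has the weak equivalence `IA → A` as a left inverse. Its pushout `𝟏 → CA` is thus a weak
equivalence, with left inverse `CA → 𝟏` (`Cylinder.coneProj_quasiIso`). The generators of `IA` over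
`A ∨ A` generate `CA` freely over `A`, as the second copy of `A` is sent to the ground algebra, and
they do so compatibly with the filtration (`Cylinder.toCone_isFreeExtension`,
`Cylinder.toCone_isCellExtension`).
-/

noncomputable section

namespace CellOperad

variable {R : Type u} [CommRing R]

/-! ### Graded modules -/

/-- A family of submodules is an internal direct sum decomposition as soon as it spans and there
are endomorphisms that act like the projections to the summands. -/
theorem isInternal_of_projections {M : Type u} [AddCommGroup M] [Module R M]
    (N : ℤ → Submodule R M) (π : ℤ → M →ₗ[R] M) (hself : ∀ i, ∀ x ∈ N i, π i x = x)
    (hne : ∀ i j, i ≠ j → ∀ x ∈ N i, π j x = 0) (htop : ∀ x, x ∈ ⨆ i, N i) :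
    DirectSum.IsInternal N := by
  constructor
  · rw [← AddMonoidHom.coe_coe, injective_iff_map_eq_zero]
    intro x hx
    have key : ∀ j, π j ∘ₗ DirectSum.coeLinearMap N =
        (N j).subtype ∘ₗ DirectSum.component R ℤ (fun i => N i) j := by
      intro j
      refine DirectSum.linearMap_ext _ fun i => LinearMap.ext fun y => ?_
      simp only [LinearMap.comp_apply, DirectSum.coeLinearMap_lof]
      by_cases h : i = j
      · subst h
        rw [hself i _ y.2, DirectSum.component.lof_self]
        rfl
      · rw [hne i j h _ y.2, DirectSum.component.of, dif_neg h]
        simp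
    refine DFinsupp.ext fun j => Subtype.ext ?_
    have h1 := congrArg (fun F => F x) (key j)
    have h2 : DirectSum.coeLinearMap N x = 0 := hx
    simp only [LinearMap.comp_apply, h2, map_zero] at h1
    exact h1.symm
  · intro x
    refine Submodule.iSup_induction (motive := fun x => ∃ a, DirectSum.coeLinearMap N a = x) N
      (htop x) (fun i y hy => ⟨DirectSum.lof R ℤ (fun i => N i) i ⟨y, hy⟩,
        DirectSum.coeLinearMap_lof N i ⟨y, hy⟩⟩) ⟨0, map_zero _⟩ ?_
    rintro _ _ ⟨a, rfl⟩ ⟨b, rfl⟩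
    exact ⟨a + b, map_add _ _ _⟩

namespace GrModule

variable (M : GrModule R)

/-- Induction along the decomposition of an element into homogeneous components. -/
theorem induction {M : GrModule R} {P : M.carrier → Prop} (x : M.carrier)
    (hom : ∀ i, ∀ y ∈ M.gr i, P y) (add : ∀ y z, P y → P z → P (y + z)) : P x := by
  have hx : x ∈ ⨆ i, M.gr i := by rw [M.isInternal.submodule_iSup_eq_top]; trivial
  exact Submodule.iSup_induction (motive := P) _ hx hom (hom 0 0 (zero_mem _)) add

/-- The linear map out of a graded module with given restrictions to the homogeneous parts. -/
def lift {M : GrModule R} {N : Type*} [AddCommGroup N] [Module R N]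
    (f : ∀ i, M.gr i →ₗ[R] N) : M.carrier →ₗ[R] N :=
  DirectSum.toModule R ℤ N f ∘ₗ
    (LinearEquiv.ofBijective (DirectSum.coeLinearMap M.gr) M.isInternal).symm.toLinearMap

theorem lift_apply {M : GrModule R} {N : Type*} [AddCommGroup N] [Module R N]
    (f : ∀ i, M.gr i →ₗ[R] N) {i : ℤ} {x : M.carrier} (hx : x ∈ M.gr i) :
    lift f x = f i ⟨x, hx⟩ := by
  have h : (LinearEquiv.ofBijective (DirectSum.coeLinearMap M.gr) M.isInternal).symm x =
      DirectSum.lof R ℤ (fun i => M.gr i) i ⟨x, hx⟩ := by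
    rw [LinearEquiv.symm_apply_eq]
    exact (DirectSum.coeLinearMap_lof M.gr i ⟨x, hx⟩).symm
  simp only [lift, LinearMap.comp_apply, LinearEquiv.coe_coe, h, DirectSum.toModule_lof]

/-- The projection to the homogeneous part of degree `j`. -/
def proj (j : ℤ) : M.carrier →ₗ[R] M.carrier :=
  lift fun i => if i = j then (M.gr i).subtype else 0

variable {M}

theorem proj_self {i : ℤ} {x : M.carrier} (hx : x ∈ M.gr i) : M.proj i x = x := by
  rw [proj, lift_apply _ hx, if_pos rfl]; rfl

theorem proj_of_ne {i j : ℤ} (h : i ≠ j) {x : M.carrier} (hx : x ∈ M.gr i) :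
    M.proj j x = 0 := by
  rw [proj, lift_apply _ hx, if_neg h]; rfl

theorem proj_mem (j : ℤ) (x : M.carrier) : M.proj j x ∈ M.gr j := by
  refine induction (P := fun x => M.proj j x ∈ M.gr j) x (fun i y hy => ?_) fun y z hy hz => ?_
  · by_cases h : i = j
    · subst h
      rwa [proj_self hy]
    · rw [proj_of_ne h hy]
      exact zero_mem _
  · rw [map_add]
    exact add_mem hy hz

/-- A homogeneous map of degree `e` commutes with the projections. -/
theorem map_proj {M N : GrModule R} (f : M.carrier →ₗ[R] N.carrier) (e : ℤ)
    (hf : ∀ i, ∀ x ∈ M.gr i, f x ∈ N.gr (i + e)) (j : ℤ) (x : M.carrier) :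
    f (M.proj j x) = N.proj (j + e) (f x) := by
  refine induction (P := fun x => f (M.proj j x) = N.proj (j + e) (f x)) x
    (fun i y hy => ?_) fun y z hy hz => ?_
  · by_cases h : i = j
    · subst h
      rw [proj_self hy, proj_self (hf i y hy)]
    · rw [proj_of_ne h hy, proj_of_ne (by omega) (hf i y hy), map_zero]
  · simp only [map_add, hy, hz]

variable (M) in
/-- The grading involution, which multiplies the elements of degree `i` by `(-1)^i`. -/
def sign : M.carrier →ₗ[R] M.carrier := lift fun i => ((i.negOnePow : ℤˣ) : ℤ) • (M.gr i).subtype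

theorem sign_apply {i : ℤ} {x : M.carrier} (hx : x ∈ M.gr i) :
    M.sign x = i.negOnePow • x := by
  rw [sign, lift_apply _ hx]; rfl

theorem units_smul_mem {i : ℤ} {x : M.carrier} (hx : x ∈ M.gr i) (s : ℤˣ) : s • x ∈ M.gr i := by
  rw [Units.smul_def]
  exact zsmul_mem hx _

end GrModule

theorem map_units_smul {M N : Type*} [AddCommGroup M] [AddCommGroup N] [Module R M] [Module R N]
    (f : M →ₗ[R] N) (s : ℤˣ) (x : M) : f (s • x) = s • f x := by
  rcases Int.units_eq_one_or s with rfl | rfl <;> simp [Units.smul_def]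

/-- Multilinear maps are multiplicative over signs. -/
theorem multilinear_units_smul {n : ℕ} {M N : Type*} [AddCommGroup M] [AddCommGroup N]
    [Module R M] [Module R N] (f : MultilinearMap R (fun _ : Fin n => M) N) (s : Fin n → ℤˣ)
    (x : Fin n → M) : f (fun i => s i • x i) = (∏ i, s i) • f x := by
  have h : ∀ i, s i • x i = ((s i : ℤ) : R) • x i := fun i => by
    rw [Units.smul_def, Int.cast_smul_eq_zsmul]
  simp only [h]
  rw [f.map_smul_univ, Units.smul_def, ← Int.cast_smul_eq_zsmul R]
  simp

theorem multilinear_update_units_smul {n : ℕ} {M N : Type*} [AddCommGroup M] [AddCommGroup N]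
    [Module R M] [Module R N] (f : MultilinearMap R (fun _ : Fin n => M) N) (x : Fin n → M)
    (k : Fin n) (s : ℤˣ) (y : M) :
    f (Function.update x k (s • y)) = s • f (Function.update x k y) := by
  rcases Int.units_eq_one_or s with rfl | rfl <;> simp [Units.smul_def]

/-! ### Signs -/

theorem negOnePow_congr {a b : ℤ} (h : (a : ZMod 2) = (b : ZMod 2)) :
    a.negOnePow = b.negOnePow := by
  rw [Int.negOnePow_eq_iff, ← ZMod.intCast_eq_zero_iff_even, Int.cast_sub, h, sub_self]

theorem negOnePow_sum {ι : Type*} (s : Finset ι) (f : ι → ℤ) :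
    ∏ i ∈ s, (f i).negOnePow = (∑ i ∈ s, f i).negOnePow := by
  classical
  induction s using Finset.induction_on with
  | empty => simp
  | insert a s ha ih => rw [Finset.prod_insert ha, Finset.sum_insert ha, ih, Int.negOnePow_add]

theorem koszulSign_eq {m n : ℕ} (e : Fin m ≃ Fin n) (q : Fin m → ℤ) :
    koszulSign e q = (∑ a, ∑ b, if a < b ∧ e b < e a then q a * q b else 0).negOnePow := by
  rw [koszulSign, negOnePow_sum, Finset.sum_filter, ← Finset.univ_product_univ,
    Finset.sum_product]

theorem shuffleSign_eq {n : ℕ} (p q : Fin n → ℤ) :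
    shuffleSign p q = (∑ a, ∑ b, if a < b then q a * p b else 0).negOnePow := by
  rw [shuffleSign, negOnePow_sum, Finset.sum_filter, ← Finset.univ_product_univ,
    Finset.sum_product]

theorem leibnizSign_eq {n : ℕ} (a : ℤ) (p : Fin n → ℤ) (k : Fin n) :
    leibnizSign a p k = (a + ∑ l, if l < k then p l else 0).negOnePow := by
  rw [leibnizSign, Finset.sum_filter]

theorem leibnizSign_sub_one {n : ℕ} (a : ℤ) (p : Fin n → ℤ) (k : Fin n) :
    leibnizSign (a - 1) p k = -leibnizSign a p k := by
  rw [leibnizSign, leibnizSign, show ∀ x y : ℤ, x - 1 + y = x + y - 1 from fun _ _ => by ring,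
    Int.negOnePow_sub, Int.negOnePow_one, mul_neg_one]

theorem leibnizSign_update_of_le {n : ℕ} (a : ℤ) (p : Fin n → ℤ) {k l : Fin n} (h : l ≤ k) (v : ℤ) :
    leibnizSign a (Function.update p k v) l = leibnizSign a p l := by
  rw [leibnizSign_eq, leibnizSign_eq]
  congr 2
  refine Finset.sum_congr rfl fun t _ => ?_
  split_ifs with ht
  · rw [Function.update_of_ne (ne_of_lt (lt_of_lt_of_le ht h))]
  · rfl

theorem leibnizSign_update_of_lt {n : ℕ} (a : ℤ) (p : Fin n → ℤ) {k l : Fin n} (h : k < l) :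
    leibnizSign a (Function.update p k (p k - 1)) l = -leibnizSign a p l := by
  have : ∑ t, (if t < l then Function.update p k (p k - 1) t else 0) =
      (∑ t, if t < l then p t else 0) - 1 := by
    rw [← Finset.add_sum_erase _ _ (Finset.mem_univ k),
      ← Finset.add_sum_erase (a := k) _ (fun t => if t < l then p t else 0) (Finset.mem_univ k)]
    simp only [h, if_true, Function.update_self]
    rw [Finset.sum_congr rfl fun t ht => by
      rw [Function.update_of_ne (Finset.ne_of_mem_erase ht)]]
    ring
  rw [leibnizSign_eq, leibnizSign_eq, this, ← add_sub_assoc, Int.negOnePow_sub,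
    Int.negOnePow_one, mul_neg_one]

/-- Lowering the degree of one letter changes the Koszul sign of a rearrangement as it changes
the sign for moving a differential to that letter. -/
theorem leibnizSign_mul_koszulSign {m n : ℕ} (e : Fin m ≃ Fin n) (i : ℤ) (p : Fin n → ℤ)
    (k : Fin m) :
    leibnizSign i (fun a => p (e a)) k *
        koszulSign e (fun a => Function.update p (e k) (p (e k) - 1) (e a)) =
      koszulSign e (fun a => p (e a)) * leibnizSign i p (e k) := by
  have hL : (∑ l, if l < e k then p l else 0) = ∑ a, if e a < e k then p (e a) else 0 :=
    (Equiv.sum_comp e fun l => if l < e k then p l else 0).symm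
  rw [leibnizSign_eq, leibnizSign_eq, koszulSign_eq, koszulSign_eq, hL, ← Int.negOnePow_add,
    ← Int.negOnePow_add]
  -- work modulo 2, where the change of the degree is an indicator function
  apply negOnePow_congr
  have hu : ∀ a, ((Function.update p (e k) (p (e k) - 1) (e a) : ℤ) : ZMod 2) =
      p (e a) + if a = k then 1 else 0 := by
    intro a
    by_cases h : a = k
    · subst h
      simp only [Function.update_self, if_true]
      push_cast
      rw [sub_eq_add_neg, CharTwo.neg_eq]
    · rw [Function.update_of_ne (fun h' => h (e.injective h')), if_neg h, add_zero]
  push_cast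
  simp only [hu]
  have hK : ∀ a b : Fin m, (if a < b ∧ e b < e a then
      ((p (e a) : ZMod 2) + if a = k then 1 else 0) * ((p (e b) : ZMod 2) + if b = k then 1 else 0)
        else 0) =
      (if a < b ∧ e b < e a then (p (e a) : ZMod 2) * p (e b) else 0) +
      ((if b = k then (if a < k ∧ e k < e a then (p (e a) : ZMod 2) else 0) else 0) +
       (if a = k then (if k < b ∧ e b < e k then (p (e b) : ZMod 2) else 0) else 0)) := by
    intro a b
    by_cases h1 : a = k <;> by_cases h2 : b = k
    · subst h1; subst h2; simp
    · subst h1; simp only [if_true, if_neg h2]; split_ifs <;> ring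
    · subst h2; simp only [if_true, if_neg h1]; split_ifs <;> ring
    · simp [h1, h2]
  simp only [hK, Finset.sum_add_distrib]
  have hS1 : ∑ a : Fin m, ∑ b : Fin m, (if b = k then
      (if a < k ∧ e k < e a then (p (e a) : ZMod 2) else 0) else 0) =
      ∑ a, if a < k ∧ e k < e a then (p (e a) : ZMod 2) else 0 :=
    Finset.sum_congr rfl fun a _ => by simp
  have hS2 : ∑ a : Fin m, ∑ b : Fin m, (if a = k then
      (if k < b ∧ e b < e k then (p (e b) : ZMod 2) else 0) else 0) =
      ∑ b, if k < b ∧ e b < e k then (p (e b) : ZMod 2) else 0 := by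
    rw [Finset.sum_comm]
    exact Finset.sum_congr rfl fun a _ => by simp
  -- the letters to the left of `k` that stay there, and those that come there from the right
  have hmain : (∑ a, if a < k then (p (e a) : ZMod 2) else 0) +
      ((∑ a, if a < k ∧ e k < e a then (p (e a) : ZMod 2) else 0) +
        ∑ b, if k < b ∧ e b < e k then (p (e b) : ZMod 2) else 0) =
      ∑ a, if e a < e k then (p (e a) : ZMod 2) else 0 := by
    rw [← Finset.sum_add_distrib, ← Finset.sum_add_distrib]
    refine Finset.sum_congr rfl fun a _ => ?_
    rcases lt_trichotomy a k with h | h | h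
    · rcases lt_trichotomy (e a) (e k) with h' | h' | h'
      · simp [h, h', not_lt_of_gt h, not_lt_of_gt h']
      · exact absurd (e.injective h') (ne_of_lt h)
      · simp [h, h', not_lt_of_gt h, not_lt_of_gt h', CharTwo.add_self_eq_zero]
    · subst h; simp
    · rcases lt_trichotomy (e a) (e k) with h' | h' | h'
      · simp [h, h', not_lt_of_gt h]
      · exact absurd (e.injective h') (ne_of_gt h)
      · simp [h, not_lt_of_gt h, not_lt_of_gt h']
  rw [hS1, hS2, ← hmain]
  ring

theorem shuffle_update_left {n : ℕ} (p q : Fin n → ℤ) (k : Fin n) :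
    shuffleSign (Function.update p k (p k - 1)) q =
      shuffleSign p q * (∑ l, if l < k then q l else 0).negOnePow := by
  rw [shuffleSign_eq, shuffleSign_eq, ← Int.negOnePow_sub]
  congr 1
  rw [← Finset.sum_sub_distrib]
  refine Finset.sum_congr rfl fun a _ => ?_
  have : ∀ b, (if a < b then q a * Function.update p k (p k - 1) b else 0) =
      (if a < b then q a * p b else 0) - if b = k then (if a < k then q a else 0) else 0 := by
    intro b
    by_cases h : b = k
    · subst h; simp only [Function.update_self, if_true]; split_ifs <;> ring
    · rw [Function.update_of_ne h, if_neg h, sub_zero]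
  simp only [this, Finset.sum_sub_distrib]
  simp

theorem shuffle_update_right {n : ℕ} (p q : Fin n → ℤ) (k : Fin n) :
    shuffleSign p (Function.update q k (q k - 1)) =
      shuffleSign p q * (∑ l, if k < l then p l else 0).negOnePow := by
  rw [shuffleSign_eq, shuffleSign_eq, ← Int.negOnePow_sub]
  congr 1
  have : ∀ a b, (if a < b then Function.update q k (q k - 1) a * p b else 0) =
      (if a < b then q a * p b else 0) - if a = k then (if k < b then p b else 0) else 0 := by
    intro a b
    by_cases h : a = k
    · subst h; simp only [Function.update_self, if_true]; split_ifs <;> ring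
    · rw [Function.update_of_ne h, if_neg h, sub_zero]
  simp only [this, Finset.sum_sub_distrib]
  congr 1
  rw [Finset.sum_comm]
  simp

/-- The bijection `finSigmaFinEquiv` is increasing for the lexicographic order. -/
theorem finSigmaFinEquiv_lt_iff {n : ℕ} {j : Fin n → ℕ} (i i' : Fin n) (t : Fin (j i))
    (t' : Fin (j i')) :
    finSigmaFinEquiv ⟨i, t⟩ < finSigmaFinEquiv (⟨i', t'⟩ : (i : Fin n) × Fin (j i)) ↔
      i < i' ∨ ∃ h : i = i', h ▸ t < t' := by
  have key : ∀ (a b : Fin n) (s : Fin (j a)) (s' : Fin (j b)), a < b →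
      finSigmaFinEquiv (⟨a, s⟩ : (i : Fin n) × Fin (j i)) < finSigmaFinEquiv ⟨b, s'⟩ := by
    intro a b s s' hab
    rw [Fin.lt_def, finSigmaFinEquiv_apply, finSigmaFinEquiv_apply]
    -- the offset of a block is a sum over a range, which can be compared for different blocks
    have h1 : ∀ c : Fin n, ∑ i : Fin (c : ℕ), j (Fin.castLE c.2.le i) =
        ∑ i ∈ Finset.range c, if h : i < n then j ⟨i, h⟩ else 0 := by
      intro c
      rw [← Fin.sum_univ_eq_sum_range (fun i => if h : i < n then j ⟨i, h⟩ else 0)]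
      refine Finset.sum_congr rfl fun i _ => ?_
      rw [dif_pos (lt_trans i.2 c.2)]
      rfl
    rw [h1, h1]
    have h2 : ∑ i ∈ Finset.range (a + 1), (if h : i < n then j ⟨i, h⟩ else 0) ≤
        ∑ i ∈ Finset.range b, if h : i < n then j ⟨i, h⟩ else 0 :=
      Finset.sum_le_sum_of_subset (Finset.range_subset_range.2 hab)
    rw [Finset.sum_range_succ, dif_pos a.2] at h2
    have := s.2
    simp only [Fin.eta] at h2
    exact lt_of_lt_of_le (Nat.add_lt_add_left s.2 _)
      (le_trans h2 (Nat.le_add_right _ _))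
  rcases lt_trichotomy i i' with h | h | h
  · simp [key i i' t t' h, h]
  · subst h
    rw [Fin.lt_def, finSigmaFinEquiv_apply, finSigmaFinEquiv_apply]
    simp
  · have := key i' i t' t h
    simp [not_lt_of_gt this, not_lt_of_gt h, ne_of_gt h]

/-- The sum of the degrees to the left of a letter in a word made of blocks. -/
theorem sum_lt_finSigmaFinEquiv {n : ℕ} {j : Fin n → ℕ} (q : ∀ i, Fin (j i) → ℤ)
    (i : Fin n) (t : Fin (j i)) :
    (∑ l : Fin (∑ i, j i), if l < finSigmaFinEquiv ⟨i, t⟩ then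
        q (finSigmaFinEquiv.symm l).1 (finSigmaFinEquiv.symm l).2 else 0) =
      (∑ s, if s < i then ∑ u, q s u else 0) + ∑ u, if u < t then q i u else 0 := by
  rw [← Equiv.sum_comp finSigmaFinEquiv, Fintype.sum_sigma]
  have hq : ∀ s x, q (finSigmaFinEquiv.symm (finSigmaFinEquiv (⟨s, x⟩ : (i : Fin n) × Fin (j i)))).1
      (finSigmaFinEquiv.symm (finSigmaFinEquiv (⟨s, x⟩ : (i : Fin n) × Fin (j i)))).2 = q s x :=
    fun s x => congrArg (fun z : (i : Fin n) × Fin (j i) => q z.1 z.2)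
      (Equiv.symm_apply_apply _ _)
  simp only [hq, finSigmaFinEquiv_lt_iff]
  have h : (∑ u, if u < t then q i u else 0) =
      ∑ s, if h : s = i then ∑ u : Fin (j s), (if h ▸ u < t then q s u else 0) else 0 := by
    rw [Finset.sum_eq_single i]
    · simp
    · intro s _ hs; simp [hs]
    · simp
  rw [h, ← Finset.sum_add_distrib]
  refine Finset.sum_congr rfl fun s _ => ?_
  by_cases hs : s = i
  · subst hs; simp
  · simp [hs]

variable {O : Operad R}

theorem units_smul_apply {n : ℕ} {M N : Type*} [AddCommGroup M] [AddCommGroup N]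
    [Module R M] [Module R N] (f : MultilinearMap R (fun _ : Fin n => M) N) (s : ℤˣ)
    (x : Fin n → M) : (s • f) x = s • f x := by
  rcases Int.units_eq_one_or s with rfl | rfl <;> simp [Units.smul_def]

theorem sum_antisymmetric_eq_zero {n : ℕ} {M : Type*} [AddCommGroup M] (f : Fin n → Fin n → M)
    (h0 : ∀ k, f k k = 0) (h : ∀ k l, k < l → f k l + f l k = 0) : ∑ k, ∑ l, f k l = 0 := by
  rw [← Finset.sum_product' Finset.univ Finset.univ f]
  refine Finset.sum_involution (fun s _ => s.swap) (fun s _ => ?_) (fun s _ hs hs' => ?_)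
    (fun _ _ => Finset.mem_univ _) fun s _ => s.swap_swap
  · rcases lt_trichotomy s.1 s.2 with hs | hs | hs
    · exact h _ _ hs
    · simp [hs, h0]
    · rw [add_comm]; exact h _ _ hs
  · refine hs ?_
    have : s.2 = s.1 := congrArg Prod.fst hs'
    rw [this, h0]

/-! ### Cofree differential graded algebras -/

/-- The graded module `C ⊕ C[1]`, whose elements of degree `i` are the pairs `(c, e)` with `c` of
degree `i` and `e` of degree `i - 1`. -/
def GrModule.path (C : GrModule R) : GrModule R where
  carrier := C.carrier × C.carrier
  gr i := (C.gr i).prod (C.gr (i - 1))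
  isInternal := by
    refine isInternal_of_projections _ (fun i => (C.proj i).prodMap (C.proj (i - 1))) ?_ ?_ ?_
    · rintro i ⟨x, y⟩ ⟨hx, hy⟩
      exact Prod.ext (GrModule.proj_self hx) (GrModule.proj_self hy)
    · rintro i j h ⟨x, y⟩ ⟨hx, hy⟩
      exact Prod.ext (GrModule.proj_of_ne h hx) (GrModule.proj_of_ne (by omega) hy)
    · rintro ⟨x, y⟩
      have h1 : ((x, 0) : C.carrier × C.carrier) ∈ ⨆ i, (C.gr i).prod (C.gr (i - 1)) := by
        refine GrModule.induction (P := fun x => ((x, 0) : C.carrier × C.carrier) ∈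
          ⨆ i, (C.gr i).prod (C.gr (i - 1))) x (fun i z hz => ?_) fun a b ha hb => ?_
        · exact Submodule.mem_iSup_of_mem i ⟨hz, zero_mem _⟩
        · simpa using add_mem ha hb
      have h2 : ((0, y) : C.carrier × C.carrier) ∈ ⨆ i, (C.gr i).prod (C.gr (i - 1)) := by
        refine GrModule.induction (P := fun x => ((0, x) : C.carrier × C.carrier) ∈
          ⨆ i, (C.gr i).prod (C.gr (i - 1))) y (fun i z hz => ?_) fun a b ha hb => ?_
        · refine Submodule.mem_iSup_of_mem (i + 1) ⟨zero_mem _, ?_⟩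
          change z ∈ C.gr (i + 1 - 1)
          rwa [add_sub_cancel_right]
        · simpa using add_mem ha hb
      simpa using add_mem h1 h2

/-- The factor in position `l` of the `k`-th summand of the Leibniz rule: the differential sits in
position `k`, and the letters to its left contribute their signs. -/
def pathSlot (C : GrModule R) {n : ℕ} (k l : Fin n) : C.carrier × C.carrier →ₗ[R] C.carrier :=
  if l < k then C.sign ∘ₗ LinearMap.fst R _ _ else
    if l = k then LinearMap.snd R _ _ else LinearMap.fst R _ _

/-- The products of the cofree algebra: on pairs `(c, e)`, the second component follows the Leibniz
rule with `e` in the place of `dc`. The sign `(-1)^(i + p₀ + ⋯ + pₖ₋₁)` of the `k`-th summand is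
produced by the grading involutions of the operation and of the letters to the left of `k`, so that
the formula is multilinear and makes sense for inhomogeneous elements. -/
def pathOp (C : GrAlg O) (n : ℕ) : O.obj n →ₗ[R]
    MultilinearMap R (fun _ : Fin n => C.carrier × C.carrier) (C.carrier × C.carrier) where
  toFun x := ((C.op n x).compLinearMap fun _ => LinearMap.fst R _ _).prod
    ((C.op n ((O.obj n).d x)).compLinearMap (fun _ => LinearMap.fst R _ _) +
      ∑ k, (C.op n ((O.obj n).sign x)).compLinearMap (pathSlot C.toGrModule k))
  map_add' x y := by
    ext a
    · simp
    · simp only [map_add, MultilinearMap.prod_apply, add_apply,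
        MultilinearMap.compLinearMap_apply, sum_apply, Finset.sum_add_distrib,
        Prod.snd_add]
      abel
  map_smul' r x := by
    ext a
    · simp
    · simp only [map_smul, MultilinearMap.prod_apply, add_apply,
        MultilinearMap.compLinearMap_apply, sum_apply, smul_apply,
        Prod.smul_snd, RingHom.id_apply, smul_add, Finset.smul_sum]

theorem pathOp_fst (C : GrAlg O) {n : ℕ} (x : O.obj n) (a : Fin n → C.carrier × C.carrier) :
    (pathOp C n x a).1 = C.op n x (fun k => (a k).1) := rfl

theorem pathOp_snd_eq (C : GrAlg O) {n : ℕ} (x : O.obj n) (a : Fin n → C.carrier × C.carrier) :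
    (pathOp C n x a).2 = C.op n ((O.obj n).d x) (fun k => (a k).1) +
      ∑ k, C.op n ((O.obj n).sign x) (fun l => pathSlot C.toGrModule k l (a l)) := by
  simp [pathOp]

theorem pathOp_snd (C : GrAlg O) {n : ℕ} {i : ℤ} {x : O.obj n} {p : Fin n → ℤ}
    {a : Fin n → C.carrier × C.carrier} (hx : x ∈ (O.obj n).gr i)
    (ha : ∀ k, (a k).1 ∈ C.gr (p k)) :
    (pathOp C n x a).2 = C.op n ((O.obj n).d x) (fun k => (a k).1) +
      ∑ k, leibnizSign i p k • C.op n x (Function.update (fun k => (a k).1) k (a k).2) := by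
  rw [pathOp_snd_eq]
  congr 1
  refine Finset.sum_congr rfl fun k _ => ?_
  have hs : (fun l => pathSlot C.toGrModule k l (a l)) = fun l =>
      (if l < k then (p l).negOnePow else 1) •
        Function.update (fun k => (a k).1) k (a k).2 l := by
    funext l
    rcases lt_trichotomy l k with hl | hl | hl
    · simp [pathSlot, hl, ne_of_lt hl, GrModule.sign_apply (ha l)]
    · subst hl; simp [pathSlot]
    · simp [pathSlot, not_lt_of_gt hl, ne_of_gt hl]
  rw [hs, multilinear_units_smul, GrModule.sign_apply hx, map_units_smul,
    units_smul_apply, smul_smul, leibnizSign_eq, Int.negOnePow_add, ← negOnePow_sum, mul_comm]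
  congr 2
  refine Finset.prod_congr rfl fun l _ => ?_
  split_ifs <;> rfl

/-- Changing one letter of a word made of blocks. -/
theorem update_blocks {α : Type*} {n : ℕ} {j : Fin n → ℕ} (c : ∀ i, Fin (j i) → α) (i : Fin n)
    (t : Fin (j i)) (v : α) :
    Function.update (fun s : Fin (∑ i, j i) => c (finSigmaFinEquiv.symm s).1
        (finSigmaFinEquiv.symm s).2) (finSigmaFinEquiv ⟨i, t⟩) v =
      fun s => Function.update c i (Function.update (c i) t v) (finSigmaFinEquiv.symm s).1
        (finSigmaFinEquiv.symm s).2 := by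
  have h : Function.update (fun z : (i : Fin n) × Fin (j i) => c z.1 z.2) ⟨i, t⟩ v =
      fun z => Function.update c i (Function.update (c i) t v) z.1 z.2 := by
    funext ⟨s, u⟩
    by_cases hs : s = i
    · subst hs
      by_cases hu : u = t
      · subst hu; simp
      · rw [Function.update_of_ne (by simpa using hu)]
        simp [hu]
    · rw [Function.update_of_ne (fun h => hs (congrArg Sigma.fst h))]
      simp [hs]
  funext s
  obtain ⟨z, rfl⟩ := finSigmaFinEquiv.surjective s
  have := congrFun h z
  by_cases hz : z = ⟨i, t⟩
  · subst hz
    rw [Function.update_self] at this ⊢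
    exact this.trans (congrArg (fun w : (i : Fin n) × Fin (j i) =>
      Function.update c i (Function.update (c i) t v) w.1 w.2) (Equiv.symm_apply_apply _ _)).symm
  · rw [Function.update_of_ne hz] at this
    rw [Function.update_of_ne (fun h => hz (finSigmaFinEquiv.injective h))]
    have h1 := Equiv.symm_apply_apply finSigmaFinEquiv z
    exact (congrArg (fun w : (i : Fin n) × Fin (j i) => c w.1 w.2) h1).trans
      (this.trans (congrArg (fun w : (i : Fin n) × Fin (j i) =>
        Function.update c i (Function.update (c i) t v) w.1 w.2) h1).symm)

section

variable (C : GrAlg O)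

theorem pathOp_mem {n : ℕ} {i : ℤ} {x : O.obj n} {p : Fin n → ℤ}
    {a : Fin n → C.carrier × C.carrier} (hx : x ∈ (O.obj n).gr i)
    (ha : ∀ k, a k ∈ (C.gr (p k)).prod (C.gr (p k - 1))) :
    pathOp C n x a ∈ (C.gr (i + ∑ k, p k)).prod (C.gr (i + ∑ k, p k - 1)) := by
  refine ⟨C.op_mem hx fun k => (ha k).1, ?_⟩
  rw [SetLike.mem_coe, pathOp_snd C hx fun k => (ha k).1]
  refine add_mem ?_ (sum_mem fun k _ => GrModule.units_smul_mem ?_ _)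
  · have := C.op_mem ((O.obj n).d_mem hx) fun k => (ha k).1
    rwa [show i - 1 + ∑ k, p k = i + ∑ k, p k - 1 by ring] at this
  · have : C.op n x (Function.update (fun k => (a k).1) k (a k).2) ∈
        C.gr (i + ∑ l, Function.update p k (p k - 1) l) := by
      refine C.op_mem hx fun l => ?_
      by_cases hl : l = k
      · subst hl; simpa using (ha l).2
      · simpa [hl] using (ha l).1
    rw [Finset.sum_update_of_mem (Finset.mem_univ k), ← Finset.erase_eq] at this
    rw [← Finset.add_sum_erase _ _ (Finset.mem_univ k)]
    convert this using 2
    ring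

theorem pathOp_one (a : Fin 1 → C.carrier × C.carrier) : pathOp C 1 O.one a = a 0 := by
  refine Prod.ext (C.op_one _) ?_
  have hs : (O.obj 1).sign O.one = O.one := by
    rw [GrModule.sign_apply O.one_mem, Int.negOnePow_zero, one_smul]
  simp [pathOp_snd_eq, O.d_one, hs, C.op_one, pathSlot]

theorem pathOp_act {m n : ℕ} (e : Fin m ≃ Fin n) (x : O.obj n) {p : Fin n → ℤ}
    {a : Fin n → C.carrier × C.carrier} (ha : ∀ k, a k ∈ (C.gr (p k)).prod (C.gr (p k - 1))) :
    pathOp C m (O.act e x) (fun i => a (e i)) =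
      koszulSign e (fun i => p (e i)) • pathOp C n x a := by
  have ha1 : ∀ k, (a k).1 ∈ C.gr (p k) := fun k => (ha k).1
  refine Prod.ext (C.op_act e x ha1) ?_
  refine GrModule.induction (M := (O.obj n).toGrModule) (P := fun x =>
    (pathOp C m (O.act e x) fun i => a (e i)).2 =
      (koszulSign e (fun i => p (e i)) • pathOp C n x a).2) x (fun i y hy => ?_)
      fun y z hy hz => ?_
  · rw [pathOp_snd C (O.act_mem e hy) fun k => ha1 (e k), O.d_act]
    change _ = koszulSign e (fun i => p (e i)) • (pathOp C n y a).2
    rw [pathOp_snd C hy ha1, smul_add, ← C.op_act e ((O.obj n).d y) ha1, Finset.smul_sum]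
    congr 1
    rw [← Equiv.sum_comp e]
    refine Finset.sum_congr rfl fun k _ => ?_
    have h1 : Function.update (fun k => (a (e k)).1) k (a (e k)).2 =
        fun l => Function.update (fun k => (a k).1) (e k) (a (e k)).2 (e l) := by
      funext l
      by_cases hl : l = k
      · subst hl; simp
      · simp [hl]
    rw [h1, C.op_act e y (p := Function.update p (e k) (p (e k) - 1)), smul_smul, smul_smul,
      leibnizSign_mul_koszulSign]
    intro l
    by_cases hl : l = e k
    · subst hl; simpa using (ha (e k)).2
    · simpa [hl] using ha1 l
  · simp only [map_add, add_apply, Prod.snd_add, smul_add, hy, hz]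

/-- The signs of the terms of `d` of a composite in which the differential hits a letter of an inner
word. -/
theorem shuffleSign_update_right_mul {n : ℕ} {j : Fin n → ℕ} (i₀ : ℤ) (p : Fin n → ℤ)
    (q : ∀ i, Fin (j i) → ℤ) (i : Fin n) (t : Fin (j i)) :
    leibnizSign (i₀ + ∑ i, p i) (fun s => q (finSigmaFinEquiv.symm s).1
        (finSigmaFinEquiv.symm s).2) (finSigmaFinEquiv ⟨i, t⟩) *
      shuffleSign p (Function.update (fun i => ∑ t, q i t) i ((∑ t, q i t) - 1)) =
    shuffleSign p (fun i => ∑ t, q i t) *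
      (leibnizSign i₀ (fun i => p i + ∑ t, q i t) i * leibnizSign (p i) (q i) t) := by
  rw [shuffle_update_right p (fun i => ∑ t, q i t), mul_left_comm]
  congr 1
  rw [leibnizSign_eq, leibnizSign_eq, leibnizSign_eq, sum_lt_finSigmaFinEquiv,
    ← Int.negOnePow_add, ← Int.negOnePow_add]
  apply negOnePow_congr
  have h1 : ∑ s, p s = (∑ s, if s < i then p s else 0) + p i + ∑ s, if i < s then p s else 0 := by
    have : p i = ∑ s, if s = i then p s else 0 := by simp
    rw [this, ← Finset.sum_add_distrib, ← Finset.sum_add_distrib]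
    refine Finset.sum_congr rfl fun s _ => ?_
    rcases lt_trichotomy s i with h | h | h
    · simp [h, not_lt_of_gt h, ne_of_lt h]
    · subst h; simp
    · simp [h, not_lt_of_gt h, ne_of_gt h]
  have h2 : (∑ s, if s < i then p s + ∑ t, q s t else 0) =
      (∑ s, if s < i then p s else 0) + ∑ s, if s < i then ∑ t, q s t else 0 := by
    rw [← Finset.sum_add_distrib]
    refine Finset.sum_congr rfl fun s _ => ?_
    split_ifs <;> simp
  rw [h1, h2]
  have h3 := CharTwo.add_self_eq_zero (((∑ s, if i < s then p s else 0 : ℤ)) : ZMod 2)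
  simp only [Int.cast_add]
  linear_combination h3

theorem pathOp_comp {n : ℕ} (j : Fin n → ℕ) (x : O.obj n) {p : Fin n → ℤ}
    {y : ∀ i, O.obj (j i)} {q : ∀ i, Fin (j i) → ℤ} {a : ∀ i, Fin (j i) → C.carrier × C.carrier}
    (hy : ∀ i, y i ∈ (O.obj (j i)).gr (p i))
    (ha : ∀ i t, a i t ∈ (C.gr (q i t)).prod (C.gr (q i t - 1))) :
    pathOp C (∑ i, j i) (O.comp j x y)
        (fun t => a (finSigmaFinEquiv.symm t).1 (finSigmaFinEquiv.symm t).2) =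
      shuffleSign p (fun i => ∑ t, q i t) •
        pathOp C n x (fun i => pathOp C (j i) (y i) (a i)) := by
  have ha1 : ∀ i t, (a i t).1 ∈ C.gr (q i t) := fun i t => (ha i t).1
  refine Prod.ext (C.op_comp j x hy ha1) ?_
  refine GrModule.induction (M := (O.obj n).toGrModule) (P := fun x =>
    (pathOp C (∑ i, j i) (O.comp j x y)
        (fun t => a (finSigmaFinEquiv.symm t).1 (finSigmaFinEquiv.symm t).2)).2 =
      (shuffleSign p (fun i => ∑ t, q i t) •
        pathOp C n x (fun i => pathOp C (j i) (y i) (a i))).2) x (fun i₀ z hz => ?_)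
      fun y z hy hz => ?_
  · have hb : ∀ i, (pathOp C (j i) (y i) (a i)).1 ∈ C.gr (p i + ∑ t, q i t) :=
      fun i => C.op_mem (hy i) (ha1 i)
    rw [pathOp_snd C (O.comp_mem j hz hy) (p := fun t => q (finSigmaFinEquiv.symm t).1
      (finSigmaFinEquiv.symm t).2) fun t => ha1 _ _, O.d_comp j hz hy]
    change _ = shuffleSign p (fun i => ∑ t, q i t) •
      (pathOp C n z (fun i => pathOp C (j i) (y i) (a i))).2
    rw [pathOp_snd C hz (p := fun i => p i + ∑ t, q i t) hb]
    simp only [pathOp_fst, pathOp_snd C (hy _) (ha1 _)]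
    rw [← Equiv.sum_comp finSigmaFinEquiv, Fintype.sum_sigma]
    simp only [map_add, map_sum, add_apply, sum_apply, smul_add, Finset.smul_sum,
      MultilinearMap.map_update_add, MultilinearMap.map_update_sum,
      multilinear_update_units_smul, map_units_smul, units_smul_apply]
    rw [C.op_comp j _ hy ha1, add_assoc, ← Finset.sum_add_distrib]
    refine congrArg₂ _ rfl (Finset.sum_congr rfl fun i _ => ?_)
    congr 1
    -- the differential hits the inner operation `y i`
    · have hy' : ∀ i', Function.update y i ((O.obj (j i)).d (y i)) i' ∈
          (O.obj (j i')).gr (Function.update p i (p i - 1) i') := by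
        intro i'
        by_cases h : i' = i
        · subst h; simpa using (O.obj _).d_mem (hy i')
        · simpa [h] using hy i'
      rw [C.op_comp j z hy' ha1, smul_smul, smul_smul]
      congr 1
      · rw [shuffle_update_left, leibnizSign_eq, leibnizSign_eq, mul_left_comm,
          ← Int.negOnePow_add]
        congr 2
        rw [add_assoc, ← Finset.sum_add_distrib]
        refine congrArg _ (Finset.sum_congr rfl fun s _ => ?_)
        split_ifs <;> simp
      · congr 1
        funext i'
        by_cases h : i' = i
        · subst h; simp
        · simp [h]
    -- the differential hits the letter `t` of the `i`-th inner word
    · refine Finset.sum_congr rfl fun t _ => ?_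
      have hv : (a (finSigmaFinEquiv.symm (finSigmaFinEquiv ⟨i, t⟩)).1
          (finSigmaFinEquiv.symm (finSigmaFinEquiv ⟨i, t⟩)).2).2 = (a i t).2 :=
        congrArg (fun w : (i : Fin n) × Fin (j i) => (a w.1 w.2).2) (Equiv.symm_apply_apply _ _)
      have ha' : ∀ i' t', Function.update (fun i t => (a i t).1) i
          (Function.update (fun t => (a i t).1) t (a i t).2) i' t' ∈
          C.gr (Function.update q i (Function.update (q i) t (q i t - 1)) i' t') := by
        intro i' t'
        by_cases h : i' = i
        · subst h
          by_cases h' : t' = t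
          · subst h'; simpa using (ha i' t').2
          · simpa [h'] using ha1 i' t'
        · simpa [h] using ha1 i' t'
      have hQ : (fun i' => ∑ t', Function.update q i (Function.update (q i) t (q i t - 1)) i' t') =
          Function.update (fun i => ∑ t, q i t) i ((∑ t, q i t) - 1) := by
        funext i'
        by_cases h : i' = i
        · subst h
          simp only [Function.update_self]
          rw [Finset.sum_update_of_mem (Finset.mem_univ t), ← Finset.erase_eq,
            ← Finset.add_sum_erase _ _ (Finset.mem_univ t)]
          ring
        · simp [h]
      rw [hv, update_blocks (fun i t => (a i t).1) i t, C.op_comp j z hy ha', hQ, smul_smul,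
        smul_smul, smul_smul, shuffleSign_update_right_mul, mul_assoc]
      congr 2
      funext i'
      by_cases h : i' = i
      · subst h; simp
      · simp [h]
  · simp only [map_add, add_apply, Prod.snd_add, smul_add, hy, hz]

/-- The Leibniz rule for the differential `(c, e) ↦ (e, 0)`. -/
theorem pathOp_leibniz {n : ℕ} {i : ℤ} {x : O.obj n} {p : Fin n → ℤ}
    {a : Fin n → C.carrier × C.carrier} (hx : x ∈ (O.obj n).gr i)
    (ha : ∀ k, a k ∈ (C.gr (p k)).prod (C.gr (p k - 1))) :
    ((pathOp C n x a).2, (0 : C.carrier)) = pathOp C n ((O.obj n).d x) a +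
      ∑ k, leibnizSign i p k • pathOp C n x (Function.update a k ((a k).2, 0)) := by
  have ha1 : ∀ k, (a k).1 ∈ C.gr (p k) := fun k => (ha k).1
  have hu : ∀ k, (fun l => (Function.update a k ((a k).2, 0) l).1) =
      Function.update (fun l => (a l).1) k (a k).2 := by
    intro k
    funext l
    by_cases h : l = k
    · subst h; simp
    · simp [h]
  refine Prod.ext ?_ ?_
  · rw [Prod.fst_add, Prod.fst_sum, pathOp_snd C hx ha1]
    refine congrArg₂ _ rfl (Finset.sum_congr rfl fun k _ => ?_)
    change _ = leibnizSign i p k • (pathOp C n x _).1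
    rw [pathOp_fst, hu]
  · rw [Prod.snd_add, Prod.snd_sum, pathOp_snd C ((O.obj n).d_mem hx) ha1, (O.obj n).d_d]
    have h2 : ∀ k, (leibnizSign i p k • pathOp C n x (Function.update a k ((a k).2, 0))).2 =
        leibnizSign i p k • (C.op n ((O.obj n).d x) (Function.update (fun l => (a l).1) k (a k).2) +
          ∑ l, if l = k then 0 else leibnizSign i (Function.update p k (p k - 1)) l • C.op n x
            (Function.update (Function.update (fun l => (a l).1) k (a k).2) l (a l).2)) := by
      intro k
      change leibnizSign i p k • (pathOp C n x _).2 = _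
      rw [pathOp_snd C (p := Function.update p k (p k - 1)) hx, hu]
      · congr 2
        refine Finset.sum_congr rfl fun l _ => ?_
        by_cases h : l = k
        · subst h
          simp
        · simp [h]
      · intro l
        by_cases h : l = k
        · subst h; simpa using (ha l).2
        · simpa [h] using ha1 l
    simp only [h2, smul_add, Finset.sum_add_distrib, leibnizSign_sub_one, Units.neg_smul,
      Finset.sum_neg_distrib, map_zero, zero_apply, zero_add, neg_add_cancel_left]
    -- the remaining double sum is antisymmetric
    simp only [Finset.smul_sum]
    refine (sum_antisymmetric_eq_zero _ (fun k => by simp) fun k l hkl => ?_).symm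
    rw [if_neg hkl.ne', if_neg hkl.ne, smul_smul, smul_smul, Function.update_comm hkl.ne,
      leibnizSign_update_of_lt _ _ hkl, leibnizSign_update_of_le _ _ hkl.le, mul_neg,
      Units.neg_smul, mul_comm, neg_add_cancel]

end

/-- The cofree differential graded `O`-algebra on the graded algebra `C`: it consists of the pairs
`(c, e)`, where `e` stands for the differential of `c`. -/
def path (C : GrAlg O) : Alg O where
  toGrModule := C.toGrModule.path
  op := pathOp C
  op_mem hx ha := pathOp_mem C hx ha
  op_one a := pathOp_one C a
  op_act e x _ _ ha := pathOp_act C e x ha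
  op_comp j x _ _ _ _ hy ha := pathOp_comp C j x hy ha
  d := LinearMap.inl R C.carrier C.carrier ∘ₗ LinearMap.snd R C.carrier C.carrier
  d_mem hx := ⟨hx.2, zero_mem _⟩
  d_d _ := rfl
  d_op hx ha := pathOp_leibniz C hx ha

/-! ### Morphisms of graded algebras, derivations and generated subalgebras -/

namespace GrAlg.Hom

/-- The identity morphism of a graded algebra. -/
def id (A : GrAlg O) : A.Hom A where
  toLin := LinearMap.id
  map_mem h := h
  map_op _ _ _ := rfl

/-- The composition of morphisms of graded algebras, in diagrammatic order. -/
def comp {A B C : GrAlg O} (f : A.Hom B) (g : B.Hom C) : A.Hom C where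
  toLin := g.toLin ∘ₗ f.toLin
  map_mem h := g.map_mem (f.map_mem h)
  map_op n x a := by simp [f.map_op, g.map_op]

end GrAlg.Hom

/-- The projection `(c, e) ↦ c` of the cofree algebra, which is the counit of the adjunction
between differential graded algebras and graded algebras. -/
def pathFst (C : GrAlg O) : (path C).toGrAlg.Hom C where
  toLin := LinearMap.fst R C.carrier C.carrier
  map_mem h := h.1
  map_op _ _ _ := rfl

/-- The morphism `a ↦ (f a, f (d a))` to the cofree algebra that corresponds to a morphism `f` of
graded algebras. -/
def toPath {A : Alg O} {C : GrAlg O} (f : A.toGrAlg.Hom C) : A ⟶ path C where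
  toLin := f.toLin.prod (f.toLin ∘ₗ A.d)
  map_mem h := ⟨f.map_mem h, f.map_mem (A.d_mem h)⟩
  map_op n x := by
    let F : A.carrier →ₗ[R] C.carrier × C.carrier := f.toLin.prod (f.toLin ∘ₗ A.d)
    suffices h : F.compMultilinearMap (A.op n x) = (pathOp C n x).compLinearMap fun _ => F from
      fun a => congrArg (fun G => G a) h
    refine GrModule.induction (M := (O.obj n).toGrModule) (P := fun x =>
      F.compMultilinearMap (A.op n x) = (pathOp C n x).compLinearMap fun _ => F) x
      (fun i y hy => ?_) fun y z hy hz => ?_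
    · refine multilinear_ext_of_homogeneous (M := fun _ => A.toGrModule) fun p a ha => ?_
      refine Prod.ext (f.map_op n y a) ?_
      change f.toLin (A.d (A.op n y a)) = (pathOp C n y (fun k => F (a k))).2
      rw [pathOp_snd C hy (fun k => f.map_mem (ha k)), A.d_op hy ha, map_add, map_sum, f.map_op]
      refine congrArg₂ _ rfl (Finset.sum_congr rfl fun k _ => ?_)
      rw [map_units_smul, f.map_op]
      congr 2
      funext l
      exact Function.apply_update (fun _ => f.toLin) a k (A.d (a k)) l
    · have h1 : F.compMultilinearMap (A.op n (y + z)) =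
          F.compMultilinearMap (A.op n y) + F.compMultilinearMap (A.op n z) := by
        rw [map_add]
        exact MultilinearMap.ext fun a => map_add F _ _
      rw [h1, hy, hz, map_add]
      rfl
  map_d a := Prod.ext rfl (by
    change f.toLin (A.d (A.d a)) = 0
    rw [A.d_d, map_zero])

/-- Morphisms to the cofree algebra are determined by their first component. -/
theorem path_hom_ext {A : Alg O} {C : GrAlg O} {f g : A ⟶ path C}
    (h : ∀ a, (lin f a).1 = (lin g a).1) : f = g := by
  refine Alg.Hom.ext (LinearMap.ext fun a => Prod.ext (h a) ?_)
  have hf : ∀ k : A ⟶ path C, (lin k a).2 = (lin k (A.d a)).1 := fun k =>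
    (congrArg Prod.fst (Alg.Hom.map_d k a)).symm
  exact (hf f).trans ((h _).trans (hf g).symm)

/-- A graded algebra with a section of the projection from its cofree algebra, that is with a
derivation over the differential of the operad, is a differential graded algebra if the derivation
has square zero. -/
def Alg.ofSection (B : GrAlg O) (D : B.Hom (path B).toGrAlg) (hD : ∀ b, (D.toLin b).1 = b)
    (hDD : ∀ b, (D.toLin (D.toLin b).2).2 = 0) : Alg O where
  toGrAlg := B
  d := LinearMap.snd R B.carrier B.carrier ∘ₗ D.toLin
  d_mem h := (D.map_mem h).2
  d_d := hDD
  d_op {n i x p a} hx ha := by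
    let b : Fin n → B.carrier × B.carrier := fun k => D.toLin (a k)
    have hb : (fun k => (b k).1) = a := funext fun k => hD (a k)
    have h1 : (D.toLin (B.op n x a)).2 = (pathOp B n x b).2 := congrArg Prod.snd (D.map_op n x a)
    have h2 := pathOp_snd B (a := b) hx (fun k => by rw [congrFun hb k]; exact ha k)
    rw [hb] at h2
    exact h1.trans h2

/-- The morphism given by a morphism of graded algebras that commutes with the differentials. -/
def GrAlg.Hom.toAlgHom {A B : Alg O} (f : A.toGrAlg.Hom B.toGrAlg)
    (h : ∀ a, f.toLin (A.d a) = B.d (f.toLin a)) : A ⟶ B :=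
  { f with map_d := h }

namespace GrAlg

variable {A B : GrAlg O}

theorem subset_adjoin (s : Set A.carrier) : s ⊆ A.adjoin s :=
  fun _ hx => Submodule.mem_sInf.2 fun _ hS => hS.1 hx

theorem op_mem_adjoin {s : Set A.carrier} {n : ℕ} (x : O.obj n) {a : Fin n → A.carrier}
    (ha : ∀ i, a i ∈ A.adjoin s) : A.op n x a ∈ A.adjoin s :=
  Submodule.mem_sInf.2 fun S hS => hS.2 n x a fun i => Submodule.mem_sInf.1 (ha i) S hS

theorem adjoin_le {s : Set A.carrier} {S : Submodule R A.carrier} (hs : s ⊆ S)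
    (hS : ∀ (n : ℕ) (x : O.obj n) (a : Fin n → A.carrier), (∀ i, a i ∈ S) → A.op n x a ∈ S) :
    A.adjoin s ≤ S :=
  sInf_le ⟨hs, hS⟩

theorem adjoin_le_adjoin {s t : Set A.carrier} (h : s ⊆ A.adjoin t) : A.adjoin s ≤ A.adjoin t :=
  adjoin_le h fun _ x _ ha => op_mem_adjoin x ha

theorem adjoin_mono {s t : Set A.carrier} (h : s ⊆ t) : A.adjoin s ≤ A.adjoin t :=
  adjoin_le_adjoin (h.trans (subset_adjoin t))

theorem nullary_mem_adjoin (s : Set A.carrier) (x : O.obj 0) : A.nullary x ∈ A.adjoin s :=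
  op_mem_adjoin x fun i => i.elim0

/-- A morphism that maps generators into a generated subalgebra maps all elements there. -/
theorem Hom.map_adjoin (f : A.Hom B) {s : Set A.carrier} {t : Set B.carrier}
    (h : ∀ a ∈ s, f.toLin a ∈ B.adjoin t) {a : A.carrier} (ha : a ∈ A.adjoin s) :
    f.toLin a ∈ B.adjoin t := by
  refine adjoin_le (S := (B.adjoin t).comap f.toLin) h (fun n x a ha => ?_) ha
  rw [Submodule.mem_comap, f.map_op]
  exact op_mem_adjoin x ha

theorem Hom.eqOn_adjoin {f g : A.Hom B} {s : Set A.carrier}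
    (h : ∀ a ∈ s, f.toLin a = g.toLin a) {a : A.carrier} (ha : a ∈ A.adjoin s) :
    f.toLin a = g.toLin a := by
  refine adjoin_le (S := LinearMap.eqLocus f.toLin g.toLin) h (fun n x a ha => ?_) ha
  rw [LinearMap.mem_eqLocus, f.map_op, g.map_op]
  exact congrArg _ (funext ha)

theorem Hom.adjoin_le_range (f : A.Hom B) {s : Set B.carrier} (h : s ⊆ Set.range f.toLin) :
    (B.adjoin s : Set B.carrier) ⊆ Set.range f.toLin := by
  intro b hb
  have := adjoin_le (S := LinearMap.range f.toLin) h (fun n x a ha => ?_) hb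
  · exact this
  · choose c hc using ha
    exact ⟨A.op n x c, by rw [f.map_op]; exact congrArg _ (funext hc)⟩

end GrAlg

/-- A morphism of graded algebras that commutes with the differentials on a set does so on the
subalgebra that it generates. -/
theorem map_d_of_mem_adjoin {A B : Alg O} (f : A.toGrAlg.Hom B.toGrAlg) {s : Set A.carrier}
    (h : ∀ a ∈ s, f.toLin (A.d a) = B.d (f.toLin a)) {a : A.carrier} (ha : a ∈ A.adjoin s) :
    f.toLin (A.d a) = B.d (f.toLin a) :=
  congrArg Prod.snd (GrAlg.Hom.eqOn_adjoin (f := gr (toPath f))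
    (g := f.comp (gr (toPath (GrAlg.Hom.id B.toGrAlg))))
    (fun a ha => Prod.ext rfl (h a ha)) ha)

/-- The ground algebra is initial among the graded algebras. -/
theorem ground_hom_unique {C : GrAlg O} (f g : (ground O).toGrAlg.Hom C)
    (x : (ground O).carrier) : f.toLin x = g.toLin x := by
  have h : toPath f = toPath g := (hom_ground_ext _).trans (hom_ground_ext _).symm
  exact congrArg (fun k : ground O ⟶ path C => (lin k x).1) h

/-! ### Free graded algebras -/

/-- The graded algebra `A` is free on the generators `gen t`, of degree `deg t`. -/
def IsFreeOn {T : Type u} (A : GrAlg O) (deg : T → ℤ) (gen : T → A.carrier) : Prop :=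
  (∀ t, gen t ∈ A.gr (deg t)) ∧ ∀ (C : GrAlg O) (v : T → C.carrier),
    (∀ t, v t ∈ C.gr (deg t)) → ∃! h : A.Hom C, ∀ t, h.toLin (gen t) = v t

namespace IsFreeOn

variable {T : Type u} {A : GrAlg O} {deg : T → ℤ} {gen : T → A.carrier}

/-- The morphism with prescribed values on free generators. -/
def lift (h : IsFreeOn A deg gen) {C : GrAlg O} (v : T → C.carrier)
    (hv : ∀ t, v t ∈ C.gr (deg t)) : A.Hom C :=
  (h.2 C v hv).choose

theorem lift_gen (h : IsFreeOn A deg gen) {C : GrAlg O} (v : T → C.carrier)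
    (hv : ∀ t, v t ∈ C.gr (deg t)) (t : T) : (h.lift v hv).toLin (gen t) = v t :=
  (h.2 C v hv).choose_spec.1 t

theorem hom_ext (h : IsFreeOn A deg gen) {C : GrAlg O} {f g : A.Hom C}
    (hfg : ∀ t, f.toLin (gen t) = g.toLin (gen t)) : f = g :=
  (h.2 C _ fun t => g.map_mem (h.1 t)).unique hfg fun _ => rfl

theorem map_d {A : Alg O} {gen : T → A.carrier} (h : IsFreeOn A.toGrAlg deg gen) {B : Alg O}
    (f : A.toGrAlg.Hom B.toGrAlg) (hf : ∀ t, f.toLin (A.d (gen t)) = B.d (f.toLin (gen t)))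
    (a : A.carrier) : f.toLin (A.d a) = B.d (f.toLin a) := by
  have : gr (toPath f) = f.comp (gr (toPath (GrAlg.Hom.id B.toGrAlg))) :=
    h.hom_ext fun t => Prod.ext rfl (hf t)
  exact congrArg (fun k : A.toGrAlg.Hom (path B.toGrAlg).toGrAlg => (k.toLin a).2) this

/-- The section of the projection from the cofree algebra, or derivation, with prescribed values on
free generators. -/
def derivation (h : IsFreeOn A deg gen) (δ : T → A.carrier) (hδ : ∀ t, δ t ∈ A.gr (deg t - 1)) :
    A.Hom (path A).toGrAlg :=
  h.lift (C := (path A).toGrAlg) (fun t => (gen t, δ t)) fun t => ⟨h.1 t, hδ t⟩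

theorem derivation_gen (h : IsFreeOn A deg gen) (δ : T → A.carrier)
    (hδ : ∀ t, δ t ∈ A.gr (deg t - 1)) (t : T) :
    (h.derivation δ hδ).toLin (gen t) = (gen t, δ t) :=
  h.lift_gen _ _ t

theorem derivation_fst (h : IsFreeOn A deg gen) (δ : T → A.carrier)
    (hδ : ∀ t, δ t ∈ A.gr (deg t - 1)) (a : A.carrier) : ((h.derivation δ hδ).toLin a).1 = a := by
  have : (h.derivation δ hδ).comp (pathFst A) = GrAlg.Hom.id A :=
    h.hom_ext fun t => congrArg Prod.fst (h.derivation_gen δ hδ t)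
  exact congrArg (fun k : A.Hom A => k.toLin a) this

theorem derivation_sq_zero (h : IsFreeOn A deg gen) (δ : T → A.carrier)
    (hδ : ∀ t, δ t ∈ A.gr (deg t - 1)) (hδδ : ∀ t, ((h.derivation δ hδ).toLin (δ t)).2 = 0)
    (a : A.carrier) : ((h.derivation δ hδ).toLin ((h.derivation δ hδ).toLin a).2).2 = 0 := by
  let D := h.derivation δ hδ
  have h1 : ∀ t, (D.toLin (D.toLin (gen t)).2).2 = 0 := fun t =>
    (congrArg (fun z : A.carrier × A.carrier => (D.toLin z.2).2) (h.derivation_gen δ hδ t)).trans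
      (hδδ t)
  -- iterate `D` to a morphism to `path (path A)`, whose last component is the square of the
  -- derivation, and compare it on generators with the morphism that has zero there
  have : D.comp (gr (toPath (A := path A) ((pathFst A).comp D))) =
      D.comp (gr (toPath (A := path A) (GrAlg.Hom.id _))) :=
    h.hom_ext fun t => Prod.ext (congrArg D.toLin (h.derivation_fst δ hδ _))
      (Prod.ext (h.derivation_fst δ hδ _) (h1 t))
  exact congrArg (fun k : A.Hom (path (path A).toGrAlg).toGrAlg => (k.toLin a).2.2) this

/-- The differential graded algebra with prescribed differentials of free generators. -/
def toAlg (h : IsFreeOn A deg gen) (δ : T → A.carrier)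
    (hδ : ∀ t, δ t ∈ A.gr (deg t - 1)) (hδδ : ∀ t, ((h.derivation δ hδ).toLin (δ t)).2 = 0) :
    Alg O :=
  Alg.ofSection A (h.derivation δ hδ) (h.derivation_fst δ hδ) (h.derivation_sq_zero δ hδ hδδ)

theorem toAlg_d_gen (h : IsFreeOn A deg gen) (δ : T → A.carrier)
    (hδ : ∀ t, δ t ∈ A.gr (deg t - 1)) (hδδ : ∀ t, ((h.derivation δ hδ).toLin (δ t)).2 = 0)
    (t : T) : (h.toAlg δ hδ hδδ).d (gen t) = δ t :=
  congrArg Prod.snd (h.derivation_gen δ hδ t)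

end IsFreeOn

/-! ### Existence of free graded algebras -/

section


/-- Formal expressions of a given degree in generators `t` of degree `deg t`, built with homogeneous
operations of the operad and the operations of a module. The degree of a product is an arbitrary
`m` with a proof of the expected equation, so that no transport along equations is needed. -/
inductive FreeTerm (O : Operad R) {T : Type u} (deg : T → ℤ) : ℤ → Type u
  | gen (t : T) : FreeTerm O deg (deg t)
  | op {n : ℕ} (i : ℤ) (x : (O.obj n).gr i) (p : Fin n → ℤ) (a : ∀ k, FreeTerm O deg (p k))
      (m : ℤ) (h : m = i + ∑ k, p k) : FreeTerm O deg m
  | zero (m : ℤ) : FreeTerm O deg m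
  | add {m : ℤ} (a b : FreeTerm O deg m) : FreeTerm O deg m
  | smul {m : ℤ} (r : R) (a : FreeTerm O deg m) : FreeTerm O deg m

namespace FreeTerm

variable {T : Type u} {deg : T → ℤ}

/-- The relations between formal expressions that hold in every graded algebra. -/
inductive Rel : ∀ {m : ℤ}, FreeTerm O deg m → FreeTerm O deg m → Prop
  | refl {m : ℤ} (a : FreeTerm O deg m) : Rel a a
  | symm {m : ℤ} {a b : FreeTerm O deg m} : Rel a b → Rel b a
  | trans {m : ℤ} {a b c : FreeTerm O deg m} : Rel a b → Rel b c → Rel a c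
  | add_congr {m : ℤ} {a a' b b' : FreeTerm O deg m} :
      Rel a a' → Rel b b' → Rel (add a b) (add a' b')
  | smul_congr {m : ℤ} (r : R) {a a' : FreeTerm O deg m} : Rel a a' → Rel (smul r a) (smul r a')
  | op_congr {n : ℕ} (i : ℤ) (x : (O.obj n).gr i) (p : Fin n → ℤ)
      {a a' : ∀ k, FreeTerm O deg (p k)} (m : ℤ) (h : m = i + ∑ k, p k) :
      (∀ k, Rel (a k) (a' k)) → Rel (op i x p a m h) (op i x p a' m h)
  | add_comm {m : ℤ} (a b : FreeTerm O deg m) : Rel (add a b) (add b a)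
  | add_assoc {m : ℤ} (a b c : FreeTerm O deg m) : Rel (add (add a b) c) (add a (add b c))
  | zero_add {m : ℤ} (a : FreeTerm O deg m) : Rel (add (zero m) a) a
  | neg_add {m : ℤ} (a : FreeTerm O deg m) : Rel (add (smul (-1) a) a) (zero m)
  | smul_add {m : ℤ} (r : R) (a b : FreeTerm O deg m) :
      Rel (smul r (add a b)) (add (smul r a) (smul r b))
  | add_smul {m : ℤ} (r s : R) (a : FreeTerm O deg m) :
      Rel (smul (r + s) a) (add (smul r a) (smul s a))
  | mul_smul {m : ℤ} (r s : R) (a : FreeTerm O deg m) :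
      Rel (smul (r * s) a) (smul r (smul s a))
  | one_smul {m : ℤ} (a : FreeTerm O deg m) : Rel (smul 1 a) a
  | op_add_left {n : ℕ} (i : ℤ) (x y : (O.obj n).gr i) (p : Fin n → ℤ)
      (a : ∀ k, FreeTerm O deg (p k)) (m : ℤ) (h : m = i + ∑ k, p k) :
      Rel (op i (x + y) p a m h) (add (op i x p a m h) (op i y p a m h))
  | op_smul_left {n : ℕ} (i : ℤ) (r : R) (x : (O.obj n).gr i) (p : Fin n → ℤ)
      (a : ∀ k, FreeTerm O deg (p k)) (m : ℤ) (h : m = i + ∑ k, p k) :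
      Rel (op i (r • x) p a m h) (smul r (op i x p a m h))
  | op_add {n : ℕ} (i : ℤ) (x : (O.obj n).gr i) (p : Fin n → ℤ)
      (a : ∀ k, FreeTerm O deg (p k)) (k : Fin n) (b c : FreeTerm O deg (p k))
      (m : ℤ) (h : m = i + ∑ k, p k) :
      Rel (op i x p (Function.update a k (add b c)) m h)
        (add (op i x p (Function.update a k b) m h) (op i x p (Function.update a k c) m h))
  | op_smul {n : ℕ} (i : ℤ) (x : (O.obj n).gr i) (p : Fin n → ℤ)
      (a : ∀ k, FreeTerm O deg (p k)) (k : Fin n) (r : R) (b : FreeTerm O deg (p k))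
      (m : ℤ) (h : m = i + ∑ k, p k) :
      Rel (op i x p (Function.update a k (smul r b)) m h)
        (smul r (op i x p (Function.update a k b) m h))
  | op_one (p : Fin 1 → ℤ) (a : ∀ k, FreeTerm O deg (p k)) (h : p 0 = 0 + ∑ k, p k) :
      Rel (op 0 ⟨O.one, O.one_mem⟩ p a (p 0) h) (a 0)
  | op_act {m n : ℕ} (e : Fin m ≃ Fin n) (i : ℤ) (x : (O.obj n).gr i) (p : Fin n → ℤ)
      (a : ∀ k, FreeTerm O deg (p k)) (d : ℤ) (h : d = i + ∑ k, p (e k)) (h' : d = i + ∑ k, p k) :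
      Rel (op i ⟨O.act e x.1, O.act_mem e x.2⟩ (fun k => p (e k)) (fun k => a (e k)) d h)
        (smul ((koszulSign e (fun k => p (e k)) : ℤ) : R) (op i x p a d h'))
  | op_comp {n : ℕ} (j : Fin n → ℕ) (i : ℤ) (x : (O.obj n).gr i) (p : Fin n → ℤ)
      (y : ∀ k, (O.obj (j k)).gr (p k)) (q : ∀ k, Fin (j k) → ℤ)
      (a : ∀ k t, FreeTerm O deg (q k t)) (d : ℤ)
      (h : d = (i + ∑ k, p k) + ∑ t : Fin (∑ k, j k),
        q (finSigmaFinEquiv.symm t).1 (finSigmaFinEquiv.symm t).2)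
      (h' : d = i + ∑ k, (p k + ∑ t, q k t)) :
      Rel (op (i + ∑ k, p k)
          ⟨O.comp j x.1 (fun k => (y k).1), O.comp_mem j x.2 fun k => (y k).2⟩
          (fun t => q (finSigmaFinEquiv.symm t).1 (finSigmaFinEquiv.symm t).2)
          (fun t => a (finSigmaFinEquiv.symm t).1 (finSigmaFinEquiv.symm t).2) d h)
        (smul ((shuffleSign p (fun k => ∑ t, q k t) : ℤ) : R)
          (op i x (fun k => p k + ∑ t, q k t)
            (fun k => op (p k) (y k) (q k) (a k) _ rfl) d h'))

variable (O deg) in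
/-- Equality of formal expressions up to the relations. -/
def setoid (m : ℤ) : Setoid (FreeTerm O deg m) :=
  ⟨Rel, Rel.refl, Rel.symm, Rel.trans⟩

end FreeTerm

variable {T : Type u} {deg : T → ℤ}

variable (O deg) in
/-- The part of degree `m` of the free graded algebra. -/
def FreePart (m : ℤ) : Type u := Quotient (FreeTerm.setoid O deg m)

namespace FreePart

/-- The class of a formal expression. -/
def mk {m : ℤ} (a : FreeTerm O deg m) : FreePart O deg m := Quotient.mk _ a

theorem sound {m : ℤ} {a b : FreeTerm O deg m} (h : FreeTerm.Rel a b) : mk a = mk b :=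
  Quotient.sound h

/-- A formal expression that represents an element. -/
def out {m : ℤ} (a : FreePart O deg m) : FreeTerm O deg m := Quotient.out a

theorem mk_out {m : ℤ} (a : FreePart O deg m) : mk a.out = a := Quotient.out_eq a

theorem out_mk {m : ℤ} (a : FreeTerm O deg m) : FreeTerm.Rel (mk a).out a :=
  Quotient.exact (Quotient.out_eq (mk a))

theorem ind {m : ℤ} {P : FreePart O deg m → Prop} (h : ∀ a, P (mk a)) (x : FreePart O deg m) :
    P x := Quotient.ind h x

instance (m : ℤ) : Zero (FreePart O deg m) := ⟨mk (.zero m)⟩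
instance (m : ℤ) : Add (FreePart O deg m) := ⟨fun a b => mk (.add a.out b.out)⟩
instance (m : ℤ) : SMul R (FreePart O deg m) := ⟨fun r a => mk (.smul r a.out)⟩
instance (m : ℤ) : Neg (FreePart O deg m) := ⟨fun a => (-1 : R) • a⟩

theorem mk_add {m : ℤ} (a b : FreeTerm O deg m) : mk (.add a b) = mk a + mk b :=
  sound (.symm (.add_congr (out_mk a) (out_mk b)))

theorem mk_smul {m : ℤ} (r : R) (a : FreeTerm O deg m) : mk (.smul r a) = r • mk a :=
  sound (.symm (.smul_congr r (out_mk a)))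

instance (m : ℤ) : AddCommGroup (FreePart O deg m) :=
  { AddGroup.ofLeftAxioms
      (fun a b c => by
        induction a using ind; induction b using ind; induction c using ind
        simp only [← mk_add]
        exact sound (.add_assoc _ _ _))
      (fun a => by
        induction a using ind with | h a =>
        exact (mk_add _ _).symm.trans (sound (.zero_add a)))
      (fun a => by
        induction a using ind with | h a =>
        change (-1 : R) • mk a + mk a = mk _
        rw [← mk_smul, ← mk_add]
        exact sound (.neg_add a)) with
    add_comm := fun a b => by
      induction a using ind; induction b using ind
      simp only [← mk_add]
      exact sound (.add_comm _ _) }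

instance (m : ℤ) : Module R (FreePart O deg m) :=
  Module.ofMinimalAxioms
    (fun r a b => by
      induction a using ind; induction b using ind
      simp only [← mk_add, ← mk_smul]
      exact sound (.smul_add _ _ _))
    (fun r s a => by
      induction a using ind
      simp only [← mk_add, ← mk_smul]
      exact sound (.add_smul _ _ _))
    (fun r s a => by
      induction a using ind
      simp only [← mk_smul]
      exact sound (.mul_smul _ _ _))
    (fun a => by
      induction a using ind
      simp only [← mk_smul]
      exact sound (.one_smul _))

/-- The products of homogeneous elements. -/
def op {n : ℕ} (i : ℤ) (p : Fin n → ℤ) : (O.obj n).gr i →ₗ[R]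
    MultilinearMap R (fun k => FreePart O deg (p k)) (FreePart O deg (i + ∑ k, p k)) where
  toFun x :=
    { toFun := fun a => mk (.op i x p (fun k => (a k).out) _ rfl)
      map_update_add' := by
        intro dec a k b c
        obtain rfl := Subsingleton.elim dec (instDecidableEqFin n)
        rw [← mk_add]
        have h : ∀ b : FreePart O deg (p k), FreeTerm.Rel
            (.op i x p (fun l => (Function.update a k b l).out) _ rfl)
            (.op i x p (Function.update (fun l => (a l).out) k b.out) _ rfl) := by
          intro b
          refine .op_congr i x p _ rfl fun l => ?_
          by_cases hl : l = k
          · subst hl; simpa using .refl _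
          · simpa [hl] using .refl _
        refine sound (((h _).trans (.trans (.op_congr i x p _ rfl fun l => ?_)
          (.op_add i x p (fun l => (a l).out) k b.out c.out _ rfl))).trans
          (.symm (.add_congr (h b) (h c))))
        by_cases hl : l = k
        · subst hl
          rw [Function.update_self, Function.update_self]
          exact out_mk _
        · simpa [hl] using .refl _
      map_update_smul' := by
        intro dec a k r b
        obtain rfl := Subsingleton.elim dec (instDecidableEqFin n)
        rw [← mk_smul]
        have h : ∀ b : FreePart O deg (p k), FreeTerm.Rel
            (.op i x p (fun l => (Function.update a k b l).out) _ rfl)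
            (.op i x p (Function.update (fun l => (a l).out) k b.out) _ rfl) := by
          intro b
          refine .op_congr i x p _ rfl fun l => ?_
          by_cases hl : l = k
          · subst hl; simpa using .refl _
          · simpa [hl] using .refl _
        refine sound (((h _).trans (.trans (.op_congr i x p _ rfl fun l => ?_)
          (.op_smul i x p (fun l => (a l).out) k r b.out _ rfl))).trans
          (.symm (.smul_congr r (h b))))
        by_cases hl : l = k
        · subst hl
          rw [Function.update_self, Function.update_self]
          exact out_mk _
        · simpa [hl] using .refl _ }
  map_add' x y := MultilinearMap.ext fun a =>
    (sound (.op_add_left i x y p _ _ rfl)).trans (mk_add _ _)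
  map_smul' r x := MultilinearMap.ext fun a =>
    (sound (.op_smul_left i r x p _ _ rfl)).trans (mk_smul _ _)

theorem op_mk {n : ℕ} (i : ℤ) (p : Fin n → ℤ) (x : (O.obj n).gr i)
    (a : ∀ k, FreeTerm O deg (p k)) : op i p x (fun k => mk (a k)) = mk (.op i x p a _ rfl) :=
  sound (.op_congr i x p _ rfl fun k => out_mk (a k))

end FreePart

variable (O deg) in
/-- The graded module that underlies the free graded algebra. -/
def freeGrModule : GrModule R where
  carrier := DirectSum ℤ (FreePart O deg)
  gr i := LinearMap.range (DirectSum.lof R ℤ (FreePart O deg) i)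
  isInternal := by
    refine isInternal_of_projections _ (fun i => DirectSum.lof R ℤ (FreePart O deg) i ∘ₗ
      DirectSum.component R ℤ (FreePart O deg) i) ?_ ?_ ?_
    · rintro i _ ⟨y, rfl⟩
      rw [LinearMap.comp_apply, DirectSum.component.lof_self]
    · rintro i j h _ ⟨y, rfl⟩
      rw [LinearMap.comp_apply, DirectSum.component.of, dif_neg h, map_zero]
    · intro x
      induction x using DirectSum.induction_on with
      | zero => exact zero_mem _
      | of i y => exact Submodule.mem_iSup_of_mem i ⟨y, rfl⟩
      | add x y hx hy => exact add_mem hx hy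

/-- The inclusion of the homogeneous part of degree `m`. -/
def freeLof (m : ℤ) : FreePart O deg m →ₗ[R] (freeGrModule O deg).carrier :=
  DirectSum.lof R ℤ (FreePart O deg) m

variable (O deg) in
/-- The products of the free graded algebra. -/
def freeOp (n : ℕ) : O.obj n →ₗ[R]
    MultilinearMap R (fun _ : Fin n => (freeGrModule O deg).carrier)
      (freeGrModule O deg).carrier :=
  GrModule.lift fun i => (MultilinearMap.fromDFinsuppEquiv (fun _ : Fin n => ℤ) R
      (M := fun _ m => FreePart O deg m) (N := (freeGrModule O deg).carrier)).toLinearMap ∘ₗ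
    LinearMap.pi fun p =>
      { toFun := fun x => (freeLof (i + ∑ k, p k)).compMultilinearMap (FreePart.op i p x)
        map_add' := fun x y => by ext a; simp
        map_smul' := fun r x => by ext a; simp }

theorem freeOp_lof {n : ℕ} {i : ℤ} {x : O.obj n} (hx : x ∈ (O.obj n).gr i) (p : Fin n → ℤ)
    (a : ∀ k, FreePart O deg (p k)) :
    freeOp O deg n x (fun k => freeLof (p k) (a k)) =
      freeLof (i + ∑ k, p k) (FreePart.op i p ⟨x, hx⟩ a) := by
  rw [freeOp, GrModule.lift_apply _ hx]
  exact MultilinearMap.fromDFinsuppEquiv_single (κ := fun _ : Fin n => ℤ) (R := R)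
    (M := fun _ m => FreePart O deg m) (N := (freeGrModule O deg).carrier) _ p a

/-- The products of classes of formal expressions, in every presentation of the degree. -/
theorem freeOp_mk {n : ℕ} {i : ℤ} {x : O.obj n} (hx : x ∈ (O.obj n).gr i) (p : Fin n → ℤ)
    (a : ∀ k, FreeTerm O deg (p k)) (m : ℤ) (h : m = i + ∑ k, p k) :
    freeOp O deg n x (fun k => freeLof (p k) (.mk (a k))) =
      freeLof m (.mk (.op i ⟨x, hx⟩ p a m h)) := by
  subst h
  rw [freeOp_lof hx, FreePart.op_mk]

theorem exists_freeLof_mk {m : ℤ} {b : (freeGrModule O deg).carrier}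
    (h : b ∈ (freeGrModule O deg).gr m) : ∃ t : FreeTerm O deg m, b = freeLof m (.mk t) := by
  obtain ⟨y, rfl⟩ := h
  exact ⟨y.out, by rw [FreePart.mk_out]; rfl⟩

theorem freeLof_mem {m : ℤ} (x : FreePart O deg m) : freeLof m x ∈ (freeGrModule O deg).gr m :=
  ⟨x, rfl⟩

variable (O deg) in
/-- The free graded algebra on generators `t` of degree `deg t`. -/
def freeGrAlg : GrAlg O where
  toGrModule := freeGrModule O deg
  op := freeOp O deg
  op_mem {n i x p a} hx ha := by
    choose t ht using fun k => exists_freeLof_mk (ha k)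
    obtain rfl : a = _ := funext ht
    rw [freeOp_mk hx p t _ rfl]
    exact freeLof_mem _
  op_one a := by
    have key : ∀ b : (freeGrModule O deg).carrier, freeOp O deg 1 O.one (fun _ => b) = b := by
      intro b
      refine GrModule.induction (M := freeGrModule O deg)
        (P := fun b => freeOp O deg 1 O.one (fun _ => b) = b) b (fun i y hy => ?_)
        fun y z hy hz => ?_
      · obtain ⟨t, rfl⟩ := exists_freeLof_mk hy
        rw [freeOp_mk O.one_mem (fun _ => i) (fun _ => t) i (by simp)]
        exact congrArg _ (FreePart.sound (.op_one (fun _ => i) (fun _ => t) (by simp)))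
      · have hu : ∀ w : (freeGrModule O deg).carrier,
            (fun _ : Fin 1 => w) = Function.update (fun _ => 0) 0 w := fun w => by
          funext l
          rw [Subsingleton.elim l 0, Function.update_self]
        rw [hu, MultilinearMap.map_update_add, ← hu, ← hu, hy, hz]
    have ha : a = fun _ => a 0 := funext fun l => by rw [Subsingleton.elim l 0]
    rw [ha]
    exact key _
  op_act {m n} e x p a ha := by
    choose t ht using fun k => exists_freeLof_mk (ha k)
    obtain rfl : a = _ := funext ht
    refine GrModule.induction (M := (O.obj n).toGrModule) (P := fun x =>
      freeOp O deg m (O.act e x) (fun i => freeLof (p (e i)) (.mk (t (e i)))) =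
        koszulSign e (fun i => p (e i)) • freeOp O deg n x (fun k => freeLof (p k) (.mk (t k))))
      x (fun i y hy => ?_) fun y z hy hz => ?_
    · have hd : i + ∑ k, p k = i + ∑ k, p (e k) := by rw [Equiv.sum_comp e]
      rw [freeOp_mk (O.act_mem e hy) (fun k => p (e k)) (fun k => t (e k)) _ hd,
        freeOp_mk hy p t _ rfl, Units.smul_def, ← Int.cast_smul_eq_zsmul R, ← map_smul,
        ← FreePart.mk_smul]
      exact congrArg _ (FreePart.sound (.op_act e i ⟨y, hy⟩ p t _ hd rfl))
    · simp only [map_add, add_apply, smul_add, hy, hz]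
  op_comp {n} j x p y q a hy ha := by
    choose t ht using fun k l => exists_freeLof_mk (ha k l)
    obtain rfl : a = _ := funext fun k => funext (ht k)
    refine GrModule.induction (M := (O.obj n).toGrModule) (P := fun x =>
      freeOp O deg (∑ k, j k) (O.comp j x y) (fun s => freeLof
        (q (finSigmaFinEquiv.symm s).1 (finSigmaFinEquiv.symm s).2)
        (.mk (t (finSigmaFinEquiv.symm s).1 (finSigmaFinEquiv.symm s).2))) =
        shuffleSign p (fun k => ∑ l, q k l) • freeOp O deg n x
          (fun k => freeOp O deg (j k) (y k) (fun l => freeLof (q k l) (.mk (t k l)))))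
      x (fun i z hz => ?_) fun y z hy hz => ?_
    · have hd : (i + ∑ k, p k) + ∑ s : Fin (∑ k, j k),
          q (finSigmaFinEquiv.symm s).1 (finSigmaFinEquiv.symm s).2 =
          i + ∑ k, (p k + ∑ l, q k l) := by
        rw [Equiv.sum_comp finSigmaFinEquiv.symm (fun s : (i : Fin n) × Fin (j i) => q s.1 s.2),
          Fintype.sum_sigma, Finset.sum_add_distrib, add_assoc]
      rw [freeOp_mk (O.comp_mem j hz hy) (fun s => q (finSigmaFinEquiv.symm s).1
        (finSigmaFinEquiv.symm s).2) (fun s => t (finSigmaFinEquiv.symm s).1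
        (finSigmaFinEquiv.symm s).2) _ rfl]
      simp only [fun k => freeOp_mk (hy k) (q k) (t k) _ rfl]
      rw [freeOp_mk hz (fun k => p k + ∑ l, q k l)
        (fun k => .op (p k) ⟨y k, hy k⟩ (q k) (t k) _ rfl) _ hd,
        Units.smul_def, ← Int.cast_smul_eq_zsmul R, ← map_smul, ← FreePart.mk_smul]
      exact congrArg _ (FreePart.sound (.op_comp j i ⟨z, hz⟩ p (fun k => ⟨y k, hy k⟩) q t _ rfl hd))
    · simp only [map_add, add_apply, smul_add, hy, hz]

variable (O deg) in
/-- The generators of the free graded algebra. -/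
def freeGen (t : T) : (freeGrAlg O deg).carrier := freeLof (deg t) (.mk (.gen t))

/-- The free graded algebra is generated by its generators. -/
theorem mem_adjoin_freeGen (b : (freeGrAlg O deg).carrier) :
    b ∈ (freeGrAlg O deg).adjoin (Set.range (freeGen O deg)) := by
  refine GrModule.induction (M := freeGrModule O deg)
    (P := fun b => b ∈ (freeGrAlg O deg).adjoin (Set.range (freeGen O deg))) b (fun i y hy => ?_)
    fun y z hy hz => add_mem hy hz
  obtain ⟨t, rfl⟩ := exists_freeLof_mk hy
  clear hy
  induction t with
  | gen t => exact GrAlg.subset_adjoin _ ⟨t, rfl⟩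
  | op i x p a m h ih =>
    rw [← freeOp_mk x.2 p a m h]
    exact GrAlg.op_mem_adjoin (A := freeGrAlg O deg) x.1 ih
  | zero m =>
    have : freeLof m (FreePart.mk (.zero m)) = (0 : (freeGrModule O deg).carrier) :=
      map_zero (freeLof (O := O) (deg := deg) m)
    rw [this]
    exact zero_mem _
  | add a b iha ihb =>
    rw [FreePart.mk_add, map_add]
    exact add_mem iha ihb
  | smul r a ih =>
    rw [FreePart.mk_smul, map_smul]
    exact Submodule.smul_mem _ r ih

namespace FreeTerm

variable (C : GrAlg O) (v : T → C.carrier)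

/-- The value of a formal expression in a graded algebra. -/
def eval : ∀ {m : ℤ}, FreeTerm O deg m → C.carrier
  | _, gen t => v t
  | _, op _ x _ a _ _ => C.op _ x.1 fun k => eval (a k)
  | _, zero _ => 0
  | _, add a b => eval a + eval b
  | _, smul r a => r • eval a

theorem eval_mem (hv : ∀ t, v t ∈ C.gr (deg t)) {m : ℤ} (a : FreeTerm O deg m) :
    eval C v a ∈ C.gr m := by
  induction a with
  | gen t => exact hv t
  | op i x p a m h ih =>
    subst h
    exact C.op_mem x.2 ih
  | zero m => exact zero_mem _
  | add a b iha ihb => exact add_mem iha ihb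
  | smul r a ih => exact Submodule.smul_mem _ r ih

theorem eval_eq (hv : ∀ t, v t ∈ C.gr (deg t)) {m : ℤ} {a b : FreeTerm O deg m} (h : Rel a b) :
    eval C v a = eval C v b := by
  have hu : ∀ {n : ℕ} {p : Fin n → ℤ} (a : ∀ k, FreeTerm O deg (p k)) (k : Fin n)
      (b : FreeTerm O deg (p k)), (fun l => eval C v (Function.update a k b l)) =
        Function.update (fun l => eval C v (a l)) k (eval C v b) := fun a k b => by
    funext l
    exact Function.apply_update (fun _ => eval C v) a k b l
  induction h with
  | refl a => rfl
  | symm _ ih => exact ih.symm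
  | trans _ _ ih ih' => exact ih.trans ih'
  | add_congr _ _ ih ih' => exact congrArg₂ _ ih ih'
  | smul_congr r _ ih => exact congrArg (r • ·) ih
  | op_congr i x p m h _ ih => exact congrArg (C.op _ x.1) (funext ih)
  | add_comm a b => exact _root_.add_comm _ _
  | add_assoc a b c => exact _root_.add_assoc _ _ _
  | zero_add a => exact _root_.zero_add _
  | neg_add a => simp [eval]
  | smul_add r a b => exact _root_.smul_add _ _ _
  | add_smul r s a => exact _root_.add_smul _ _ _
  | mul_smul r s a => exact SemigroupAction.mul_smul _ _ _
  | one_smul a => exact _root_.one_smul _ _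
  | op_add_left i x y p a m h => simp [eval]
  | op_smul_left i r x p a m h => simp [eval]
  | op_add i x p a k b c m h => simp only [eval, hu, MultilinearMap.map_update_add]
  | op_smul i x p a k r b m h => simp only [eval, hu, MultilinearMap.map_update_smul]
  | op_one p a h => exact C.op_one _
  | op_act e i x p a d h h' =>
    simp only [eval]
    rw [C.op_act e x.1 (a := fun k => eval C v (a k)) fun k => eval_mem C v hv (a k),
      Int.cast_smul_eq_zsmul, Units.smul_def]
  | op_comp j i x p y q a d h h' =>
    simp only [eval]
    rw [C.op_comp j x.1 (a := fun k t => eval C v (a k t)) (fun k => (y k).2)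
      fun k t => eval_mem C v hv (a k t), Int.cast_smul_eq_zsmul, Units.smul_def]

end FreeTerm

/-- The evaluation of the elements of degree `m` of the free graded algebra. -/
def FreePart.eval (C : GrAlg O) (v : T → C.carrier) (hv : ∀ t, v t ∈ C.gr (deg t)) (m : ℤ) :
    FreePart O deg m →ₗ[R] C.carrier where
  toFun := Quotient.lift (FreeTerm.eval C v) fun _ _ h => FreeTerm.eval_eq C v hv h
  map_add' a b := by
    induction a using FreePart.ind; induction b using FreePart.ind
    rw [← mk_add]
    rfl
  map_smul' r a := by
    induction a using FreePart.ind
    rw [← mk_smul]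
    rfl

/-- The morphism out of the free graded algebra with prescribed values on the generators. -/
def freeLift (C : GrAlg O) (v : T → C.carrier) (hv : ∀ t, v t ∈ C.gr (deg t)) :
    (freeGrAlg O deg).Hom C := by
  let F : (freeGrModule O deg).carrier →ₗ[R] C.carrier :=
    DirectSum.toModule R ℤ C.carrier (FreePart.eval C v hv)
  have hF : ∀ (m : ℤ) (t : FreeTerm O deg m), F (freeLof m (.mk t)) = FreeTerm.eval C v t :=
    fun m t => DirectSum.toModule_lof R m _
  refine { toLin := F, map_mem := fun {i x} hx => ?_, map_op := fun n x => ?_ }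
  · obtain ⟨t, rfl⟩ := exists_freeLof_mk hx
    exact (hF i t).symm ▸ FreeTerm.eval_mem C v hv t
  · suffices h : F.compMultilinearMap (freeOp O deg n x) =
        (C.op n x).compLinearMap fun _ => F from fun a => congrArg (fun G => G a) h
    refine GrModule.induction (M := (O.obj n).toGrModule) (P := fun x =>
      F.compMultilinearMap (freeOp O deg n x) = (C.op n x).compLinearMap fun _ => F) x
      (fun i y hy => ?_) fun y z hy hz => ?_
    · refine multilinear_ext_of_homogeneous (M := fun _ => freeGrModule O deg) fun p a ha => ?_
      choose t ht using fun k => exists_freeLof_mk (ha k)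
      obtain rfl : a = _ := funext ht
      rw [LinearMap.compMultilinearMap_apply, freeOp_mk hy p t _ rfl, hF,
        MultilinearMap.compLinearMap_apply]
      simp only [hF]
      rfl
    · have h1 : F.compMultilinearMap (freeOp O deg n (y + z)) =
          F.compMultilinearMap (freeOp O deg n y) + F.compMultilinearMap (freeOp O deg n z) := by
        rw [map_add]
        exact MultilinearMap.ext fun a => map_add F _ _
      rw [h1, hy, hz, map_add]
      rfl

theorem freeLift_gen (C : GrAlg O) (v : T → C.carrier) (hv : ∀ t, v t ∈ C.gr (deg t)) (t : T) :
    (freeLift C v hv).toLin (freeGen O deg t) = v t :=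
  DirectSum.toModule_lof R (φ := FreePart.eval C v hv) (deg t) (.mk (.gen t))

theorem freeGrAlg_isFreeOn : IsFreeOn (freeGrAlg O deg) deg (freeGen O deg) := by
  refine ⟨fun t => freeLof_mem _, fun C v hv => ⟨freeLift C v hv, freeLift_gen C v hv,
    fun f hf => GrAlg.Hom.ext (LinearMap.ext fun b =>
      GrAlg.Hom.eqOn_adjoin ?_ (mem_adjoin_freeGen b))⟩⟩
  rintro _ ⟨t, rfl⟩
  exact (hf t).trans (freeLift_gen C v hv t).symm

end

/-! ### Bases adapted to a filtration, and recursion along the filtration -/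

/-- An exhaustive filtration with free quotients has an adapted basis: the basis vectors of rank at
most `k` span the `k`-th stage. -/
theorem exists_basis_of_filtration {V : Type u} [AddCommGroup V] [Module R V]
    (F : ℕ → Submodule R V) (hmono : Monotone F) (hex : ∀ x, ∃ k, x ∈ F k)
    (h0 : Module.Free R (F 0))
    (hs : ∀ k, Module.Free R (F (k + 1) ⧸ (F k).submoduleOf (F (k + 1)))) :
    ∃ (B : Type u) (b : Module.Basis B R V) (ρ : B → ℕ),
      ∀ k, F k = Submodule.span R (b '' {t | ρ t ≤ k}) := by
  -- the stage below `F k`, which is `⊥` for `k = 0`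
  let G : ℕ → Submodule R V := fun k => Nat.casesOn k ⊥ F
  have hGF : ∀ j k, j < k → F j ≤ G k := fun j k hjk => by
    obtain ⟨k, rfl⟩ : ∃ k', k = k' + 1 := ⟨k - 1, by omega⟩
    exact hmono (Nat.lt_succ_iff.1 hjk)
  have hfree : ∀ k, Module.Free R (F k ⧸ (G k).submoduleOf (F k)) := by
    rintro (_ | k)
    · refine Module.Free.of_equiv (Submodule.quotEquivOfEqBot _ ?_).symm
      change Submodule.comap _ ⊥ = ⊥
      rw [Submodule.comap_bot, Submodule.ker_subtype]
    · exact hs k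
  let Q : ℕ → Type u := fun k =>
    Module.Free.ChooseBasisIndex R (F k ⧸ (G k).submoduleOf (F k))
  let β : ∀ k, Module.Basis (Q k) R (F k ⧸ (G k).submoduleOf (F k)) := fun k =>
    Module.Free.chooseBasis R _
  choose e he using fun (k : ℕ) (t : Q k) => Submodule.Quotient.mk_surjective _ (β k t)
  let v : (Σ k, Q k) → V := fun t => e t.1 t.2
  have hspan : ∀ k, F k = Submodule.span R (v '' {t | t.1 ≤ k}) := by
    intro k
    apply le_antisymm
    · have step : ∀ k, F k ≤ G k ⊔ Submodule.span R (v '' {t | t.1 ≤ k}) := by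
        intro k x hx
        have h1 : Submodule.map ((G k).submoduleOf (F k)).mkQ
            (Submodule.span R (Set.range (e k))) = ⊤ := by
          rw [Submodule.map_span, ← Set.range_comp, ← (β k).span_eq]
          exact congrArg _ (congrArg Set.range (funext fun t => he k t))
        obtain ⟨y, hy, hxy⟩ : ((G k).submoduleOf (F k)).mkQ ⟨x, hx⟩ ∈
            Submodule.map ((G k).submoduleOf (F k)).mkQ (Submodule.span R (Set.range (e k))) := by
          rw [h1]; trivial
        have h2 : x - (y : V) ∈ G k := (Submodule.Quotient.eq ((G k).submoduleOf (F k))).1 hxy.symm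
        have h3 : (y : V) ∈ Submodule.span R (v '' {t | t.1 ≤ k}) := by
          have := Submodule.mem_map_of_mem (f := (F k).subtype) hy
          rw [Submodule.map_span, ← Set.range_comp] at this
          refine Submodule.span_mono ?_ this
          rintro _ ⟨t, rfl⟩
          exact ⟨⟨k, t⟩, le_refl k, rfl⟩
        rw [← sub_add_cancel x (y : V)]
        exact Submodule.add_mem_sup h2 h3
      induction k with
      | zero =>
        refine (step 0).trans (sup_le bot_le le_rfl)
      | succ k ih =>
        refine (step (k + 1)).trans (sup_le (ih.trans (Submodule.span_mono ?_)) le_rfl)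
        exact Set.image_mono fun t ht => Nat.le_succ_of_le ht
    · rw [Submodule.span_le]
      rintro _ ⟨t, ht, rfl⟩
      exact hmono ht (e t.1 t.2).2
  -- linear independence, by induction on a bound for the ranks that occur: modulo `G k`, only the
  -- vectors of rank `k` survive, and they are independent there
  have hind : ∀ k (s : Finset (Σ k, Q k)) (g : (Σ k, Q k) → R), (∀ t ∈ s, t.1 < k) →
      ∑ t ∈ s, g t • v t = 0 → ∀ t ∈ s, g t = 0 := by
    intro k
    induction k with
    | zero => intro s g hs _ t ht; exact absurd (hs t ht) (by omega)
    | succ k ih =>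
      intro s g hs hg
      obtain ⟨W, _, _, π, hπ⟩ : ∃ (W : Type u) (_ : AddCommGroup W) (_ : Module R W)
          (π : V →ₗ[R] W), ∀ x, π x = 0 ↔ x ∈ G k :=
        ⟨V ⧸ G k, Submodule.Quotient.addCommGroup (G k), Submodule.Quotient.module (G k),
          (G k).mkQ, fun x => Submodule.Quotient.mk_eq_zero _⟩
      have hq : LinearIndependent R (fun t : Q k => π (v ⟨k, t⟩)) := by
        let M : (F k ⧸ (G k).submoduleOf (F k)) →ₗ[R] W :=
          Submodule.liftQ ((G k).submoduleOf (F k)) (π ∘ₗ (F k).subtype) fun x hx => (hπ x).2 hx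
        have hM : LinearMap.ker M = ⊥ := LinearMap.ker_eq_bot'.2 fun m hm => by
          obtain ⟨y, rfl⟩ := Submodule.Quotient.mk_surjective _ m
          exact (Submodule.Quotient.mk_eq_zero _).2 ((hπ y).1 hm)
        have h1 := (β k).linearIndependent.map' M hM
        convert! h1 using 1
        funext t
        change _ = M (β k t)
        rw [← he k t]
        rfl
      have htop : ∀ t : Q k, (⟨k, t⟩ : Σ k, Q k) ∈ s → g ⟨k, t⟩ = 0 := by
        intro t ht
        refine linearIndependent_iff'.1 hq (s.preimage (Sigma.mk k) sigma_mk_injective.injOn)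
          (fun t => g ⟨k, t⟩) ?_ t (by simpa using ht)
        have h2 := congrArg π hg
        rw [map_sum, map_zero] at h2
        rw [← h2, ← Finset.sum_preimage (Sigma.mk k) s sigma_mk_injective.injOn
          (fun t => π (g t • v t))]
        · exact Finset.sum_congr rfl fun t _ => (map_smul _ _ _).symm
        · rintro ⟨j, t'⟩ ht' hr
          have hj : j < k := lt_of_le_of_ne (Nat.lt_succ_iff.1 (hs _ ht'))
            (by rintro rfl; exact hr ⟨t', rfl⟩)
          rw [hπ]
          exact Submodule.smul_mem _ _ (hGF j k hj (e j t').2)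
      have hlow : ∀ t ∈ s.filter (fun t => t.1 < k), g t = 0 := by
        refine ih _ g (fun t ht => (Finset.mem_filter.1 ht).2) ?_
        rw [← hg, Finset.sum_filter]
        refine Finset.sum_congr rfl fun t ht => ?_
        split_ifs with h
        · rfl
        · obtain ⟨j, t⟩ := t
          obtain rfl : j = k := le_antisymm (Nat.lt_succ_iff.1 (hs _ ht)) (not_lt.1 h)
          rw [htop t ht, zero_smul]
      rintro ⟨j, t⟩ ht
      by_cases h : j < k
      · exact hlow _ (Finset.mem_filter.2 ⟨ht, h⟩)
      · obtain rfl : j = k := le_antisymm (Nat.lt_succ_iff.1 (hs _ ht)) (not_lt.1 h)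
        exact htop t ht
  have hli : LinearIndependent R v := linearIndependent_iff'.2 fun s g hg t ht =>
    hind (s.sup (fun t => t.1) + 1) s g
      (fun t ht => Nat.lt_succ_iff.2 (Finset.le_sup (f := fun t : Σ k, Q k => t.1) ht)) hg t ht
  have htop : ⊤ ≤ Submodule.span R (Set.range v) := by
    intro x _
    obtain ⟨k, hk⟩ := hex x
    rw [hspan k] at hk
    exact Submodule.span_mono (Set.image_subset_range _ _) hk
  refine ⟨Σ k, Q k, Module.Basis.mk hli htop, fun t => t.1, fun k => ?_⟩
  rw [Module.Basis.coe_mk]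
  exact hspan k

/-- Functions can be constructed by recursion along a rank, if the condition `Good u t` depends only
on the values of `u` up to the rank of `t`, and can always be achieved by choosing `u t`. -/
theorem exists_of_rank {T : Type*} (ρ : T → ℕ) {X : T → Type*} [∀ t, Inhabited (X t)]
    (Good : (∀ t, X t) → T → Prop)
    (hloc : ∀ u u' t, (∀ s, ρ s ≤ ρ t → u s = u' s) → Good u t → Good u' t)
    (hstep : ∀ u t, (∀ s, ρ s < ρ t → Good u s) →
      ∃ a, ∀ u', (∀ s, ρ s < ρ t → u' s = u s) → u' t = a → Good u' t) :
    ∃ u, ∀ t, Good u t := by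
  classical
  let F : ∀ t, (∀ s, ρ s < ρ t → X s) → X t := fun t r =>
    if h : ∀ s, ρ s < ρ t → Good (fun s => if h : ρ s < ρ t then r s h else default) s then
      (hstep _ t h).choose else default
  let u : ∀ t, X t := (measure ρ).wf.fix F
  refine ⟨u, fun t => ?_⟩
  induction hk : ρ t using Nat.strong_induction_on generalizing t with
  | _ k ih =>
    subst hk
    let w : ∀ s, X s := fun s => if ρ s < ρ t then u s else default
    have hw : ∀ s, ρ s < ρ t → u s = w s := fun s hs => (if_pos hs).symm
    have hgood : ∀ s, ρ s < ρ t → Good w s := fun s hs =>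
      hloc u w s (fun s' hs' => hw s' (lt_of_le_of_lt hs' hs)) (ih _ hs s rfl)
    refine (hstep w t hgood).choose_spec u hw ?_
    have h1 : u t = F t fun s _ => u s := (measure ρ).wf.fix_eq F t
    rw [h1]
    exact dif_pos hgood

/-! ### Lifting against surjective quasi-isomorphisms -/

/-- A surjective quasi-isomorphism allows to solve the equations `d x = z`, `p x = g`. -/
theorem exists_of_surjective_of_quasiIso {X Y : Alg O} {p : X ⟶ Y} (hs : IsSurjective p)
    (hq : IsQuasiIso p) {i : ℤ} {z : X.carrier} {g : Y.carrier} (hz : z ∈ X.gr (i - 1))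
    (hg : g ∈ Y.gr i) (hdz : X.d z = 0) (hpz : lin p z = Y.d g) :
    ∃ x ∈ X.gr i, X.d x = z ∧ lin p x = g := by
  have hpd : ∀ x, lin p (X.d x) = Y.d (lin p x) := Alg.Hom.map_d p
  obtain ⟨x, hx, hpx⟩ : ∃ x, X.d x = z ∧ lin p x = g := by
    -- solve `d x₁ = z`, and correct `x₁` by a cycle and a boundary to obtain `p x = g`
    obtain ⟨x₁, hx₁⟩ : ∃ x, X.d x = z := by
      have h1 : homologyMap p (Submodule.Quotient.mk ⟨z, hdz⟩) = 0 :=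
        (Submodule.Quotient.mk_eq_zero _).2 ⟨g, hpz.symm⟩
      have h2 := hq.1 (h1.trans (map_zero _).symm)
      exact (Submodule.Quotient.mk_eq_zero _).1 h2
    have hc : Y.d (lin p x₁ - g) = 0 := by rw [map_sub, ← hpd, hx₁, hpz, sub_self]
    obtain ⟨q, hq₂⟩ := hq.2 (Submodule.Quotient.mk ⟨lin p x₁ - g, hc⟩)
    obtain ⟨⟨x₂, hx₂⟩, rfl⟩ := Submodule.Quotient.mk_surjective _ q
    obtain ⟨g₂, hg₂⟩ := (Submodule.Quotient.eq _).1 hq₂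
    replace hg₂ : Y.d g₂ = lin p x₂ - (lin p x₁ - g) := hg₂
    replace hx₂ : X.d x₂ = 0 := hx₂
    obtain ⟨x₃, hx₃⟩ := hs g₂
    refine ⟨x₁ - x₂ + X.d x₃, ?_, ?_⟩
    · rw [map_add, map_sub, hx₁, hx₂, X.d_d, sub_zero, add_zero]
    · rw [map_add, map_sub, hpd, hx₃, hg₂]
      abel
  -- the component of degree `i` of a solution is a solution
  refine ⟨X.proj i x, GrModule.proj_mem i x, ?_, ?_⟩
  · rw [GrModule.map_proj (M := X.toGrModule) (N := X.toGrModule) X.d (-1)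
      (fun i x hx => X.d_mem hx), hx]
    exact GrModule.proj_self hz
  · rw [GrModule.map_proj (M := X.toGrModule) (N := Y.toGrModule) (lin p) 0
      (fun i x hx => by rw [add_zero]; exact (gr p).map_mem hx), hpx, add_zero]
    exact GrModule.proj_self hg

/-! ### Free generators of cell extensions -/

/-- The graded algebra `B` is obtained from `A` by adjoining free generators `gen t`, of degree
`deg t`. -/
def IsFreeOver {A B : GrAlg O} (j : A.Hom B) {T : Type u} (deg : T → ℤ) (gen : T → B.carrier) :
    Prop :=
  (∀ t, gen t ∈ B.gr (deg t)) ∧ ∀ (C : GrAlg O) (f : A.Hom C) (v : T → C.carrier),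
    (∀ t, v t ∈ C.gr (deg t)) →
      ∃! h : B.Hom C, (∀ a, h.toLin (j.toLin a) = f.toLin a) ∧ ∀ t, h.toLin (gen t) = v t

/-- Generators over the ground algebra are generators in the absolute sense. -/
theorem IsFreeOver.isFreeOn {A : Alg O} {T : Type u} {deg : T → ℤ} {gen : T → A.carrier}
    (h : IsFreeOver (gr (unitHom A)) deg gen) : IsFreeOn A.toGrAlg deg gen := by
  refine ⟨h.1, fun C v hv => ?_⟩
  obtain ⟨k, hk, huniq⟩ := h.2 C ((gr (unitHom (path C))).comp (pathFst C)) v hv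
  exact ⟨k, hk.2, fun k' hk' => huniq k'
    ⟨fun a => ground_hom_unique ((gr (unitHom A)).comp k') _ a, hk'⟩⟩

/-- An extension by free generators, such that the differential of each generator is expressed by
generators of smaller rank, has the left lifting property with respect to surjective
quasi-isomorphisms. -/
theorem IsFreeOver.exists_lift {A B : Alg O} {j : A ⟶ B} {T : Type u} {deg : T → ℤ}
    {gen : T → B.carrier} (h : IsFreeOver (gr j) deg gen) (ρ : T → ℕ)
    (hd : ∀ t, B.d (gen t) ∈ B.adjoin (Set.range (lin j) ∪ gen '' {s | ρ s < ρ t}))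
    {X Y : Alg O} {p : X ⟶ Y} (hs : IsSurjective p) (hq : IsQuasiIso p) (f : A ⟶ X) (g : B ⟶ Y)
    (hfg : f ≫ p = j ≫ g) : ∃ l : B ⟶ X, j ≫ l = f ∧ l ≫ p = g := by
  have hfg' : ∀ a, lin p (lin f a) = lin g (lin j a) := fun a =>
    congrArg (fun k : A ⟶ Y => lin k a) hfg
  -- `H u` is the extension of `f` with the values `u` on the generators
  choose H hH using fun u : ∀ t, X.gr (deg t) =>
    (h.2 X.toGrAlg (gr f) (fun t => u t) fun t => (u t).2).exists
  have hext : ∀ (C : GrAlg O) (k k' : B.toGrAlg.Hom C),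
      (∀ a, k.toLin (lin j a) = k'.toLin (lin j a)) →
      (∀ t, k.toLin (gen t) = k'.toLin (gen t)) → ∀ b, k.toLin b = k'.toLin b := by
    intro C k k' h1 h2 b
    have := (h.2 C ((gr j).comp k') (fun t => k'.toLin (gen t))
      fun t => k'.map_mem (h.1 t)).unique ⟨h1, h2⟩ ⟨fun _ => rfl, fun _ => rfl⟩
    rw [this]
  have hjd : ∀ u a, (H u).toLin (B.d (lin j a)) = X.d ((H u).toLin (lin j a)) := by
    intro u a
    rw [← Alg.Hom.map_d j, (hH u).1, (hH u).1]
    exact Alg.Hom.map_d f a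
  have hagree : ∀ u u' t, (∀ s, ρ s < ρ t → u s = u' s) →
      (H u).toLin (B.d (gen t)) = (H u').toLin (B.d (gen t)) := by
    intro u u' t hu
    refine GrAlg.Hom.eqOn_adjoin ?_ (hd t)
    rintro _ (⟨a, rfl⟩ | ⟨s, hs, rfl⟩)
    · rw [(hH u).1, (hH u').1]
    · rw [(hH u).2, (hH u').2, hu s hs]
  obtain ⟨u, hu⟩ := exists_of_rank ρ (X := fun t => X.gr (deg t))
    (fun u t => lin p (u t) = lin g (gen t) ∧ (H u).toLin (B.d (gen t)) = X.d (u t))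
    (fun u u' t huu' hu => by
      rw [← huu' t le_rfl, ← hagree u u' t fun s hs => huu' s hs.le]
      exact hu)
    (fun u t hu => by
      have hz : (H u).toLin (B.d (gen t)) ∈ X.gr (deg t - 1) := (H u).map_mem (B.d_mem (h.1 t))
      have hdz : X.d ((H u).toLin (B.d (gen t))) = 0 := by
        rw [← map_d_of_mem_adjoin (H u) ?_ (hd t), B.d_d, map_zero]
        rintro _ (⟨a, rfl⟩ | ⟨s, hs, rfl⟩)
        · exact hjd u a
        · rw [(hH u).2]; exact (hu s hs).2
      have hpz : lin p ((H u).toLin (B.d (gen t))) = Y.d (lin g (gen t)) := by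
        rw [← Alg.Hom.map_d g]
        refine GrAlg.Hom.eqOn_adjoin (f := (H u).comp (gr p)) (g := gr g) ?_ (hd t)
        rintro _ (⟨a, rfl⟩ | ⟨s, hs, rfl⟩)
        · exact (congrArg (lin p) ((hH u).1 a)).trans (hfg' a)
        · exact (congrArg (lin p) ((hH u).2 s)).trans (hu s hs).1
      obtain ⟨x, hx, hdx, hpx⟩ := exists_of_surjective_of_quasiIso hs hq hz
        ((gr g).map_mem (h.1 t)) hdz hpz
      refine ⟨⟨x, hx⟩, fun u' hu' hx' => ?_⟩
      rw [hagree u' u t hu', hx']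
      exact ⟨hpx, hdx.symm⟩)
  have hcomm : ∀ b, (H u).toLin (B.d b) = X.d ((H u).toLin b) := fun b =>
    congrArg Prod.snd (hext _ (gr (toPath (H u)))
      ((H u).comp (gr (toPath (GrAlg.Hom.id X.toGrAlg)))) (fun a => Prod.ext rfl (hjd u a))
      (fun t => Prod.ext rfl ((hu t).2.trans (congrArg X.d ((hH u).2 t).symm))) b)
  refine ⟨(H u).toAlgHom hcomm, Alg.Hom.ext (LinearMap.ext (hH u).1),
    Alg.Hom.ext (LinearMap.ext fun b => ?_)⟩
  refine hext _ ((H u).comp (gr p)) (gr g) (fun a => ?_) (fun t => ?_) b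
  · exact (congrArg (lin p) ((hH u).1 a)).trans (hfg' a)
  · exact (congrArg (lin p) ((hH u).2 t)).trans (hu t).1

/-- Bases of the homogeneous parts of the generating module of a cell extension that are adapted to
its filtration. -/
structure CellBasis {A B : Alg O} {j : A ⟶ B} (c : CellStructure j) where
  idx : ℤ → Type u
  basis : ∀ i, Module.Basis (idx i) R (c.V i)
  rank : ∀ i, idx i → ℕ
  fil_eq : ∀ k i, c.fil k i = Submodule.span R (basis i '' {t | rank i t ≤ k})

theorem CellStructure.nonempty_cellBasis {A B : Alg O} {j : A ⟶ B} (c : CellStructure j) :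
    Nonempty (CellBasis c) := by
  choose idx b ρ h using fun i => exists_basis_of_filtration (fun k => c.fil k i) (c.fil_mono i)
    (c.fil_exhaust i) (c.free_zero i) (fun k => c.free_succ k i)
  exact ⟨⟨idx, b, ρ, fun k i => h i k⟩⟩

namespace CellBasis

variable {A B : Alg O} {j : A ⟶ B} {c : CellStructure j} (β : CellBasis c)

/-- The generators of a cell extension that belong to adapted bases. -/
def gen (t : Σ i, β.idx i) : B.carrier := c.ι t.1 (β.basis t.1 t.2)

theorem isFreeOver : IsFreeOver (gr j) (fun t : Σ i, β.idx i => t.1) β.gen := by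
  refine ⟨fun t => c.isFree.1 _ _, fun C f v hv => ?_⟩
  obtain ⟨h, hh, huniq⟩ := c.isFree.2 C f
    (fun i => (β.basis i).constr R fun t => v ⟨i, t⟩) (fun i x => by
      refine (?_ : LinearMap.range ((β.basis i).constr R fun t => v ⟨i, t⟩) ≤ C.gr i) ⟨x, rfl⟩
      rw [Module.Basis.constr_range, Submodule.span_le]
      rintro _ ⟨t, rfl⟩
      exact hv ⟨i, t⟩)
  refine ⟨h, ⟨hh.1, fun t => ?_⟩, fun h' hh' => huniq h' ⟨hh'.1, fun i x => ?_⟩⟩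
  · exact (hh.2 _ _).trans ((β.basis t.1).constr_basis R _ _)
  · refine LinearMap.congr_fun (f := h'.toLin ∘ₗ c.ι i)
      ((β.basis i).ext fun t => ?_) x
    rw [Module.Basis.constr_basis]
    exact hh'.2 ⟨i, t⟩

theorem basis_mem (i : ℤ) (t : β.idx i) : β.basis i t ∈ c.fil (β.rank i t) i := by
  rw [β.fil_eq]
  exact Submodule.subset_span ⟨t, le_refl (β.rank i t), rfl⟩

theorem ι_mem_adjoin {k : ℕ} {i : ℤ} {x : c.V i} (hx : x ∈ c.fil k i) :
    c.ι i x ∈ B.adjoin (β.gen '' {s | β.rank s.1 s.2 ≤ k}) := by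
  rw [β.fil_eq] at hx
  refine (Submodule.span_le.2 ?_ : _ ≤ (B.adjoin _).comap (c.ι i)) hx
  rintro _ ⟨t, ht, rfl⟩
  exact GrAlg.subset_adjoin _ ⟨⟨i, t⟩, ht, rfl⟩

theorem d_gen_mem (t : Σ i, β.idx i) : B.d (β.gen t) ∈
    B.adjoin (Set.range (lin j) ∪ β.gen '' {s | β.rank s.1 s.2 < β.rank t.1 t.2}) := by
  obtain ⟨i, t⟩ := t
  have ht := β.basis_mem i t
  change B.d (c.ι i (β.basis i t)) ∈ B.adjoin (_ ∪ β.gen '' {s | β.rank s.1 s.2 < β.rank i t})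
  generalize β.rank i t = k at ht
  cases k with
  | zero =>
    exact GrAlg.subset_adjoin _ (Or.inl (c.d_zero i _ ht))
  | succ k =>
    refine GrAlg.adjoin_le_adjoin ?_ (c.d_succ k i _ ht)
    rintro _ (h | ⟨i', y, hy, rfl⟩)
    · exact GrAlg.subset_adjoin _ (Or.inl h)
    · refine GrAlg.adjoin_mono ?_ (β.ι_mem_adjoin hy)
      rintro _ ⟨s, hs, rfl⟩
      exact Or.inr ⟨s, Nat.lt_succ_of_le hs, rfl⟩

end CellBasis

/-! ### The graded algebra that underlies a standard cylinder -/

section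


variable {T : Type u}

/-- The degrees of the generators `x'`, `x''` and `sx` of a standard cylinder. -/
def cylDeg (deg : T → ℤ) : T ⊕ T ⊕ T → ℤ := Sum.elim deg (Sum.elim deg fun t => deg t + 1)

variable (O) in
/-- The free graded algebra on the generators `x'`, `x''` and `sx`. -/
abbrev cylGrAlg (deg : T → ℤ) : GrAlg O := freeGrAlg O (cylDeg deg)

variable (O) in
/-- The generator `x'`. -/
def cylFst (deg : T → ℤ) (t : T) : (cylGrAlg O deg).carrier := freeGen O (cylDeg deg) (.inl t)

variable (O) in
/-- The generator `x''`. -/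
def cylSnd (deg : T → ℤ) (t : T) : (cylGrAlg O deg).carrier :=
  freeGen O (cylDeg deg) (.inr (.inl t))

variable (O) in
/-- The generator `sx`. -/
def cylSusp (deg : T → ℤ) (t : T) : (cylGrAlg O deg).carrier :=
  freeGen O (cylDeg deg) (.inr (.inr t))

variable (O) in
/-- The generators `x'`, `x''` and `sx` for `x` of rank less than `k`. -/
def cylGens (deg : T → ℤ) (ρ : T → ℕ) (k : ℕ) : Set (cylGrAlg O deg).carrier :=
  {b | ∃ t, ρ t < k ∧ (b = cylFst O deg t ∨ b = cylSnd O deg t ∨ b = cylSusp O deg t)}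

variable {deg : T → ℤ}

theorem cylGens_mono {ρ : T → ℕ} {k l : ℕ} (h : k ≤ l) : cylGens O deg ρ k ⊆ cylGens O deg ρ l :=
  fun _ ⟨t, ht, hb⟩ => ⟨t, lt_of_lt_of_le ht h, hb⟩

theorem cylFst_mem (t : T) : cylFst O deg t ∈ (cylGrAlg O deg).gr (deg t) :=
  (freeGrAlg_isFreeOn (deg := cylDeg deg)).1 (.inl t)

theorem cylSnd_mem (t : T) : cylSnd O deg t ∈ (cylGrAlg O deg).gr (deg t) :=
  (freeGrAlg_isFreeOn (deg := cylDeg deg)).1 (.inr (.inl t))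

theorem cylSusp_mem (t : T) : cylSusp O deg t ∈ (cylGrAlg O deg).gr (deg t + 1) :=
  (freeGrAlg_isFreeOn (deg := cylDeg deg)).1 (.inr (.inr t))

theorem cylHom_ext {C : GrAlg O} {f g : (cylGrAlg O deg).Hom C}
    (h1 : ∀ t, f.toLin (cylFst O deg t) = g.toLin (cylFst O deg t))
    (h2 : ∀ t, f.toLin (cylSnd O deg t) = g.toLin (cylSnd O deg t))
    (h3 : ∀ t, f.toLin (cylSusp O deg t) = g.toLin (cylSusp O deg t)) : f = g :=
  freeGrAlg_isFreeOn.hom_ext (by rintro (t | t | t); exacts [h1 t, h2 t, h3 t])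

/-- The morphism with prescribed values on the generators `x'`, `x''` and `sx`. -/
def cylLift {C : GrAlg O} (a b : ∀ t, C.gr (deg t)) (s : ∀ t, C.gr (deg t + 1)) :
    (cylGrAlg O deg).Hom C :=
  freeLift C (Sum.elim (fun t => (a t).1) (Sum.elim (fun t => (b t).1) fun t => (s t).1))
    (by rintro (t | t | t); exacts [(a t).2, (b t).2, (s t).2])

section

variable {C : GrAlg O} (a b : ∀ t, C.gr (deg t)) (s : ∀ t, C.gr (deg t + 1))

theorem cylLift_fst (t : T) : (cylLift a b s).toLin (cylFst O deg t) = a t :=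
  freeLift_gen (deg := cylDeg deg) C _ _ (Sum.inl t)

theorem cylLift_snd (t : T) : (cylLift a b s).toLin (cylSnd O deg t) = b t :=
  freeLift_gen (deg := cylDeg deg) C _ _ (Sum.inr (Sum.inl t))

theorem cylLift_susp (t : T) : (cylLift a b s).toLin (cylSusp O deg t) = s t :=
  freeLift_gen (deg := cylDeg deg) C _ _ (Sum.inr (Sum.inr t))

end

section

variable {A : GrAlg O} {gen : T → A.carrier} (h : IsFreeOn A deg gen)

/-- The first inclusion `x ↦ x'`, for graded algebras. -/
def cylIn₁ : A.Hom (cylGrAlg O deg) := h.lift (cylFst O deg) cylFst_mem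

/-- The second inclusion `x ↦ x''`, for graded algebras. -/
def cylIn₂ : A.Hom (cylGrAlg O deg) := h.lift (cylSnd O deg) cylSnd_mem

theorem cylIn₁_gen (t : T) : (cylIn₁ h).toLin (gen t) = cylFst O deg t := h.lift_gen _ _ t

theorem cylIn₂_gen (t : T) : (cylIn₂ h).toLin (gen t) = cylSnd O deg t := h.lift_gen _ _ t

/-- The projection `x', x'' ↦ x`, `sx ↦ 0`, for graded algebras. -/
def cylProj : (cylGrAlg O deg).Hom A :=
  cylLift (fun t => ⟨gen t, h.1 t⟩) (fun t => ⟨gen t, h.1 t⟩) fun _ => 0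

theorem cylProj_fst (t : T) : (cylProj h).toLin (cylFst O deg t) = gen t := cylLift_fst _ _ _ t

theorem cylProj_snd (t : T) : (cylProj h).toLin (cylSnd O deg t) = gen t := cylLift_snd _ _ _ t

theorem cylProj_susp (t : T) : (cylProj h).toLin (cylSusp O deg t) = 0 := cylLift_susp _ _ _ t

theorem cylProj_in₁ (a : A.carrier) : (cylProj h).toLin ((cylIn₁ h).toLin a) = a := by
  have : (cylIn₁ h).comp (cylProj h) = GrAlg.Hom.id A := h.hom_ext fun t =>
    (congrArg (cylProj h).toLin (cylIn₁_gen h t)).trans (cylProj_fst h t)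
  exact congrArg (fun k : A.Hom A => k.toLin a) this

theorem cylProj_in₂ (a : A.carrier) : (cylProj h).toLin ((cylIn₂ h).toLin a) = a := by
  have : (cylIn₂ h).comp (cylProj h) = GrAlg.Hom.id A := h.hom_ext fun t =>
    (congrArg (cylProj h).toLin (cylIn₂_gen h t)).trans (cylProj_snd h t)
  exact congrArg (fun k : A.Hom A => k.toLin a) this

theorem cylIn₁_mem_adjoin {ρ : T → ℕ} {k : ℕ} {a : A.carrier}
    (ha : a ∈ A.adjoin (gen '' {s | ρ s < k})) :
    (cylIn₁ h).toLin a ∈ (cylGrAlg O deg).adjoin (cylGens O deg ρ k) := by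
  refine (cylIn₁ h).map_adjoin ?_ ha
  rintro _ ⟨s, hs, rfl⟩
  exact GrAlg.subset_adjoin _ ⟨s, hs, Or.inl (cylIn₁_gen h s)⟩

theorem cylIn₂_mem_adjoin {ρ : T → ℕ} {k : ℕ} {a : A.carrier}
    (ha : a ∈ A.adjoin (gen '' {s | ρ s < k})) :
    (cylIn₂ h).toLin a ∈ (cylGrAlg O deg).adjoin (cylGens O deg ρ k) := by
  refine (cylIn₂ h).map_adjoin ?_ ha
  rintro _ ⟨s, hs, rfl⟩
  exact GrAlg.subset_adjoin _ ⟨s, hs, Or.inr (Or.inl (cylIn₂_gen h s))⟩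

/-! ### Differentials on the cylinder -/

/-- The derivation `x' ↦ (dx)'`, `x'' ↦ (dx)''`, `sx ↦ x' - x'' - w x`. -/
def cylDer (dA : ∀ t, A.gr (deg t - 1)) (w : ∀ t, (cylGrAlg O deg).gr (deg t)) :
    (cylGrAlg O deg).Hom (path (cylGrAlg O deg)).toGrAlg :=
  freeGrAlg_isFreeOn.derivation
    (Sum.elim (fun t => (cylIn₁ h).toLin (dA t)) (Sum.elim (fun t => (cylIn₂ h).toLin (dA t))
      fun t => cylFst O deg t - cylSnd O deg t - (w t).1)) (by
    rintro (t | t | t)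
    · exact (cylIn₁ h).map_mem (dA t).2
    · exact (cylIn₂ h).map_mem (dA t).2
    · change _ ∈ (cylGrAlg O deg).gr (deg t + 1 - 1)
      rw [add_sub_cancel_right]
      exact sub_mem (sub_mem (cylFst_mem t) (cylSnd_mem t)) (w t).2)

variable (dA : ∀ t, A.gr (deg t - 1)) (w : ∀ t, (cylGrAlg O deg).gr (deg t))

theorem cylDer_fst (t : T) : (cylDer h dA w).toLin (cylFst O deg t) =
    (cylFst O deg t, (cylIn₁ h).toLin (dA t)) :=
  (freeGrAlg_isFreeOn (deg := cylDeg deg)).derivation_gen _ _ (Sum.inl t)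

theorem cylDer_snd (t : T) : (cylDer h dA w).toLin (cylSnd O deg t) =
    (cylSnd O deg t, (cylIn₂ h).toLin (dA t)) :=
  (freeGrAlg_isFreeOn (deg := cylDeg deg)).derivation_gen _ _ (Sum.inr (Sum.inl t))

theorem cylDer_susp (t : T) : (cylDer h dA w).toLin (cylSusp O deg t) =
    (cylSusp O deg t, cylFst O deg t - cylSnd O deg t - (w t).1) :=
  (freeGrAlg_isFreeOn (deg := cylDeg deg)).derivation_gen _ _ (Sum.inr (Sum.inr t))

/-- On the part generated in rank less than `k`, the derivation depends only on the data of rank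
less than `k`. -/
theorem cylDer_congr {ρ : T → ℕ} {k : ℕ} {dA dA' : ∀ t, A.gr (deg t - 1)}
    {w w' : ∀ t, (cylGrAlg O deg).gr (deg t)} (hdA : ∀ t, ρ t < k → dA t = dA' t)
    (hw : ∀ t, ρ t < k → w t = w' t) {b : (cylGrAlg O deg).carrier}
    (hb : b ∈ (cylGrAlg O deg).adjoin (cylGens O deg ρ k)) :
    (cylDer h dA w).toLin b = (cylDer h dA' w').toLin b := by
  refine GrAlg.Hom.eqOn_adjoin ?_ hb
  rintro _ ⟨t, ht, rfl | rfl | rfl⟩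
  · rw [cylDer_fst, cylDer_fst, hdA t ht]
  · rw [cylDer_snd, cylDer_snd, hdA t ht]
  · rw [cylDer_susp, cylDer_susp, hw t ht]

/-- The correction term `w x` in `d(sx) = x' - x'' - w x` is admissible: it is expressed by
generators of smaller rank, lies in the kernel of the projection, and has the differential that
makes `d(d(sx))` vanish. -/
def IsCylTerm (ρ : T → ℕ) (t : T) : Prop :=
  (w t : (cylGrAlg O deg).carrier) ∈ (cylGrAlg O deg).adjoin (cylGens O deg ρ (ρ t)) ∧
    (cylProj h).toLin (w t) = 0 ∧
    ((cylDer h dA w).toLin (w t)).2 = (cylIn₁ h).toLin (dA t) - (cylIn₂ h).toLin (dA t)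

theorem IsCylTerm.congr {ρ : T → ℕ} {t : T} {dA dA' : ∀ t, A.gr (deg t - 1)}
    {w w' : ∀ t, (cylGrAlg O deg).gr (deg t)} (hdA : ∀ s, ρ s ≤ ρ t → dA s = dA' s)
    (hw : ∀ s, ρ s ≤ ρ t → w s = w' s) (H : IsCylTerm h dA w ρ t) : IsCylTerm h dA' w' ρ t := by
  obtain ⟨h1, h2, h3⟩ := H
  rw [cylDer_congr h (fun s hs => hdA s hs.le) (fun s hs => hw s hs.le) h1] at h3
  rw [hw t le_rfl] at h1 h2 h3
  rw [hdA t le_rfl] at h3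
  exact ⟨h1, h2, h3⟩

end

section

variable {A : Alg O} {gen : T → A.carrier} (h : IsFreeOn A.toGrAlg deg gen)

/-- The differentials of the generators of an algebra. -/
def IsFreeOn.dGen (t : T) : A.gr (deg t - 1) := ⟨A.d (gen t), A.d_mem (h.1 t)⟩

variable (w : ∀ t, (cylGrAlg O deg).gr (deg t))

theorem cylDer_in₁ (a : A.carrier) : (cylDer h h.dGen w).toLin ((cylIn₁ h).toLin a) =
    ((cylIn₁ h).toLin a, (cylIn₁ h).toLin (A.d a)) := by
  have : (cylIn₁ h).comp (cylDer h h.dGen w) = gr (toPath (cylIn₁ h)) := h.hom_ext fun t =>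
    (congrArg (cylDer h h.dGen w).toLin (cylIn₁_gen h t)).trans ((cylDer_fst ..).trans
      (Prod.ext (cylIn₁_gen h t).symm rfl))
  exact congrArg (fun k : A.toGrAlg.Hom (path (cylGrAlg O deg)).toGrAlg => k.toLin a) this

theorem cylDer_in₂ (a : A.carrier) : (cylDer h h.dGen w).toLin ((cylIn₂ h).toLin a) =
    ((cylIn₂ h).toLin a, (cylIn₂ h).toLin (A.d a)) := by
  have : (cylIn₂ h).comp (cylDer h h.dGen w) = gr (toPath (cylIn₂ h)) := h.hom_ext fun t =>
    (congrArg (cylDer h h.dGen w).toLin (cylIn₂_gen h t)).trans ((cylDer_snd ..).trans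
      (Prod.ext (cylIn₂_gen h t).symm rfl))
  exact congrArg (fun k : A.toGrAlg.Hom (path (cylGrAlg O deg)).toGrAlg => k.toLin a) this

variable {w} {ρ : T → ℕ} (hw : ∀ t, IsCylTerm h h.dGen w ρ t)

/-- The standard cylinder that belongs to admissible correction terms. -/
def cylAlg : Alg O :=
  (freeGrAlg_isFreeOn (O := O) (deg := cylDeg deg)).toAlg
    (Sum.elim (fun t => (cylIn₁ h).toLin (h.dGen t)) (Sum.elim
      (fun t => (cylIn₂ h).toLin (h.dGen t))
      fun t => cylFst O deg t - cylSnd O deg t - (w t).1)) _ (by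
    rintro (t | t | t)
    · refine (congrArg Prod.snd (cylDer_in₁ h w (h.dGen t))).trans ?_
      exact (congrArg (cylIn₁ h).toLin (A.d_d _)).trans (map_zero _)
    · refine (congrArg Prod.snd (cylDer_in₂ h w (h.dGen t))).trans ?_
      exact (congrArg (cylIn₂ h).toLin (A.d_d _)).trans (map_zero _)
    · change ((cylDer h h.dGen w).toLin (cylFst O deg t - cylSnd O deg t - (w t).1)).2 = 0
      have h1 := congrArg Prod.snd (cylDer_fst h h.dGen w t)
      have h2 := congrArg Prod.snd (cylDer_snd h h.dGen w t)
      have h3 := (hw t).2.2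
      rw [map_sub, map_sub]
      change (_ : (cylGrAlg O deg).carrier) - _ - _ = 0
      exact (congrArg₂ _ (congrArg₂ _ h1 h2) h3).trans (sub_self _))

theorem cylAlg_d_susp (t : T) : (cylAlg h hw).d (cylSusp O deg t) =
    cylFst O deg t - cylSnd O deg t - (w t).1 := congrArg Prod.snd (cylDer_susp h h.dGen w t)

/-- The first inclusion of an algebra in a standard cylinder. -/
def cylAlgIn₁ : A ⟶ cylAlg h hw :=
  GrAlg.Hom.toAlgHom (B := cylAlg h hw) (cylIn₁ h)
    fun a => (congrArg Prod.snd (cylDer_in₁ h w a)).symm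

/-- The second inclusion of an algebra in a standard cylinder. -/
def cylAlgIn₂ : A ⟶ cylAlg h hw :=
  GrAlg.Hom.toAlgHom (B := cylAlg h hw) (cylIn₂ h)
    fun a => (congrArg Prod.snd (cylDer_in₂ h w a)).symm

/-- Commutation with the differential of a standard cylinder can be checked on generators. -/
theorem cylAlg_map_d {X : Alg O} (f : (cylGrAlg O deg).Hom X.toGrAlg)
    (h1 : ∀ t, f.toLin ((cylIn₁ h).toLin (A.d (gen t))) = X.d (f.toLin (cylFst O deg t)))
    (h2 : ∀ t, f.toLin ((cylIn₂ h).toLin (A.d (gen t))) = X.d (f.toLin (cylSnd O deg t)))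
    (h3 : ∀ t, f.toLin (cylFst O deg t) - f.toLin (cylSnd O deg t) - f.toLin (w t) =
      X.d (f.toLin (cylSusp O deg t))) (b : (cylGrAlg O deg).carrier) :
    f.toLin ((cylAlg h hw).d b) = X.d (f.toLin b) := by
  refine IsFreeOn.map_d (A := cylAlg h hw) (freeGrAlg_isFreeOn (O := O) (deg := cylDeg deg)) f ?_ b
  rintro (t | t | t)
  · exact (congrArg f.toLin (congrArg Prod.snd (cylDer_fst h h.dGen w t))).trans (h1 t)
  · exact (congrArg f.toLin (congrArg Prod.snd (cylDer_snd h h.dGen w t))).trans (h2 t)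
  · refine (congrArg f.toLin (cylAlg_d_susp h hw t)).trans (Eq.trans ?_ (h3 t))
    rw [map_sub, map_sub]

/-- The projection of a standard cylinder. -/
def cylAlgProj : cylAlg h hw ⟶ A :=
  GrAlg.Hom.toAlgHom (A := cylAlg h hw) (cylProj h) (cylAlg_map_d h hw _
    (fun t => by rw [cylProj_in₁]; exact congrArg A.d (cylProj_fst h t).symm)
    (fun t => by rw [cylProj_in₂]; exact congrArg A.d (cylProj_snd h t).symm)
    (fun t => by
      rw [cylProj_fst, cylProj_snd, cylProj_susp, (hw t).2.1, map_zero, sub_self, sub_zero]))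

theorem cylAlgIn₁_proj : cylAlgIn₁ h hw ≫ cylAlgProj h hw = 𝟙 A :=
  Alg.Hom.ext (LinearMap.ext (cylProj_in₁ h))

theorem cylAlgIn₂_proj : cylAlgIn₂ h hw ≫ cylAlgProj h hw = 𝟙 A :=
  Alg.Hom.ext (LinearMap.ext (cylProj_in₂ h))

theorem cylAlgProj_surjective : IsSurjective (cylAlgProj h hw) :=
  fun a => ⟨(cylIn₁ h).toLin a, cylProj_in₁ h a⟩

/-- The first inclusion of an algebra in a standard cylinder has the left lifting property with
respect to all surjections: a lift of `sx` can be chosen freely, and `d(sx) = x' - x'' - w x` then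
dictates the image of `x''`. -/
theorem cylAlgIn₁_exists_lift
    (hd : ∀ t, A.d (gen t) ∈ A.adjoin (gen '' {s | ρ s < ρ t}))
    {X Y : Alg O} {p : X ⟶ Y} (hp : IsSurjective p) (f : A ⟶ X) (g : cylAlg h hw ⟶ Y)
    (hfg : f ≫ p = cylAlgIn₁ h hw ≫ g) :
    ∃ l : cylAlg h hw ⟶ X, cylAlgIn₁ h hw ≫ l = f ∧ l ≫ p = g := by
  let g' : (cylGrAlg O deg).Hom Y.toGrAlg := gr g
  have hpd : ∀ x, lin p (X.d x) = Y.d (lin p x) := Alg.Hom.map_d p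
  have hgd : ∀ b, g'.toLin ((cylDer h h.dGen w).toLin b).2 = Y.d (g'.toLin b) := Alg.Hom.map_d g
  have hfg' : ∀ a, lin p (lin f a) = g'.toLin ((cylIn₁ h).toLin a) := fun a =>
    congrArg (fun k : A ⟶ Y => lin k a) hfg
  -- `H u` extends `f` with the values `u` on the generators `x''` and `sx`
  let H : (∀ t, X.gr (deg t) × X.gr (deg t + 1)) → (cylGrAlg O deg).Hom X.toGrAlg := fun u =>
    cylLift (C := X.toGrAlg) (fun t => ⟨lin f (gen t), (gr f).map_mem (h.1 t)⟩)
      (fun t => (u t).1) (fun t => (u t).2)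
  have H1 : ∀ u t, (H u).toLin (cylFst O deg t) = lin f (gen t) := fun u t => cylLift_fst _ _ _ t
  have H2 : ∀ u t, (H u).toLin (cylSnd O deg t) = (u t).1 := fun u t => cylLift_snd _ _ _ t
  have H3 : ∀ u t, (H u).toLin (cylSusp O deg t) = (u t).2 := fun u t => cylLift_susp _ _ _ t
  have HA : ∀ u a, (H u).toLin ((cylIn₁ h).toLin a) = lin f a := by
    intro u a
    have : (cylIn₁ h).comp (H u) = gr f := h.hom_ext fun t =>
      (congrArg (H u).toLin (cylIn₁_gen h t)).trans (H1 u t)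
    exact congrArg (fun k : A.toGrAlg.Hom X.toGrAlg => k.toLin a) this
  have Hcongr : ∀ u u' k, (∀ s, ρ s < k → u s = u' s) → ∀ b ∈ (cylGrAlg O deg).adjoin
      (cylGens O deg ρ k), (H u).toLin b = (H u').toLin b := by
    intro u u' k hu b hb
    refine GrAlg.Hom.eqOn_adjoin ?_ hb
    rintro _ ⟨s, hs, rfl | rfl | rfl⟩
    · rw [H1, H1]
    · rw [H2, H2, hu s hs]
    · rw [H3, H3, hu s hs]
  have hfd : ∀ a, lin f (A.d a) = X.d (lin f a) := Alg.Hom.map_d f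
  obtain ⟨u, hu⟩ := exists_of_rank ρ (X := fun t => X.gr (deg t) × X.gr (deg t + 1))
    (fun u t => (lin p (u t).1 = g'.toLin (cylSnd O deg t) ∧
        lin p (u t).2 = g'.toLin (cylSusp O deg t)) ∧
      (H u).toLin ((cylIn₂ h).toLin (A.d (gen t))) = X.d (u t).1 ∧
      lin f (gen t) - (u t).1 - (H u).toLin (w t) = X.d (u t).2)
    (fun u u' t huu' hu => by
      rw [← huu' t le_rfl, ← Hcongr u u' (ρ t) (fun s hs => huu' s hs.le) _
        (cylIn₂_mem_adjoin h (hd t)), ← Hcongr u u' (ρ t) (fun s hs => huu' s hs.le) _ (hw t).1]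
      exact hu)
    (fun u t hu => by
      obtain ⟨s₀, hs₀⟩ := hp (g'.toLin (cylSusp O deg t))
      let s : X.gr (deg t + 1) := ⟨X.proj (deg t + 1) s₀, GrModule.proj_mem _ _⟩
      have hs : lin p s = g'.toLin (cylSusp O deg t) := by
        have h1 := GrModule.map_proj (M := X.toGrModule) (N := Y.toGrModule) (lin p) 0
          (fun i x hx => by rw [add_zero]; exact (gr p).map_mem hx) (deg t + 1) s₀
        rw [hs₀, add_zero, GrModule.proj_self (g'.map_mem (cylSusp_mem t))] at h1
        exact h1
      have hcomm : (H u).toLin ((cylDer h h.dGen w).toLin (w t)).2 = X.d ((H u).toLin (w t)) := by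
        refine map_d_of_mem_adjoin (A := cylAlg h hw) (H u) ?_ (hw t).1
        rintro _ ⟨t', ht', rfl | rfl | rfl⟩
        · refine (congrArg (H u).toLin (congrArg Prod.snd (cylDer_fst h h.dGen w t'))).trans ?_
          exact (HA u _).trans ((hfd _).trans (congrArg X.d (H1 u t').symm))
        · refine (congrArg (H u).toLin (congrArg Prod.snd (cylDer_snd h h.dGen w t'))).trans ?_
          exact (hu t' ht').2.1.trans (congrArg X.d (H2 u t').symm)
        · refine (congrArg (H u).toLin (congrArg Prod.snd (cylDer_susp h h.dGen w t'))).trans ?_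
          refine Eq.trans ?_ ((hu t' ht').2.2.trans (congrArg X.d (H3 u t').symm))
          simp only [map_sub, H1, H2]
      rw [(hw t).2.2, map_sub, HA] at hcomm
      -- the value on `x''` that is dictated by `d(sx) = x' - x'' - w x`
      let b : X.gr (deg t) := ⟨lin f (gen t) - X.d s - (H u).toLin (w t),
        sub_mem (sub_mem ((gr f).map_mem (h.1 t)) (by
          have := X.d_mem s.2
          rwa [add_sub_cancel_right] at this)) ((H u).map_mem (w t).2)⟩
      refine ⟨(b, s), fun u' hu' hb => ?_⟩
      have hpw : lin p ((H u).toLin (w t)) = g'.toLin (w t) := by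
        refine GrAlg.Hom.eqOn_adjoin (f := (H u).comp (gr p)) (g := g') ?_ (hw t).1
        rintro _ ⟨t', ht', rfl | rfl | rfl⟩
        · refine (congrArg (lin p) (H1 u t')).trans ((hfg' _).trans ?_)
          rw [cylIn₁_gen]
        · exact (congrArg (lin p) (H2 u t')).trans (hu t' ht').1.1
        · exact (congrArg (lin p) (H3 u t')).trans (hu t' ht').1.2
      have hpb : lin p b = g'.toLin (cylSnd O deg t) := by
        have h1 := hgd (cylSusp O deg t)
        rw [congrArg Prod.snd (cylDer_susp h h.dGen w t)] at h1
        change lin p (lin f (gen t) - X.d s - (H u).toLin (w t)) = _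
        rw [map_sub, map_sub, hpd, hs, ← h1, hfg', cylIn₁_gen, hpw, map_sub, map_sub]
        abel
      rw [hb, Hcongr u' u (ρ t) hu' _ (cylIn₂_mem_adjoin h (hd t)),
        Hcongr u' u (ρ t) hu' _ (hw t).1]
      refine ⟨⟨hpb, hs⟩, ?_, ?_⟩
      · change _ = X.d (lin f (gen t) - X.d s - (H u).toLin (w t))
        rw [map_sub, map_sub, X.d_d, ← hcomm, ← hfd]
        change _ = _ - 0 - (lin f (A.d (gen t)) - _)
        rw [sub_zero, sub_sub_cancel]
        rfl
      · change lin f (gen t) - (lin f (gen t) - X.d s - (H u).toLin (w t)) - (H u).toLin (w t) =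
          X.d s
        abel)
  have hcomm : ∀ b, (H u).toLin ((cylAlg h hw).d b) = X.d ((H u).toLin b) :=
    cylAlg_map_d h hw (H u) (fun t => by rw [HA, H1, hfd]) (fun t => by rw [H2]; exact (hu t).2.1)
      (fun t => by rw [H1, H2, H3]; exact (hu t).2.2)
  refine ⟨GrAlg.Hom.toAlgHom (A := cylAlg h hw) (H u) hcomm,
    Alg.Hom.ext (LinearMap.ext (HA u)), Alg.Hom.ext (LinearMap.ext fun b => ?_)⟩
  have : (H u).comp (gr p) = g' := cylHom_ext
    (fun t => (congrArg (lin p) (H1 u t)).trans ((hfg' _).trans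
      (congrArg g'.toLin (cylIn₁_gen h t))))
    (fun t => (congrArg (lin p) (H2 u t)).trans (hu t).1.1)
    (fun t => (congrArg (lin p) (H3 u t)).trans (hu t).1.2)
  exact congrArg (fun k : (cylGrAlg O deg).Hom Y.toGrAlg => k.toLin b) this

end

end

/-! ### Consequences of the model structure -/

section

variable [ModelCategory (Alg O)]

/-- A morphism with the left lifting property with respect to all surjections is a trivial
cofibration. -/
theorem weakEquivalence_of_exists_lift
    (hfib : ∀ {X Y : Alg O} (f : X ⟶ Y), Fibration f ↔ IsSurjective f) {A B : Alg O} (i : A ⟶ B)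
    (H : ∀ {X Y : Alg O} (p : X ⟶ Y), IsSurjective p → ∀ (f : A ⟶ X) (g : B ⟶ Y),
      f ≫ p = i ≫ g → ∃ l : B ⟶ X, i ≫ l = f ∧ l ≫ p = g) : WeakEquivalence i := by
  have h1 : (fibrations (Alg O)).llp i := by
    intro X Y p hp
    refine ⟨fun {f g} sq => ?_⟩
    obtain ⟨l, hl₁, hl₂⟩ := H p ((hfib p).1 ((fibration_iff p).2 hp)) f g sq.w
    exact ⟨⟨⟨l, hl₁, hl₂⟩⟩⟩
  rw [fibrations_llp] at h1
  exact ((mem_trivialCofibrations_iff i).1 h1).2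

/-- A morphism with the left lifting property with respect to all surjective quasi-isomorphisms is a
cofibration. -/
theorem cofibration_of_exists_lift
    (hfib : ∀ {X Y : Alg O} (f : X ⟶ Y), Fibration f ↔ IsSurjective f)
    (hweq : ∀ {X Y : Alg O} (f : X ⟶ Y), WeakEquivalence f ↔ IsQuasiIso f) {A B : Alg O}
    (i : A ⟶ B) (H : ∀ {X Y : Alg O} (p : X ⟶ Y), IsSurjective p → IsQuasiIso p →
      ∀ (f : A ⟶ X) (g : B ⟶ Y), f ≫ p = i ≫ g → ∃ l : B ⟶ X, i ≫ l = f ∧ l ≫ p = g) :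
    Cofibration i := by
  have h1 : (trivialFibrations (Alg O)).llp i := by
    intro X Y p hp
    obtain ⟨hp₁, hp₂⟩ := (mem_trivialFibrations_iff p).1 hp
    refine ⟨fun {f g} sq => ?_⟩
    obtain ⟨l, hl₁, hl₂⟩ := H p ((hfib p).1 hp₁) ((hweq p).1 hp₂) f g sq.w
    exact ⟨⟨⟨l, hl₁, hl₂⟩⟩⟩
  rw [trivialFibrations_llp] at h1
  exact (cofibration_iff i).2 h1

theorem IsCellExtension.cofibration
    (hfib : ∀ {X Y : Alg O} (f : X ⟶ Y), Fibration f ↔ IsSurjective f)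
    (hweq : ∀ {X Y : Alg O} (f : X ⟶ Y), WeakEquivalence f ↔ IsQuasiIso f) {A B : Alg O}
    {i : A ⟶ B} (h : IsCellExtension i) : Cofibration i := by
  obtain ⟨c⟩ := h
  obtain ⟨β⟩ := c.nonempty_cellBasis
  exact cofibration_of_exists_lift hfib hweq i fun p hs hq f g hfg =>
    β.isFreeOver.exists_lift (fun t => β.rank t.1 t.2) β.d_gen_mem hs hq f g hfg

variable {T : Type u} {deg : T → ℤ} {ρ : T → ℕ}

/-- The projection of a standard cylinder is a quasi-isomorphism, because the first inclusion is a
trivial cofibration. -/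
theorem cylAlgProj_quasiIso
    (hfib : ∀ {X Y : Alg O} (f : X ⟶ Y), Fibration f ↔ IsSurjective f)
    (hweq : ∀ {X Y : Alg O} (f : X ⟶ Y), WeakEquivalence f ↔ IsQuasiIso f)
    {A : Alg O} {gen : T → A.carrier} (h : IsFreeOn A.toGrAlg deg gen)
    (hd : ∀ t, A.d (gen t) ∈ A.adjoin (gen '' {s | ρ s < ρ t}))
    {w : ∀ t, (cylGrAlg O deg).gr (deg t)} (hw : ∀ t, IsCylTerm h h.dGen w ρ t) :
    IsQuasiIso (cylAlgProj h hw) := by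
  have h1 : WeakEquivalence (cylAlgIn₁ h hw) := weakEquivalence_of_exists_lift hfib _
    fun p hp f g hfg => cylAlgIn₁_exists_lift h hw hd hp f g hfg
  have h2 : WeakEquivalence (cylAlgIn₁ h hw ≫ cylAlgProj h hw) := by
    rw [cylAlgIn₁_proj]; infer_instance
  exact (hweq _).1 (weakEquivalence_of_precomp (cylAlgIn₁ h hw) _)

/-! ### Existence of the correction terms -/

/-- The correction terms of a standard cylinder exist. If they are known in rank less than `k`, then
they define a standard cylinder on the algebra with the same generators in which the differentials
of the generators of rank at least `k` are replaced by zero; its projection is a surjective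
quasi-isomorphism, so that the cycle `(dx)' - (dx)''` in the kernel is the boundary of an element of
the kernel. Killing the generators of rank at least `k` moves this element to the part generated in
rank less than `k`. -/
theorem exists_cylTerms
    (hfib : ∀ {X Y : Alg O} (f : X ⟶ Y), Fibration f ↔ IsSurjective f)
    (hweq : ∀ {X Y : Alg O} (f : X ⟶ Y), WeakEquivalence f ↔ IsQuasiIso f)
    {A : Alg O} {gen : T → A.carrier} (h : IsFreeOn A.toGrAlg deg gen)
    (hd : ∀ t, A.d (gen t) ∈ A.adjoin (gen '' {s | ρ s < ρ t})) :
    ∃ w : ∀ t, (cylGrAlg O deg).gr (deg t), ∀ t, IsCylTerm h h.dGen w ρ t := by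
  refine exists_of_rank ρ (X := fun t => (cylGrAlg O deg).gr (deg t))
    (fun w t => IsCylTerm h h.dGen w ρ t)
    (fun w w' t hww' H => H.congr h (fun _ _ => rfl) hww') fun u t₀ hu => ?_
  -- the truncated algebra
  let dA : ∀ t, A.gr (deg t - 1) := fun t => if ρ t < ρ t₀ then h.dGen t else 0
  have hdA : ∀ t, ρ t < ρ t₀ → dA t = h.dGen t := fun t ht => if_pos ht
  have hdA' : ∀ t, ¬ ρ t < ρ t₀ → dA t = 0 := fun t ht => if_neg ht
  have hDA : ∀ a ∈ A.adjoin (gen '' {s | ρ s < ρ t₀}),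
      ((h.derivation (fun t => (dA t : A.carrier)) fun t => (dA t).2).toLin a).2 = A.d a := by
    intro a ha
    refine congrArg Prod.snd (GrAlg.Hom.eqOn_adjoin
      (g := gr (toPath (A := A) (GrAlg.Hom.id A.toGrAlg))) ?_ ha)
    rintro _ ⟨s, hs, rfl⟩
    refine (h.derivation_gen _ _ s).trans (Prod.ext rfl ?_)
    exact congrArg Subtype.val (hdA s hs)
  have hlow : ∀ t, ρ t < ρ t₀ → A.d (gen t) ∈ A.adjoin (gen '' {s | ρ s < ρ t₀}) := fun t ht =>
    GrAlg.adjoin_mono (Set.image_mono fun s (hs : ρ s < ρ t) => hs.trans ht) (hd t)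
  let A₀ : Alg O := h.toAlg (fun t => (dA t : A.carrier)) (fun t => (dA t).2) fun t => by
    by_cases ht : ρ t < ρ t₀
    · rw [hdA t ht]
      exact (hDA _ (hlow t ht)).trans (A.d_d _)
    · rw [hdA' t ht]
      exact congrArg Prod.snd (map_zero _)
  have hA₀d : ∀ t, A₀.d (gen t) = (dA t).1 := h.toAlg_d_gen _ _ _
  have h₀ : IsFreeOn A₀.toGrAlg deg gen := h
  have hgen₀ : h₀.dGen = dA := funext fun t => Subtype.ext (hA₀d t)
  have hd₀ : ∀ t, A₀.d (gen t) ∈ A₀.adjoin (gen '' {s | ρ s < ρ t}) := by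
    intro t
    rw [hA₀d]
    by_cases ht : ρ t < ρ t₀
    · rw [hdA t ht]; exact hd t
    · rw [hdA' t ht]; exact zero_mem _
  -- the cylinder on the truncated algebra
  let w : ∀ t, (cylGrAlg O deg).gr (deg t) := fun t => if ρ t < ρ t₀ then u t else 0
  have hwu : ∀ t, ρ t < ρ t₀ → w t = u t := fun t ht => if_pos ht
  have hwu' : ∀ t, ¬ ρ t < ρ t₀ → w t = 0 := fun t ht => if_neg ht
  have hw : ∀ t, IsCylTerm h₀ h₀.dGen w ρ t := by
    intro t
    rw [hgen₀]
    by_cases ht : ρ t < ρ t₀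
    · exact (hu t ht).congr h (fun s hs => (hdA s (lt_of_le_of_lt hs ht)).symm)
        (fun s hs => (hwu s (lt_of_le_of_lt hs ht)).symm)
    · refine ⟨?_, ?_, ?_⟩
      · rw [hwu' t ht]; exact zero_mem _
      · rw [hwu' t ht]; exact map_zero _
      · rw [hwu' t ht, hdA' t ht]
        exact (congrArg Prod.snd (map_zero _)).trans ((congrArg₂ _ (map_zero _)
          (map_zero _)).trans (sub_self _)).symm
  let C : Alg O := cylAlg h₀ hw
  let z : C.carrier := (cylIn₁ h).toLin (A.d (gen t₀)) - (cylIn₂ h).toLin (A.d (gen t₀))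
  have hz : z ∈ (cylGrAlg O deg).adjoin (cylGens O deg ρ (ρ t₀)) :=
    sub_mem (cylIn₁_mem_adjoin h (hd t₀)) (cylIn₂_mem_adjoin h (hd t₀))
  have hzdeg : z ∈ C.gr (deg t₀ - 1) :=
    sub_mem ((cylIn₁ h).map_mem (h.dGen t₀).2) ((cylIn₂ h).map_mem (h.dGen t₀).2)
  have hA₀z : A₀.d (A.d (gen t₀)) = 0 := (hDA _ (hd t₀)).trans (A.d_d _)
  have hdz : C.d z = 0 := by
    have h1 : C.d ((cylIn₁ h).toLin (A.d (gen t₀))) = 0 :=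
      (Alg.Hom.map_d (cylAlgIn₁ h₀ hw) (A.d (gen t₀))).symm.trans
        ((congrArg (cylIn₁ h).toLin hA₀z).trans (map_zero _))
    have h2 : C.d ((cylIn₂ h).toLin (A.d (gen t₀))) = 0 :=
      (Alg.Hom.map_d (cylAlgIn₂ h₀ hw) (A.d (gen t₀))).symm.trans
        ((congrArg (cylIn₂ h).toLin hA₀z).trans (map_zero _))
    exact (map_sub C.d _ _).trans ((congrArg₂ _ h1 h2).trans (sub_self _))
  have hpz : lin (cylAlgProj h₀ hw) z = A₀.d 0 := by
    refine Eq.trans ?_ (map_zero A₀.d).symm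
    exact (map_sub (cylProj h).toLin _ _).trans ((congrArg₂ _ (cylProj_in₁ h _)
      (cylProj_in₂ h _)).trans (sub_self _))
  obtain ⟨w₀, hw₀, hdw₀, hpw₀⟩ := exists_of_surjective_of_quasiIso (cylAlgProj_surjective h₀ hw)
    (cylAlgProj_quasiIso hfib hweq h₀ hd₀ hw) hzdeg (zero_mem _) hdz hpz
  -- the retraction that kills the generators of rank at least `ρ t₀`
  let r : (cylGrAlg O deg).Hom (cylGrAlg O deg) := cylLift
    (fun t => if ρ t < ρ t₀ then ⟨cylFst O deg t, cylFst_mem t⟩ else 0)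
    (fun t => if ρ t < ρ t₀ then ⟨cylSnd O deg t, cylSnd_mem t⟩ else 0)
    (fun t => if ρ t < ρ t₀ then ⟨cylSusp O deg t, cylSusp_mem t⟩ else 0)
  have r1 : ∀ t, r.toLin (cylFst O deg t) = if ρ t < ρ t₀ then cylFst O deg t else 0 := fun t => by
    refine (cylLift_fst _ _ _ t).trans ?_
    split_ifs <;> rfl
  have r2 : ∀ t, r.toLin (cylSnd O deg t) = if ρ t < ρ t₀ then cylSnd O deg t else 0 := fun t => by
    refine (cylLift_snd _ _ _ t).trans ?_
    split_ifs <;> rfl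
  have r3 : ∀ t, r.toLin (cylSusp O deg t) = if ρ t < ρ t₀ then cylSusp O deg t else 0 :=
    fun t => by
      refine (cylLift_susp _ _ _ t).trans ?_
      split_ifs <;> rfl
  have hrfix : ∀ b ∈ (cylGrAlg O deg).adjoin (cylGens O deg ρ (ρ t₀)), r.toLin b = b := by
    intro b hb
    refine GrAlg.Hom.eqOn_adjoin (f := r) (g := GrAlg.Hom.id _) ?_ hb
    rintro _ ⟨t, ht, rfl | rfl | rfl⟩
    · exact (r1 t).trans (if_pos ht)
    · exact (r2 t).trans (if_pos ht)
    · exact (r3 t).trans (if_pos ht)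
  have hrmem : ∀ b, r.toLin b ∈ (cylGrAlg O deg).adjoin (cylGens O deg ρ (ρ t₀)) := by
    intro b
    refine r.map_adjoin ?_ (mem_adjoin_freeGen b)
    have key : ∀ t b, (b = cylFst O deg t ∨ b = cylSnd O deg t ∨ b = cylSusp O deg t) →
        (if ρ t < ρ t₀ then b else 0) ∈ (cylGrAlg O deg).adjoin (cylGens O deg ρ (ρ t₀)) := by
      intro t b hb
      split_ifs with ht
      · exact GrAlg.subset_adjoin _ ⟨t, ht, hb⟩
      · exact zero_mem _
    rintro _ ⟨t | t | t, rfl⟩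
    · exact (r1 t).symm ▸ key t _ (Or.inl rfl)
    · exact (r2 t).symm ▸ key t _ (Or.inr (Or.inl rfl))
    · exact (r3 t).symm ▸ key t _ (Or.inr (Or.inr rfl))
  have hdfst : ∀ t, C.d (cylFst O deg t) = (cylIn₁ h).toLin (dA t) := fun t => by
    rw [← hgen₀]; exact congrArg Prod.snd (cylDer_fst h₀ h₀.dGen w t)
  have hdsnd : ∀ t, C.d (cylSnd O deg t) = (cylIn₂ h).toLin (dA t) := fun t => by
    rw [← hgen₀]; exact congrArg Prod.snd (cylDer_snd h₀ h₀.dGen w t)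
  have hdsusp : ∀ t, C.d (cylSusp O deg t) = cylFst O deg t - cylSnd O deg t - (w t).1 :=
    cylAlg_d_susp h₀ hw
  have hrd : ∀ b, r.toLin (C.d b) = C.d (r.toLin b) := by
    refine cylAlg_map_d (X := C) h₀ hw r (fun t => ?_) (fun t => ?_) fun t => ?_
    · refine (congrArg (fun a => r.toLin ((cylIn₁ h).toLin a)) (hA₀d t)).trans
        (Eq.trans ?_ (congrArg C.d (r1 t)).symm)
      by_cases ht : ρ t < ρ t₀
      · have h1 : r.toLin ((cylIn₁ h).toLin (dA t).1) = (cylIn₁ h).toLin (dA t).1 := by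
          rw [hdA t ht]; exact hrfix _ (cylIn₁_mem_adjoin h (hlow t ht))
        exact h1.trans ((hdfst t).symm.trans (congrArg C.d (if_pos ht).symm))
      · have h1 : r.toLin ((cylIn₁ h).toLin (dA t).1) = 0 := by
          rw [hdA' t ht]; exact (congrArg r.toLin (map_zero _)).trans (map_zero _)
        exact h1.trans ((map_zero C.d).symm.trans (congrArg C.d (if_neg ht).symm))
    · refine (congrArg (fun a => r.toLin ((cylIn₂ h).toLin a)) (hA₀d t)).trans
        (Eq.trans ?_ (congrArg C.d (r2 t)).symm)
      by_cases ht : ρ t < ρ t₀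
      · have h1 : r.toLin ((cylIn₂ h).toLin (dA t).1) = (cylIn₂ h).toLin (dA t).1 := by
          rw [hdA t ht]; exact hrfix _ (cylIn₂_mem_adjoin h (hlow t ht))
        exact h1.trans ((hdsnd t).symm.trans (congrArg C.d (if_pos ht).symm))
      · have h1 : r.toLin ((cylIn₂ h).toLin (dA t).1) = 0 := by
          rw [hdA' t ht]; exact (congrArg r.toLin (map_zero _)).trans (map_zero _)
        exact h1.trans ((map_zero C.d).symm.trans (congrArg C.d (if_neg ht).symm))
    · refine (congrArg₂ _ (congrArg₂ _ (r1 t) (r2 t)) rfl).trans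
        (Eq.trans ?_ (congrArg C.d (r3 t)).symm)
      by_cases ht : ρ t < ρ t₀
      · have h1 := hrfix _ (GrAlg.adjoin_mono (cylGens_mono ht.le) (hw t).1)
        refine (congrArg₂ _ (congrArg₂ _ (if_pos ht) (if_pos ht)) h1).trans ?_
        exact (hdsusp t).symm.trans (congrArg C.d (if_pos ht).symm)
      · have h1 : r.toLin (w t).1 = 0 := by rw [hwu' t ht]; exact map_zero _
        refine (congrArg₂ _ (congrArg₂ _ (if_neg ht) (if_neg ht)) h1).trans ?_
        refine Eq.trans ?_ ((map_zero C.d).symm.trans (congrArg C.d (if_neg ht).symm))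
        exact (sub_zero _).trans (sub_zero _)
  let rA : A.toGrAlg.Hom A.toGrAlg := h.lift (fun t => if ρ t < ρ t₀ then gen t else 0)
    fun t => by
      split_ifs
      exacts [h.1 t, zero_mem _]
  have hrA : ∀ t, rA.toLin (gen t) = if ρ t < ρ t₀ then gen t else 0 := h.lift_gen _ _
  have hprA : ∀ b, (cylProj h).toLin (r.toLin b) = rA.toLin ((cylProj h).toLin b) := by
    intro b
    have : r.comp (cylProj h) = (cylProj h).comp rA := by
      refine cylHom_ext (fun t => ?_) (fun t => ?_) fun t => ?_
      · refine (congrArg (cylProj h).toLin (r1 t)).trans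
          (Eq.trans ?_ (congrArg rA.toLin (cylProj_fst h t)).symm)
        rw [hrA]
        split_ifs
        exacts [cylProj_fst h t, map_zero _]
      · refine (congrArg (cylProj h).toLin (r2 t)).trans
          (Eq.trans ?_ (congrArg rA.toLin (cylProj_snd h t)).symm)
        rw [hrA]
        split_ifs
        exacts [cylProj_snd h t, map_zero _]
      · refine (congrArg (cylProj h).toLin (r3 t)).trans
          (Eq.trans ?_ ((congrArg rA.toLin (cylProj_susp h t)).trans (map_zero _)).symm)
        split_ifs
        exacts [cylProj_susp h t, map_zero _]
    exact congrArg (fun k : (cylGrAlg O deg).Hom A.toGrAlg => k.toLin b) this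
  -- the compatibility of `r` with the differential and the projection makes `r w₀` admissible
  refine ⟨⟨r.toLin w₀, r.map_mem hw₀⟩, fun u' hu' hut => ?_⟩
  have hval : (u' t₀ : (cylGrAlg O deg).carrier) = r.toLin w₀ := congrArg Subtype.val hut
  refine ⟨?_, ?_, ?_⟩
  · rw [hval]; exact hrmem w₀
  · exact (congrArg (cylProj h).toLin hval).trans
      ((hprA w₀).trans ((congrArg rA.toLin hpw₀).trans (map_zero _)))
  · rw [hval, cylDer_congr h (dA' := dA) (w' := w) (fun t ht => (hdA t ht).symm)
      (fun t ht => (hu' t ht).trans (hwu t ht).symm) (hrmem w₀), ← hgen₀]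
    exact (hrd w₀).symm.trans ((congrArg r.toLin hdw₀).trans (hrfix z hz))

end

/-! ### The standard cylinder on a cell algebra -/

theorem GrAlg.Hom.congr_toLin {A B : GrAlg O} {f g : A.Hom B} (h : f = g) (a : A.carrier) :
    f.toLin a = g.toLin a := by rw [h]

/-- A morphism `A ∨ A → B` that adjoins generators `sx` with differentials of the standard form is
a cell extension. -/
theorem isCellExtension_of_standard {A B : Alg O} [HasBinaryCoproduct A A] (incl : A ⨿ A ⟶ B)
    (c : CellAlgebraStructure A) (s : ∀ i, c.V i →ₗ[R] B.carrier)
    (hfree : IsFreeExtension (gr incl) (fun i => c.V (i - 1)) (fun i => s (i - 1)))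
    (h0 : ∀ i, ∀ x ∈ c.fil 0 i, B.d (s i x) - lin (coprod.inl ≫ incl) (c.ι i x) +
      lin (coprod.inr ≫ incl) (c.ι i x) ∈ B.adjoin ∅)
    (hsucc : ∀ k i, ∀ x ∈ c.fil (k + 1) i, B.d (s i x) - lin (coprod.inl ≫ incl) (c.ι i x) +
      lin (coprod.inr ≫ incl) (c.ι i x) ∈ B.adjoin {b | ∃ i, ∃ x ∈ c.fil k i,
        b = lin (coprod.inl ≫ incl) (c.ι i x) ∨ b = lin (coprod.inr ≫ incl) (c.ι i x) ∨
          b = s i x}) : IsCellExtension incl := by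
  have hin₁ : ∀ a, lin (coprod.inl ≫ incl) a ∈ Set.range (lin incl) := fun a => ⟨_, rfl⟩
  have hin₂ : ∀ a, lin (coprod.inr ≫ incl) a ∈ Set.range (lin incl) := fun a => ⟨_, rfl⟩
  have key : ∀ (S : Submodule R B.carrier) i (x : c.V i), Set.range (lin incl) ⊆ S →
      B.d (s i x) - lin (coprod.inl ≫ incl) (c.ι i x) + lin (coprod.inr ≫ incl) (c.ι i x) ∈ S →
      B.d (s i x) ∈ S := fun S i x hS hx => by
    have h := S.sub_mem (S.add_mem hx (hS (hin₁ (c.ι i x)))) (hS (hin₂ (c.ι i x)))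
    convert! h using 1
    abel
  exact ⟨{
    V := fun i => c.V (i - 1)
    ι := fun i => s (i - 1)
    isFree := hfree
    fil := fun k i => c.fil k (i - 1)
    fil_mono := fun i => c.fil_mono (i - 1)
    fil_exhaust := fun i => c.fil_exhaust (i - 1)
    free_zero := fun i => c.free_zero (i - 1)
    free_succ := fun k i => c.free_succ k (i - 1)
    d_zero := fun i x hx => key (LinearMap.range (lin incl)) _ x (fun _ h => h)
      ((gr incl).adjoin_le_range (Set.empty_subset _) (h0 _ x hx))
    d_succ := fun k i x hx => by
      refine key _ _ x (fun b hb => GrAlg.subset_adjoin _ (Or.inl hb))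
        (GrAlg.adjoin_mono ?_ (hsucc k _ x hx))
      rintro _ ⟨i, y, hy, rfl | rfl | rfl⟩
      · exact Or.inl (hin₁ _)
      · exact Or.inl (hin₂ _)
      · obtain ⟨i, rfl⟩ : ∃ l, i = l - 1 := ⟨i + 1, by ring⟩
        exact Or.inr ⟨i, y, hy, rfl⟩ }⟩

section

variable {A : Alg O} [HasBinaryCoproduct A A] {V : ℤ → Type u} [∀ i, AddCommGroup (V i)]
  [∀ i, Module R (V i)] {idx : ℤ → Type u} (b : ∀ i, Module.Basis (idx i) R (V i))

/-- The suspension `x ↦ sx` of the generating module. -/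
def cylSuspMap (i : ℤ) : V i →ₗ[R] (cylGrAlg O (Sigma.fst : (Σ i, idx i) → ℤ)).carrier :=
  (b i).constr R fun t => cylSusp O Sigma.fst ⟨i, t⟩

theorem cylSuspMap_basis (i : ℤ) (t : idx i) :
    cylSuspMap (O := O) b i (b i t) = cylSusp O Sigma.fst ⟨i, t⟩ :=
  (b i).constr_basis R _ t

/-- As a graded algebra, the standard cylinder is `A ∨ A ∨ O⟨sV⟩`. -/
theorem cylAlg_isFreeExtension {gen : (Σ i, idx i) → A.carrier}
    (h : IsFreeOn A.toGrAlg Sigma.fst gen) {ρ : (Σ i, idx i) → ℕ}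
    {w : ∀ t : Σ i, idx i, (cylGrAlg O Sigma.fst).gr t.1}
    (hw : ∀ t, IsCylTerm h h.dGen w ρ t) :
    IsFreeExtension (gr (coprod.desc (cylAlgIn₁ h hw) (cylAlgIn₂ h hw))) (fun i => V (i - 1))
      (fun i => cylSuspMap b (i - 1)) := by
  have hs : ∀ i x, cylSuspMap (O := O) b i x ∈ (cylGrAlg O Sigma.fst).gr (i + 1) := by
    intro i x
    refine (?_ : LinearMap.range (cylSuspMap (O := O) b i) ≤ (cylGrAlg O Sigma.fst).gr (i + 1))
      ⟨x, rfl⟩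
    rw [cylSuspMap, Module.Basis.constr_range, Submodule.span_le]
    rintro _ ⟨t, rfl⟩
    exact cylSusp_mem (deg := Sigma.fst) (⟨i, t⟩ : Σ i, idx i)
  refine ⟨fun i x => ?_, fun C f g hg => ?_⟩
  · have := hs (i - 1) x
    rw [sub_add_cancel] at this
    exact this
  -- reindex the values on `sV` by the degrees of `V`
  obtain ⟨g', hg'⟩ : ∃ g' : ∀ i, V i →ₗ[R] C.carrier, ∀ i, g' (i - 1) = g i :=
    ⟨Equiv.piCongrLeft (fun i => V i →ₗ[R] C.carrier) (Equiv.subRight 1) g,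
      Equiv.piCongrLeft_apply_apply (fun i => V i →ₗ[R] C.carrier) (Equiv.subRight 1) g⟩
  have hg'mem : ∀ i x, g' i x ∈ C.gr (i + 1) := by
    intro i
    obtain ⟨i, rfl⟩ : ∃ l, i = l - 1 := ⟨i + 1, by ring⟩
    intro x
    rw [hg', sub_add_cancel]
    exact hg i x
  have hsusp : ∀ k : (cylGrAlg O (Sigma.fst : (Σ i, idx i) → ℤ)).Hom C,
      (∀ i x, k.toLin (cylSuspMap b (i - 1) x) = g i x) ↔
        ∀ t : Σ i, idx i, k.toLin (cylSusp O Sigma.fst t) = g' t.1 (b t.1 t.2) := by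
    intro k
    constructor
    · rintro hk ⟨i, t⟩
      obtain ⟨i, rfl⟩ : ∃ l, i = l - 1 := ⟨i + 1, by ring⟩
      rw [← cylSuspMap_basis b, hk, hg']
    · intro hk i x
      rw [← hg']
      refine LinearMap.congr_fun (f := k.toLin ∘ₗ cylSuspMap b (i - 1))
        ((b (i - 1)).ext fun t => ?_) x
      exact (congrArg k.toLin (cylSuspMap_basis b _ t)).trans (hk ⟨i - 1, t⟩)
  have hbase : ∀ k : (cylGrAlg O (Sigma.fst : (Σ i, idx i) → ℤ)).Hom C,
      (∀ a, k.toLin (lin (coprod.desc (cylAlgIn₁ h hw) (cylAlgIn₂ h hw)) a) = f.toLin a) ↔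
        (∀ t, k.toLin (cylFst O Sigma.fst t) = f.toLin (lin coprod.inl (gen t))) ∧
          ∀ t, k.toLin (cylSnd O Sigma.fst t) = f.toLin (lin coprod.inr (gen t)) := by
    intro k
    have e₁ : ∀ a, lin (coprod.desc (cylAlgIn₁ h hw) (cylAlgIn₂ h hw)) (lin coprod.inl a) =
        (cylIn₁ h).toLin a := fun a => congrArg (fun m : A ⟶ cylAlg h hw => lin m a)
      (coprod.inl_desc (cylAlgIn₁ h hw) (cylAlgIn₂ h hw))
    have e₂ : ∀ a, lin (coprod.desc (cylAlgIn₁ h hw) (cylAlgIn₂ h hw)) (lin coprod.inr a) =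
        (cylIn₂ h).toLin a := fun a => congrArg (fun m : A ⟶ cylAlg h hw => lin m a)
      (coprod.inr_desc (cylAlgIn₁ h hw) (cylAlgIn₂ h hw))
    constructor
    · refine fun hk => ⟨fun t => ?_, fun t => ?_⟩
      · exact (congrArg k.toLin ((e₁ (gen t)).trans (cylIn₁_gen h t)).symm).trans (hk _)
      · exact (congrArg k.toLin ((e₂ (gen t)).trans (cylIn₂_gen h t)).symm).trans (hk _)
    · rintro ⟨hk₁, hk₂⟩ a
      have h₁ : (cylIn₁ h).comp k = (gr coprod.inl).comp f := h.hom_ext fun t =>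
        (congrArg k.toLin (cylIn₁_gen h t)).trans (hk₁ t)
      have h₂ : (cylIn₂ h).comp k = (gr coprod.inr).comp f := h.hom_ext fun t =>
        (congrArg k.toLin (cylIn₂_gen h t)).trans (hk₂ t)
      have : coprod.desc (cylAlgIn₁ h hw) (cylAlgIn₂ h hw) ≫
          toPath (A := cylAlg h hw) k = toPath f :=
        coprod.hom_ext
          (path_hom_ext fun a => (congrArg k.toLin (e₁ a)).trans (GrAlg.Hom.congr_toLin h₁ a))
          (path_hom_ext fun a => (congrArg k.toLin (e₂ a)).trans (GrAlg.Hom.congr_toLin h₂ a))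
      exact congrArg (fun m : A ⨿ A ⟶ path C => (lin m a).1) this
  let k₀ : (cylGrAlg O (Sigma.fst : (Σ i, idx i) → ℤ)).Hom C := cylLift
    (fun t => ⟨f.toLin (lin coprod.inl (gen t)), f.map_mem ((gr coprod.inl).map_mem (h.1 t))⟩)
    (fun t => ⟨f.toLin (lin coprod.inr (gen t)), f.map_mem ((gr coprod.inr).map_mem (h.1 t))⟩)
    (fun t => ⟨g' t.1 (b t.1 t.2), hg'mem _ _⟩)
  have hk₀₁ := (hbase k₀).2 ⟨cylLift_fst _ _ _, cylLift_snd _ _ _⟩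
  have hk₀₂ := (hsusp k₀).2 (cylLift_susp _ _ _)
  refine ⟨k₀, ⟨hk₀₁, hk₀₂⟩, fun k hk => ?_⟩
  have hk₁ := (hbase k).1 hk.1
  have hk₂ := (hbase k₀).1 hk₀₁
  exact cylHom_ext (fun t => (hk₁.1 t).trans (hk₂.1 t).symm)
    (fun t => (hk₁.2 t).trans (hk₂.2 t).symm)
    fun t => ((hsusp k).1 hk.2 t).trans ((hsusp k₀).1 hk₀₂ t).symm

end

/-- A cell algebra has a standard cylinder. Here `d(sx) - x' + x''` is the negative of the
correction term. -/
theorem exists_isStandard [ModelCategory (Alg O)]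
    (hfib : ∀ {X Y : Alg O} (f : X ⟶ Y), Fibration f ↔ IsSurjective f)
    (hweq : ∀ {X Y : Alg O} (f : X ⟶ Y), WeakEquivalence f ↔ IsQuasiIso f)
    {A : Alg O} (c : CellAlgebraStructure A) : ∃ I : Cylinder A, I.IsStandard c := by
  obtain ⟨β⟩ := c.nonempty_cellBasis
  let ρ : (Σ i, β.idx i) → ℕ := fun t => β.rank t.1 t.2
  have h : IsFreeOn A.toGrAlg (Sigma.fst : (Σ i, β.idx i) → ℤ) β.gen := β.isFreeOver.isFreeOn
  have hd : ∀ t, A.d (β.gen t) ∈ A.adjoin (β.gen '' {s | ρ s < ρ t}) := by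
    intro t
    refine GrAlg.adjoin_le_adjoin ?_ (β.d_gen_mem t)
    rintro _ (⟨x, rfl⟩ | hb)
    · exact GrAlg.nullary_mem_adjoin _ x
    · exact GrAlg.subset_adjoin _ hb
  obtain ⟨w, hw⟩ := exists_cylTerms hfib hweq h hd
  have hfree := cylAlg_isFreeExtension β.basis h hw
  let C : Alg O := cylAlg h hw
  let incl : A ⨿ A ⟶ C := coprod.desc (cylAlgIn₁ h hw) (cylAlgIn₂ h hw)
  let s : ∀ i, c.V i →ₗ[R] C.carrier := cylSuspMap β.basis
  have e₁ : ∀ t, lin (coprod.inl ≫ incl) (β.gen t) = cylFst O Sigma.fst t := fun t =>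
    (congrArg (fun m : A ⟶ C => lin m (β.gen t)) (coprod.inl_desc _ _)).trans (cylIn₁_gen h t)
  have e₂ : ∀ t, lin (coprod.inr ≫ incl) (β.gen t) = cylSnd O Sigma.fst t := fun t =>
    (congrArg (fun m : A ⟶ C => lin m (β.gen t)) (coprod.inr_desc _ _)).trans (cylIn₂_gen h t)
  have key : ∀ k i, ∀ x ∈ c.fil k i, C.d (s i x) - lin (coprod.inl ≫ incl) (c.ι i x) +
      lin (coprod.inr ≫ incl) (c.ι i x) ∈ C.adjoin (cylGens O Sigma.fst ρ k) := by
    intro k i x hx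
    let L : c.V i →ₗ[R] C.carrier := C.d ∘ₗ s i - lin (coprod.inl ≫ incl) ∘ₗ c.ι i +
      lin (coprod.inr ≫ incl) ∘ₗ c.ι i
    suffices H : c.fil k i ≤ (C.adjoin (cylGens O Sigma.fst ρ k)).comap L from H hx
    rw [β.fil_eq, Submodule.span_le]
    rintro _ ⟨t, ht, rfl⟩
    have hL : L (β.basis i t) = -(w ⟨i, t⟩).1 := by
      refine (congrArg₂ (fun p q : C.carrier => p + q) (congrArg₂ (fun p q : C.carrier => p - q)
        ((congrArg C.d (cylSuspMap_basis β.basis i t)).trans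
        (cylAlg_d_susp h hw ⟨i, t⟩)) (e₁ ⟨i, t⟩)) (e₂ ⟨i, t⟩)).trans ?_
      change (_ : (cylGrAlg O Sigma.fst).carrier) - _ - _ - _ + _ = _
      abel
    have hwt := (hw ⟨i, t⟩).1
    have hmem : -(w ⟨i, t⟩).1 ∈ C.adjoin (cylGens O Sigma.fst ρ k) :=
      neg_mem (GrAlg.adjoin_mono (cylGens_mono ht) hwt)
    change L (β.basis i t) ∈ C.adjoin _
    rw [hL]
    exact hmem
  have h0 : ∀ i, ∀ x ∈ c.fil 0 i, C.d (s i x) - lin (coprod.inl ≫ incl) (c.ι i x) +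
      lin (coprod.inr ≫ incl) (c.ι i x) ∈ C.adjoin ∅ := fun i x hx =>
    GrAlg.adjoin_mono (by rintro _ ⟨t, ht, _⟩; exact absurd ht (Nat.not_lt_zero _)) (key 0 i x hx)
  have hsucc : ∀ k i, ∀ x ∈ c.fil (k + 1) i, C.d (s i x) -
      lin (coprod.inl ≫ incl) (c.ι i x) + lin (coprod.inr ≫ incl) (c.ι i x) ∈
      C.adjoin {b | ∃ i, ∃ x ∈ c.fil k i, b = lin (coprod.inl ≫ incl) (c.ι i x) ∨
        b = lin (coprod.inr ≫ incl) (c.ι i x) ∨ b = s i x} := by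
    refine fun k i x hx => GrAlg.adjoin_mono ?_ (key (k + 1) i x hx)
    rintro b ⟨⟨l, t⟩, ht, hb⟩
    refine ⟨l, β.basis l t, ?_, ?_⟩
    · exact c.fil_mono l (Nat.le_of_lt_succ ht) (β.basis_mem l t)
    · rcases hb with hb | hb | hb
      · exact Or.inl (hb.trans (e₁ ⟨l, t⟩).symm)
      · exact Or.inr (Or.inl (hb.trans (e₂ ⟨l, t⟩).symm))
      · exact Or.inr (Or.inr (hb.trans (cylSuspMap_basis β.basis l t).symm))
  exact ⟨{
    obj := C
    incl := incl
    proj := cylAlgProj h hw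
    fac := coprod.hom_ext
      (by rw [coprod.inl_desc_assoc, coprod.inl_desc, cylAlgIn₁_proj])
      (by rw [coprod.inr_desc_assoc, coprod.inr_desc, cylAlgIn₂_proj])
    isCell := isCellExtension_of_standard incl c s hfree h0 hsucc
    surjective := cylAlgProj_surjective h hw
    quasiIso := cylAlgProj_quasiIso hfib hweq h hd hw }, s, hfree, h0, hsucc⟩

/-! ### The cone -/

namespace Cylinder

section

variable {A : Alg O} [HasBinaryCoproduct A A] [HasPushouts (Alg O)] (I : Cylinder A)
  (ε : A ⟶ ground O)

/-- The canonical map `𝟏 → CA`. -/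
def coneInl : ground O ⟶ I.cone ε := pushout.inl ε I.snd

/-- The canonical map `IA → CA`. -/
def coneInr : I.obj ⟶ I.cone ε := pushout.inr ε I.snd

theorem toCone_eq : I.toCone ε = coprod.inl ≫ I.incl ≫ I.coneInr ε := Category.assoc _ _ _

theorem coneInr_condition : coprod.inr ≫ I.incl ≫ I.coneInr ε = ε ≫ I.coneInl ε :=
  (Category.assoc _ _ _).symm.trans (pushout.condition (f := ε) (g := I.snd)).symm

theorem exists_coneDesc {X : Alg O} {f : ground O ⟶ X} {g : I.obj ⟶ X} (h : ε ≫ f = I.snd ≫ g) :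
    ∃ q : I.cone ε ⟶ X, I.coneInr ε ≫ q = g :=
  ⟨pushout.desc f g h, pushout.inr_desc f g h⟩

/-- As the ground algebra is initial, morphisms out of the cone are determined on `IA`. -/
theorem cone_hom_ext {X : Alg O} {f g : I.cone ε ⟶ X}
    (h : I.coneInr ε ≫ f = I.coneInr ε ≫ g) : f = g :=
  pushout.hom_ext ((hom_ground_ext _).trans (hom_ground_ext _).symm) h

/-- In the cone, the second copy of `A` is sent to the ground algebra, so that the image of `A ∨ A`
is contained in the image of `A`. -/
theorem incl_coneInr :
    I.incl ≫ I.coneInr ε = coprod.desc (𝟙 A) (ε ≫ unitHom A) ≫ I.toCone ε := by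
  refine coprod.hom_ext ?_ ?_
  · rw [coprod.inl_desc_assoc, Category.id_comp, toCone_eq]
  · rw [coprod.inr_desc_assoc, coneInr_condition, Category.assoc, hom_ground_ext (I.coneInl ε),
      hom_ground_ext (unitHom A ≫ I.toCone ε)]

/-- The pushout of algebras is a pushout of graded algebras, because morphisms of graded algebras
to `C` are morphisms of algebras to the cofree algebra on `C`. Hence the generators of `IA` over
`A ∨ A` freely generate the cone over `A`. -/
theorem toCone_isFreeExtension {V : ℤ → Type u} [∀ i, AddCommGroup (V i)] [∀ i, Module R (V i)]
    {ι : ∀ i, V i →ₗ[R] I.obj.carrier} (h : IsFreeExtension (gr I.incl) V ι) :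
    IsFreeExtension (gr (I.toCone ε)) V fun i => lin (I.coneInr ε) ∘ₗ ι i := by
  refine ⟨fun i x => (gr (I.coneInr ε)).map_mem (h.1 i x), fun C f g hg => ?_⟩
  -- `f` on the first copy of `A`, and the augmentation on the second
  let F : A ⨿ A ⟶ path C := coprod.desc (toPath f) (ε ≫ unitHom (path C))
  have hF₁ : coprod.inl ≫ F = toPath f := coprod.inl_desc _ _
  have hF₂ : coprod.inr ≫ F = ε ≫ unitHom (path C) := coprod.inr_desc _ _
  obtain ⟨k, ⟨hk₁, hk₂⟩, huniq⟩ := h.2 C ((gr F).comp (pathFst C)) g hg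
  have hkF : I.incl ≫ toPath k = F := path_hom_ext hk₁
  have hw : ε ≫ unitHom (path C) = I.snd ≫ toPath k := by
    rw [snd, Category.assoc, hkF, hF₂]
  obtain ⟨q, hq⟩ := I.exists_coneDesc ε hw
  have hqf : I.toCone ε ≫ q = toPath f := by
    rw [toCone_eq, Category.assoc, Category.assoc, hq, hkF, hF₁]
  refine ⟨(gr q).comp (pathFst C), ⟨fun a => ?_, fun i x => ?_⟩, fun h' hh' => ?_⟩
  · exact congrArg (fun m : A ⟶ path C => (lin m a).1) hqf
  · exact (congrArg (fun m : I.obj ⟶ path C => (lin m (ι i x)).1) hq).trans (hk₂ i x)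
  · have h1 : I.toCone ε ≫ toPath (A := I.cone ε) h' = toPath f := path_hom_ext hh'.1
    have h2 : I.incl ≫ I.coneInr ε ≫ toPath (A := I.cone ε) h' = F := by
      refine coprod.hom_ext ?_ ?_
      · rw [hF₁, ← h1, toCone_eq, Category.assoc, Category.assoc]
      · have h3 := congrArg (· ≫ toPath (A := I.cone ε) h') (I.coneInr_condition ε)
        simp only [Category.assoc] at h3
        rw [h3, hF₂, hom_ground_ext (I.coneInl ε ≫ toPath (A := I.cone ε) h')]
    have h3 : (gr (I.coneInr ε)).comp h' = k := huniq _
      ⟨fun a => congrArg (fun m : A ⨿ A ⟶ path C => (lin m a).1) h2, hh'.2⟩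
    have h4 : toPath (A := I.cone ε) h' = q := by
      refine I.cone_hom_ext ε (Eq.trans ?_ hq.symm)
      exact path_hom_ext fun b => GrAlg.Hom.congr_toLin h3 b
    exact GrAlg.Hom.ext (LinearMap.ext fun b =>
      congrArg (fun m : I.cone ε ⟶ path C => (lin m b).1) h4)

theorem toCone_isCellExtension : IsCellExtension (I.toCone ε) := by
  obtain ⟨c⟩ := I.isCell
  have hd : ∀ b, (I.cone ε).d (lin (I.coneInr ε) b) =
      lin (I.coneInr ε) (I.obj.d b) := fun b =>
    (Alg.Hom.map_d (I.coneInr ε) b).symm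
  have hr : ∀ a, lin (I.coneInr ε) (lin I.incl a) ∈ Set.range (lin (I.toCone ε)) :=
    fun a => ⟨_, (congrArg (fun m : A ⨿ A ⟶ I.cone ε => lin m a) (I.incl_coneInr ε)).symm⟩
  exact ⟨{
    V := c.V
    ι := fun i => lin (I.coneInr ε) ∘ₗ c.ι i
    isFree := I.toCone_isFreeExtension ε c.isFree
    fil := c.fil
    fil_mono := c.fil_mono
    fil_exhaust := c.fil_exhaust
    free_zero := c.free_zero
    free_succ := c.free_succ
    d_zero := fun i x hx => by
      obtain ⟨a, ha⟩ := c.d_zero i x hx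
      obtain ⟨a', ha'⟩ := hr a
      exact ⟨a', ha'.trans ((congrArg (lin (I.coneInr ε)) ha).trans (hd _).symm)⟩
    d_succ := fun k i x hx => by
      have h1 := (gr (I.coneInr ε)).map_adjoin (t := Set.range (lin (I.toCone ε)) ∪
        {b | ∃ i', ∃ y ∈ c.fil k i', b = lin (I.coneInr ε) (c.ι i' y)}) (by
          rintro _ (⟨a, rfl⟩ | ⟨i', y, hy, rfl⟩)
          · exact GrAlg.subset_adjoin _ (Or.inl (hr a))
          · exact GrAlg.subset_adjoin _ (Or.inr ⟨i', y, hy, rfl⟩)) (c.d_succ k i x hx)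
      exact (hd (c.ι i x)).symm ▸ h1 }⟩

theorem toCone_coneProj : I.toCone ε ≫ I.coneProj ε = ε := by
  have h : I.coneInr ε ≫ I.coneProj ε = I.proj ≫ ε := pushout.inr_desc _ _ _
  have h' : I.toCone ε = I.fst ≫ I.coneInr ε := rfl
  rw [h', Category.assoc, h, ← Category.assoc, fst_proj, Category.id_comp]

theorem coneInl_coneProj : I.coneInl ε ≫ I.coneProj ε = 𝟙 (ground O) := pushout.inl_desc _ _ _

theorem coneProj_surjective : IsSurjective (I.coneProj ε) := fun x =>
  ⟨lin (I.coneInl ε) x, congrArg (fun m : ground O ⟶ ground O => lin m x)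
    (I.coneInl_coneProj ε)⟩

end

variable [ModelCategory (Alg O)]

/-- The second inclusion of a cell algebra in a cylinder is a trivial cofibration, so that its
pushout `𝟏 → CA` is a weak equivalence; it is a section of `CA → 𝟏`. -/
theorem coneProj_quasiIso
    (hfib : ∀ {X Y : Alg O} (f : X ⟶ Y), Fibration f ↔ IsSurjective f)
    (hweq : ∀ {X Y : Alg O} (f : X ⟶ Y), WeakEquivalence f ↔ IsQuasiIso f)
    {A : Alg O} (hA : IsCellExtension (unitHom A)) (I : Cylinder A) (ε : A ⟶ ground O) :
    IsQuasiIso (I.coneProj ε) := by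
  have hinit : IsInitial (ground O) :=
    IsInitial.ofUniqueHom (fun A => unitHom A) fun _ f => hom_ground_ext f
  have : IsCofibrant A :=
    (isCofibrant_iff_of_isInitial (unitHom A) hinit).2 (hA.cofibration hfib hweq)
  have : Cofibration I.incl := I.isCell.cofibration hfib hweq
  have : Cofibration I.snd := by rw [snd]; infer_instance
  have : WeakEquivalence I.proj := (hweq _).2 I.quasiIso
  have : WeakEquivalence I.snd := by
    have : WeakEquivalence (I.snd ≫ I.proj) := by rw [I.snd_proj]; infer_instance
    exact weakEquivalence_of_postcomp I.snd I.proj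
  have : WeakEquivalence (I.coneInl ε) :=
    inferInstanceAs (WeakEquivalence (pushout.inl ε I.snd))
  have : WeakEquivalence (I.coneInl ε ≫ I.coneProj ε) := by
    rw [I.coneInl_coneProj ε]; infer_instance
  exact (hweq _).1 (weakEquivalence_of_precomp (I.coneInl ε) (I.coneProj ε))

end Cylinder

end CellOperad

end

theorem mainTheorem7 {R : Type u} [CommRing R] (O : CellOperad.Operad R)
    [ModelCategory (CellOperad.Alg O)]
    (hfib : ∀ {X Y : CellOperad.Alg O} (f : X ⟶ Y), Fibration f ↔ CellOperad.IsSurjective f)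
    (hweq : ∀ {X Y : CellOperad.Alg O} (f : X ⟶ Y), WeakEquivalence f ↔ CellOperad.IsQuasiIso f)
    (A : CellOperad.Alg O) (c : CellOperad.CellAlgebraStructure A)
    (ε : A ⟶ CellOperad.ground O) :
    (∃ I : CellOperad.Cylinder A, I.IsStandard c) ∧
      ∀ I : CellOperad.Cylinder A,
        CellOperad.IsCellExtension (I.toCone ε) ∧
        I.toCone ε ≫ I.coneProj ε = ε ∧
        CellOperad.IsSurjective (I.coneProj ε) ∧
        CellOperad.IsQuasiIso (I.coneProj ε) :=
  ⟨CellOperad.exists_isStandard hfib hweq c, fun I =>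
    ⟨I.toCone_isCellExtension ε, I.toCone_coneProj ε, I.coneProj_surjective ε,
      I.coneProj_quasiIso hfib hweq ⟨c⟩ ε⟩⟩
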